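/- Let $\mathbb B=\{u+\mathbf j v: u,v\in\mathbb C\}$ be the commutative algebra of bicomplex numbers ($\mathbf j^2=-1$, $i\mathbf j=\mathbf j i$), with $\operatorname{Sc}(u+\mathbf jv)=u$, $\operatorname{Vec}(u+\mathbf jv)=v$, $\overline{u+\mathbf jv}=u-\mathbf jv$, $|u+\mathbf jv|_{\mathbb B}=\sqrt{|u|^2+|v|^2}$; write $\widehat z=x+\mathbf jy$ for $z=x+iy$ and $\overline{\boldsymbol\partial}=\frac12(\partial_x+\mathbf j\partial_y)$. Let $\Omega\subset\mathbb C$ be a bounded domain, star-shaped with respect to $0\in\Omega$, and $\varrho=\sup_{z\in\Omega}|z|$. Let $q_f\in C^1[0,\varrho]$ be complex-valued and let $f\in C^2[0,\varrho]$ be a complex-valued function without zeros in $[0,\varrho]$ such that $f(0)=1$ and $f''+\frac1r f'-q_f f=0$ on $(0,\varrho)$; put $q_{1/f}=2(f'/f)^2-q_f$ and regard $f$ also as the function $z\mapsto f(|z|)$. Let $\operatorname V_f(\Omega;\mathbb B)$ be the set of all $W\in C^1(\Omega;\mathbb B)$ with $$\overline{\boldsymbol\partial}W=\frac{\overline{\boldsymbol\partial}f}{f}\,\overline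 W\quad\text{in }\Omega .$$ For $q\in\{q_f,q_{1/f}\}$ let $G=G^q$ be the kernel, continuous on $[0,\varrho]\times[0,1]$ and of class $C^2$ in the interior, determined by $$r\,(G_{rr}-q(r)G)-G_r+2(1-t)G_{rt}=0\ \text{ on }(0,\varrho)\times(0,1),\qquad G(r,0)=\int_0^r\tau q(\tau)\,d\tau,\qquad G(0,t)=0,$$ let $\mathbf T^{q}h(z)=h(z)+\int_0^1\sigma\, G^{q}(|z|,1-\sigma^2)\,h(\sigma^2z)\,d\sigma$, and let $\mathcal T_fW=\mathbf T^{q_f}\operatorname{Sc}W+\mathbf j\,\mathbf T^{q_{1/f}}\operatorname{Vec}W$. For $n\ge 0$ and $A\in\mathbb B$ the radial formal power is $$\mathcal Z_f^{(n)}(A;z)=\operatorname{Sc}(A)\,\mathcal T_f[\widehat z^{\,n}]+\operatorname{Vec}(A)\,\mathcal T_f[\mathbf j\widehat z^{\,n}],$$ and a radial formal polynomial is a sum $\sum_{n=0}^N\mathcal Z_f^{(n)}(A_n;z)$ with $N\ge0$, $A_0,\dots,A_N\in\mathbb B$, $A_N\ne0$. Theorem. The radial formal powers are a complete system of solutions of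 the Vekua equation: they belong to $\operatorname V_f(\Omega;\mathbb B)$, and for every $W\in\operatorname V_f(\Omega;\mathbb B)$ and every compact $K\subset\Omega$ there is a sequence of radial formal polynomials that converges to $W$ uniformly on $K$. If moreover $\Omega$ is the disk $\{|z|<\varrho\}$, then for every $W\in\operatorname V_f(\Omega;\mathbb B)$ there are $A_n\in\mathbb B$, $n\ge0$, such that $$W(z)=\sum_{n=0}^\infty\mathcal Z_f^{(n)}(A_n;z),\qquad z\in\Omega,$$ where the series converges absolutely at each point of $\Omega$, and both the series and the series of the norms $|\mathcal Z_f^{(n)}(A_n;z)|_{\mathbb B}$ converge uniformly on compact subsets of $\Omega$. -/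

import Mathlib

open Set Filter Topology

/-- The bicomplex numbers: pairs `(u, v)` of complex numbers, standing for `u + 𝐣 v`, with the
Euclidean norm `√(|u|² + |v|²)`. -/
def Bicomplex : Type := WithLp 2 (ℂ × ℂ)

namespace Bicomplex

noncomputable instance : NormedAddCommGroup Bicomplex :=
  inferInstanceAs (NormedAddCommGroup (WithLp 2 (ℂ × ℂ)))

noncomputable instance : NormedSpace ℂ Bicomplex :=
  inferInstanceAs (NormedSpace ℂ (WithLp 2 (ℂ × ℂ)))

/-- The bicomplex number `u + 𝐣 v`. -/
def mk (u v : ℂ) : Bicomplex := WithLp.toLp 2 (u, v)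

/-- The scalar part. -/
def sc (W : Bicomplex) : ℂ := WithLp.fst W

/-- The vectorial part. -/
def vec (W : Bicomplex) : ℂ := WithLp.snd W

theorem ext {W Z : Bicomplex} (h₁ : W.sc = Z.sc) (h₂ : W.vec = Z.vec) : W = Z :=
  WithLp.ofLp_injective 2 (Prod.ext h₁ h₂)

instance : Mul Bicomplex :=
  ⟨fun W Z => mk (W.sc * Z.sc - W.vec * Z.vec) (W.sc * Z.vec + W.vec * Z.sc)⟩

instance : One Bicomplex := ⟨mk 1 0⟩

@[simp] theorem sc_mk (u v : ℂ) : (mk u v).sc = u := rfl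
@[simp] theorem vec_mk (u v : ℂ) : (mk u v).vec = v := rfl
@[simp] theorem sc_zero : (0 : Bicomplex).sc = 0 := rfl
@[simp] theorem vec_zero : (0 : Bicomplex).vec = 0 := rfl
@[simp] theorem sc_one : (1 : Bicomplex).sc = 1 := rfl
@[simp] theorem vec_one : (1 : Bicomplex).vec = 0 := rfl
@[simp] theorem sc_add (W Z : Bicomplex) : (W + Z).sc = W.sc + Z.sc := rfl
@[simp] theorem vec_add (W Z : Bicomplex) : (W + Z).vec = W.vec + Z.vec := rfl
@[simp] theorem sc_smul (a : ℂ) (W : Bicomplex) : (a • W).sc = a * W.sc := rfl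
@[simp] theorem vec_smul (a : ℂ) (W : Bicomplex) : (a • W).vec = a * W.vec := rfl
@[simp] theorem sc_mul (W Z : Bicomplex) :
    (W * Z).sc = W.sc * Z.sc - W.vec * Z.vec := rfl
@[simp] theorem vec_mul (W Z : Bicomplex) :
    (W * Z).vec = W.sc * Z.vec + W.vec * Z.sc := rfl

theorem norm_eq (W : Bicomplex) : ‖W‖ = √(‖W.sc‖ ^ 2 + ‖W.vec‖ ^ 2) :=
  WithLp.prod_norm_eq_of_L2 (α := ℂ) (β := ℂ) W

noncomputable instance : CommRing Bicomplex :=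
  { (inferInstance : AddCommGroup Bicomplex) with
    mul := (· * ·)
    one := 1
    mul_assoc := fun a b c => ext (by simp; ring) (by simp; ring)
    one_mul := fun a => ext (by simp) (by simp)
    mul_one := fun a => ext (by simp) (by simp)
    left_distrib := fun a b c => ext (by simp; ring) (by simp; ring)
    right_distrib := fun a b c => ext (by simp; ring) (by simp; ring)
    zero_mul := fun a => ext (by simp) (by simp)
    mul_zero := fun a => ext (by simp) (by simp)
    mul_comm := fun a b => ext (by simp; ring) (by simp; ring) }

/-- The bicomplex unit `𝐣`, with `𝐣² = -1`. -/
def j : Bicomplex := mk 0 1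

/-- The inclusion of the complex scalars. -/
def ofScalar (a : ℂ) : Bicomplex := mk a 0

/-- The bicomplex conjugation `u + 𝐣 v ↦ u - 𝐣 v`. -/
def conj (W : Bicomplex) : Bicomplex := mk W.sc (-W.vec)

/-- For `z = x + i y`, the bicomplex number `ẑ = x + 𝐣 y`. -/
def hat (z : ℂ) : Bicomplex := mk (z.re : ℂ) (z.im : ℂ)

/-- The bicomplex Cauchy-Riemann operator `½ (∂/∂x + 𝐣 ∂/∂y)`. -/
noncomputable def dbar (W : ℂ → Bicomplex) (z : ℂ) : Bicomplex :=
  (1 / 2 : ℂ) • (fderiv ℝ W z 1 + j * fderiv ℝ W z Complex.I)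

end Bicomplex

namespace RadialVekua

open Bicomplex

/-- `ϱ_Ω = sup {|z| : z ∈ Ω}`. -/
noncomputable def outerRadius (Ω : Set ℂ) : ℝ := sSup ((fun z : ℂ => ‖z‖) '' Ω)

/-- The space `V_f(Ω; 𝔹)`: the `C¹` solutions in `Ω` of the main Vekua equation
`∂̄W = (∂̄f / f) W̄` with the radial coefficient function `z ↦ f(|z|)`. -/
def vekuaSolutions (Ω : Set ℂ) (f : ℝ → ℂ) : Set (ℂ → Bicomplex) :=
  {W | ContDiffOn ℝ 1 W Ω ∧ ∀ z ∈ Ω,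
    dbar W z = ((f ‖z‖)⁻¹ • dbar (fun w => ofScalar (f ‖w‖)) z) * conj (W z)}

/-- The Darboux transformed potential `q_{1/f} = 2 (f'/f)² - q_f` on `[0, R]`. -/
noncomputable def darbouxPotential (R : ℝ) (f q : ℝ → ℂ) (r : ℝ) : ℂ :=
  2 * (derivWithin f (Icc 0 R) r / f r) ^ 2 - q r

/-- `G` is the transmutation kernel on `[0, R] × [0, 1]` of the radial potential `q`: it satisfies
`r (G_rr - q G) - G_r + 2 (1 - t) G_rt = 0` with `G(r, 0) = ∫₀^r τ q(τ) dτ` and `G(0, t) = 0`.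
For `q ∈ C¹[0, R]` it is `C²` inside the rectangle and continuous up to the boundary
(its `t`-derivative need not stay bounded as `t → 1`). -/
structure IsTransmutationKernel (R : ℝ) (q : ℝ → ℂ) (G : ℝ → ℝ → ℂ) : Prop where
  continuousOn : ContinuousOn (fun p : ℝ × ℝ => G p.1 p.2) (Icc 0 R ×ˢ Icc 0 1)
  contDiffOn : ContDiffOn ℝ 2 (fun p : ℝ × ℝ => G p.1 p.2) (Ioo 0 R ×ˢ Ioo 0 1)
  pde : ∀ r ∈ Ioo 0 R, ∀ t ∈ Ioo (0 : ℝ) 1,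
    (r : ℂ) * (deriv (fun s => deriv (fun s' => G s' t) s) r - q r * G r t)
      - deriv (fun s => G s t) r
      + 2 * (1 - (t : ℂ)) * deriv (fun τ => deriv (fun s => G s τ) r) t = 0
  initial_t : ∀ r ∈ Icc 0 R, G r 0 = ∫ τ in (0 : ℝ)..r, (τ : ℂ) * q τ
  initial_r : ∀ t ∈ Icc (0 : ℝ) 1, G 0 t = 0

/-- The transmutation kernel of `q` (the conditions determine it on `[0, R] × [0, 1]`). -/
noncomputable def transmutationKernel (R : ℝ) (q : ℝ → ℂ) : ℝ → ℝ → ℂ :=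
  Classical.epsilon (IsTransmutationKernel R q)

/-- The transmutation operator of the radial Schrödinger operator with potential `q`:
`(T h)(z) = h(z) + ∫₀¹ σ G(|z|, 1 - σ²) h(σ² z) dσ`. -/
noncomputable def transmutation (R : ℝ) (q : ℝ → ℂ) (h : ℂ → ℂ) (z : ℂ) : ℂ :=
  h z + ∫ σ in (0 : ℝ)..1,
    (σ : ℂ) * transmutationKernel R q ‖z‖ (1 - σ ^ 2) * h ((σ : ℂ) ^ 2 * z)

/-- The operator `𝒯_f = T_f Sc + 𝐣 T_{1/f} Vec` on bicomplex-valued functions; `q` is the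
potential `q_f`. -/
noncomputable def vekuaTransmutation (R : ℝ) (f q : ℝ → ℂ) (W : ℂ → Bicomplex) (z : ℂ) :
    Bicomplex :=
  ofScalar (transmutation R q (fun w => (W w).sc) z)
    + j * ofScalar (transmutation R (darbouxPotential R f q) (fun w => (W w).vec) z)

/-- The radial formal power of degree `n` with coefficient `A`,
`𝒵_f^{(n)}(A; z) = Sc(A) 𝒯_f[ẑⁿ] + Vec(A) 𝒯_f[𝐣 ẑⁿ]`. -/
noncomputable def formalPower (R : ℝ) (f q : ℝ → ℂ) (n : ℕ) (A : Bicomplex) (z : ℂ) :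
    Bicomplex :=
  A.sc • vekuaTransmutation R f q (fun w => hat w ^ n) z
    + A.vec • vekuaTransmutation R f q (fun w => j * hat w ^ n) z

/-- The radial formal polynomials: the sums `∑_{n=0}^N 𝒵_f^{(n)}(A_n; z)` with `A_N ≠ 0`. -/
def formalPolynomials (R : ℝ) (f q : ℝ → ℂ) : Set (ℂ → Bicomplex) :=
  {S | ∃ (N : ℕ) (A : ℕ → Bicomplex), A N ≠ 0 ∧
    S = fun z => ∑ n ∈ Finset.range (N + 1), formalPower R f q n (A n) z}

end RadialVekua

section ParametricCalculus

variable {E : Type*} [NormedAddCommGroup E] [NormedSpace ℝ E]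

/-- A parametric integral over a compact interval is continuous in the parameter. -/
theorem continuousOn_intervalIntegral_param {X : Type*} [TopologicalSpace X]
    [FirstCountableTopology X] {s : Set X} {H : X → ℝ → E} {a b : ℝ}
    (hH : ContinuousOn (fun p : X × ℝ => H p.1 p.2) (s ×ˢ uIcc a b)) :
    ContinuousOn (fun x => ∫ t in a..b, H x t) s := by
  rw [continuousOn_iff_continuous_domRestrict]
  have hmm : min a b ≤ max a b := min_le_max
  have hc : Continuous (fun p : s × ℝ =>
      H p.1 (projIcc (min a b) (max a b) hmm p.2)) := by
    have h1 : Continuous (fun p : s × ℝ =>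
        ((p.1 : X), ((projIcc (min a b) (max a b) hmm p.2 : Icc (min a b) (max a b)) : ℝ))) := by
      fun_prop
    exact hH.comp_continuous h1 fun p => ⟨p.1.2, (projIcc (min a b) (max a b) hmm p.2).2⟩
  have h2 : Continuous (fun x : s => ∫ t in a..b,
      H x (projIcc (min a b) (max a b) hmm t)) :=
    intervalIntegral.continuous_parametric_intervalIntegral_of_continuous'
      (f := fun (x : s) t => H x (projIcc (min a b) (max a b) hmm t)) hc a b
  refine h2.congr fun x => ?_
  refine intervalIntegral.integral_congr fun t ht => ?_
  rw [projIcc_of_mem hmm ht]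

/-- A parametric integral with a moving end is continuous. -/
theorem continuousOn_intervalIntegral_param_end {X : Type*} [TopologicalSpace X]
    [FirstCountableTopology X] {s : Set X} {H : X → ℝ → E}
    (hH : ContinuousOn (fun p : X × ℝ => H p.1 p.2) (s ×ˢ univ)) (a : ℝ) :
    ContinuousOn (fun p : X × ℝ => ∫ t in a..p.2, H p.1 t) (s ×ˢ univ) := by
  rw [continuousOn_iff_continuous_domRestrict]
  have hc : Continuous (fun p : ↥(s ×ˢ (univ : Set ℝ)) × ℝ => H p.1.1.1 p.2) := by
    have h1 : Continuous (fun p : ↥(s ×ˢ (univ : Set ℝ)) × ℝ => (p.1.1.1, p.2)) := by fun_prop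
    exact hH.comp_continuous h1 fun p => ⟨p.1.2.1, mem_univ _⟩
  exact intervalIntegral.continuous_parametric_intervalIntegral_of_continuous
    (f := fun (x : ↥(s ×ˢ (univ : Set ℝ))) t => H x.1.1 t) hc (s := fun x => x.1.2) (by fun_prop)

/-- Differentiation under the integral sign for integrands with a continuous derivative. -/
theorem hasDerivAt_intervalIntegral_param {H H' : ℝ → ℝ → E} {I : Set ℝ}
    (hI : IsOpen I) {a b : ℝ}
    (hH : ContinuousOn (fun p : ℝ × ℝ => H p.1 p.2) (I ×ˢ uIcc a b))
    (hH' : ContinuousOn (fun p : ℝ × ℝ => H' p.1 p.2) (I ×ˢ uIcc a b))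
    (hd : ∀ r ∈ I, ∀ t ∈ uIcc a b, HasDerivAt (fun ρ => H ρ t) (H' r t) r) {r : ℝ} (hr : r ∈ I) :
    HasDerivAt (fun ρ => ∫ t in a..b, H ρ t) (∫ t in a..b, H' r t) r := by
  obtain ⟨ε, hε, hball⟩ := Metric.isOpen_iff.1 hI r hr
  set s : Set ℝ := Metric.closedBall r (ε / 2)
  have hsI : s ⊆ I := (Metric.closedBall_subset_ball (by linarith)).trans hball
  obtain ⟨C, hC⟩ := ((isCompact_closedBall r (ε / 2)).prod
    (isCompact_uIcc (a := a) (b := b))).exists_bound_of_continuousOn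
    (hH'.mono (prod_mono hsI le_rfl))
  have slice : ∀ {K : ℝ → ℝ → E}, ContinuousOn (fun p : ℝ × ℝ => K p.1 p.2) (I ×ˢ uIcc a b) →
      ∀ x ∈ I, ContinuousOn (K x) (uIcc a b) := fun {K} hK x hx =>
    hK.comp (f := fun t => (x, t)) (by fun_prop) fun t ht => ⟨hx, ht⟩
  have meas : ∀ {K : ℝ → ℝ → E}, ContinuousOn (fun p : ℝ × ℝ => K p.1 p.2) (I ×ˢ uIcc a b) →
      ∀ x ∈ I, MeasureTheory.AEStronglyMeasurable (K x)
        (MeasureTheory.volume.restrict (uIoc a b)) := fun {K} hK x hx =>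
    ((slice hK x hx).mono uIoc_subset_uIcc).aestronglyMeasurable measurableSet_uIoc
  refine (intervalIntegral.hasDerivAt_integral_of_dominated_loc_of_deriv_le
    (bound := fun _ => C) (F' := H') (s := s)
    (Metric.closedBall_mem_nhds r (by linarith)) ?_ ?_ (meas hH' r hr) ?_ ?_ ?_).2
  · filter_upwards [hI.mem_nhds hr] with x hx using meas hH x hx
  · exact (slice hH r hr).intervalIntegrable
  · exact Eventually.of_forall fun t ht x hx => hC (x, t) ⟨hx, uIoc_subset_uIcc ht⟩
  · exact intervalIntegrable_const
  · exact Eventually.of_forall fun t ht x hx => hd x (hsI hx) t (uIoc_subset_uIcc ht)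

/-- A function of two real variables with continuous partial derivatives is strictly
differentiable. -/
theorem hasStrictFDerivAt_of_partials {f f₁ f₂ : ℝ → ℝ → E} {U : Set (ℝ × ℝ)} (hU : IsOpen U)
    (h₁ : ∀ p ∈ U, HasDerivAt (fun x => f x p.2) (f₁ p.1 p.2) p.1)
    (h₂ : ∀ p ∈ U, HasDerivAt (fun y => f p.1 y) (f₂ p.1 p.2) p.2)
    (c₁ : ContinuousOn (fun p : ℝ × ℝ => f₁ p.1 p.2) U)
    (c₂ : ContinuousOn (fun p : ℝ × ℝ => f₂ p.1 p.2) U) {p : ℝ × ℝ} (hp : p ∈ U) :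
    HasStrictFDerivAt (fun p : ℝ × ℝ => f p.1 p.2)
      ((ContinuousLinearMap.toSpanSingleton ℝ (f₁ p.1 p.2)).coprod
        (ContinuousLinearMap.toSpanSingleton ℝ (f₂ p.1 p.2))) p := by
  have hUp := hU.mem_nhds hp
  refine hasStrictFDerivAt_uncurry_coprod (𝕜 := ℝ) (f := f) (u := p)
    (f₁ := fun x y => ContinuousLinearMap.toSpanSingleton ℝ (f₁ x y))
    (f₂ := fun x y => ContinuousLinearMap.toSpanSingleton ℝ (f₂ x y)) ?_ ?_ ?_ ?_
  · filter_upwards [hUp] with v hv using (h₁ v hv).hasFDerivAt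
  · filter_upwards [hUp] with v hv using (h₂ v hv).hasFDerivAt
  · exact (ContinuousLinearMap.toSpanSingletonCLE (𝕜 := ℝ) (E := E)).continuous.continuousAt.comp
      (f := fun p : ℝ × ℝ => f₁ p.1 p.2) (c₁.continuousAt hUp)
  · exact (ContinuousLinearMap.toSpanSingletonCLE (𝕜 := ℝ) (E := E)).continuous.continuousAt.comp
      (f := fun p : ℝ × ℝ => f₂ p.1 p.2) (c₂.continuousAt hUp)

/-- A function of two real variables whose partial derivatives are `Cⁿ` is `Cⁿ⁺¹`. -/
theorem contDiffOn_succ_of_partials {f f₁ f₂ : ℝ → ℝ → E} {U : Set (ℝ × ℝ)} (hU : IsOpen U)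
    {n : ℕ} (h₁ : ∀ p ∈ U, HasDerivAt (fun x => f x p.2) (f₁ p.1 p.2) p.1)
    (h₂ : ∀ p ∈ U, HasDerivAt (fun y => f p.1 y) (f₂ p.1 p.2) p.2)
    (c₁ : ContDiffOn ℝ n (fun p : ℝ × ℝ => f₁ p.1 p.2) U)
    (c₂ : ContDiffOn ℝ n (fun p : ℝ × ℝ => f₂ p.1 p.2) U) :
    ContDiffOn ℝ (n + 1) (fun p : ℝ × ℝ => f p.1 p.2) U := by
  have key := fun p hp => hasStrictFDerivAt_of_partials hU h₁ h₂ c₁.continuousOn c₂.continuousOn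
    (p := p) hp
  rw [contDiffOn_succ_iff_fderiv_of_isOpen hU]
  refine ⟨fun p hp => (key p hp).hasFDerivAt.differentiableAt.differentiableWithinAt, by simp, ?_⟩
  have e : ∀ p ∈ U, fderiv ℝ (fun p : ℝ × ℝ => f p.1 p.2) p =
      (ContinuousLinearMap.fst ℝ ℝ ℝ).smulRight (f₁ p.1 p.2) +
        (ContinuousLinearMap.snd ℝ ℝ ℝ).smulRight (f₂ p.1 p.2) := by
    intro p hp
    rw [(key p hp).hasFDerivAt.fderiv]
    ext <;> simp
  refine ContDiffOn.congr ?_ e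
  exact (contDiffOn_const.smulRight c₁).add (contDiffOn_const.smulRight c₂)

variable [CompleteSpace E]

/-- The primitive in the second variable of a function with a continuous derivative in the first
variable is jointly strictly differentiable. -/
theorem hasStrictFDerivAt_primitive_param {H H' : ℝ → ℝ → E} {I : Set ℝ} (hI : IsOpen I) (a : ℝ)
    (hH : ContinuousOn (fun p : ℝ × ℝ => H p.1 p.2) (I ×ˢ univ))
    (hH' : ContinuousOn (fun p : ℝ × ℝ => H' p.1 p.2) (I ×ˢ univ))
    (hd : ∀ r ∈ I, ∀ t, HasDerivAt (fun ρ => H ρ t) (H' r t) r) {r x : ℝ} (hr : r ∈ I) :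
    HasStrictFDerivAt (fun p : ℝ × ℝ => ∫ t in a..p.2, H p.1 t)
      ((ContinuousLinearMap.toSpanSingleton ℝ (∫ t in a..x, H' r t)).coprod
        (ContinuousLinearMap.toSpanSingleton ℝ (H r x))) (r, x) := by
  have slice : ∀ x ∈ I, Continuous (H x) := fun x hx =>
    hH.comp_continuous (f := fun t => (x, t)) (by fun_prop) fun t => ⟨hx, mem_univ _⟩
  refine hasStrictFDerivAt_of_partials (f := fun r x => ∫ t in a..x, H r t)
    (f₁ := fun r x => ∫ t in a..x, H' r t) (f₂ := H) (hI.prod isOpen_univ)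
    (fun p hp => ?_) (fun p hp => ?_) ?_ hH (p := (r, x)) ⟨hr, mem_univ _⟩
  · exact hasDerivAt_intervalIntegral_param hI (hH.mono (prod_mono le_rfl (subset_univ _)))
      (hH'.mono (prod_mono le_rfl (subset_univ _))) (fun r hr t _ => hd r hr t) hp.1
  · exact (slice p.1 hp.1).integral_hasStrictDerivAt a p.2 |>.hasDerivAt
  · exact continuousOn_intervalIntegral_param_end hH' a

theorem contDiffOn_primitive_param {H H' : ℝ → ℝ → E} {I : Set ℝ} (hI : IsOpen I) (a : ℝ)
    (hH : ContinuousOn (fun p : ℝ × ℝ => H p.1 p.2) (I ×ˢ univ))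
    (hH' : ContinuousOn (fun p : ℝ × ℝ => H' p.1 p.2) (I ×ˢ univ))
    (hd : ∀ r ∈ I, ∀ t, HasDerivAt (fun ρ => H ρ t) (H' r t) r) :
    ContDiffOn ℝ 1 (fun p : ℝ × ℝ => ∫ t in a..p.2, H p.1 t) (I ×ˢ univ) := by
  have slice : ∀ x ∈ I, Continuous (H x) := fun x hx =>
    hH.comp_continuous (f := fun t => (x, t)) (by fun_prop) fun t => ⟨hx, mem_univ _⟩
  refine contDiffOn_succ_of_partials (f := fun r x => ∫ t in a..x, H r t) (n := 0)
    (f₁ := fun r x => ∫ t in a..x, H' r t) (f₂ := H) (hI.prod isOpen_univ)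
    (fun p hp => ?_) (fun p hp => ?_) (contDiffOn_zero.2 ?_) (contDiffOn_zero.2 hH)
  · exact hasDerivAt_intervalIntegral_param hI (hH.mono (prod_mono le_rfl (subset_univ _)))
      (hH'.mono (prod_mono le_rfl (subset_univ _))) (fun r hr t _ => hd r hr t) hp.1
  · exact (slice p.1 hp.1).integral_hasStrictDerivAt a p.2 |>.hasDerivAt
  · exact continuousOn_intervalIntegral_param_end hH' a

/-- Leibniz' rule with a moving end. -/
theorem hasDerivAt_integral_param_end {H H' : ℝ → ℝ → E} {I : Set ℝ} (hI : IsOpen I) (a : ℝ)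
    (hH : ContinuousOn (fun p : ℝ × ℝ => H p.1 p.2) (I ×ˢ univ))
    (hH' : ContinuousOn (fun p : ℝ × ℝ => H' p.1 p.2) (I ×ˢ univ))
    (hd : ∀ r ∈ I, ∀ t, HasDerivAt (fun ρ => H ρ t) (H' r t) r) {r : ℝ} (hr : r ∈ I) :
    HasDerivAt (fun ρ => ∫ t in a..ρ, H ρ t) ((∫ t in a..r, H' r t) + H r r) r := by
  have h := (hasStrictFDerivAt_primitive_param hI a hH hH' hd (x := r) hr).hasFDerivAt.comp_hasDerivAt
    (f := fun ρ : ℝ => (ρ, ρ)) r ((hasDerivAt_id r).prodMk (hasDerivAt_id r))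
  simpa [Function.comp_def] using h

end ParametricCalculus

section Goursat

theorem abs_integral_exp_mul_abs_sub_le {L : ℝ} (hL : 0 < L) (a x : ℝ) :
    |∫ y in a..x, Real.exp (L * |y - a|)| ≤ Real.exp (L * |x - a|) / L := by
  rcases le_total a x with h | h
  · have e : ∫ y in a..x, Real.exp (L * |y - a|) = ∫ y in a..x, Real.exp (L * (y - a)) :=
      intervalIntegral.integral_congr fun y hy => by
        rw [uIcc_of_le h] at hy
        simp only [abs_of_nonneg (sub_nonneg.2 hy.1)]
    have i : ∫ y in a..x, Real.exp (L * (y - a)) = Real.exp (L * (x - a)) / L - 1 / L := by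
      rw [intervalIntegral.integral_eq_sub_of_hasDerivAt
        (f := fun y => Real.exp (L * (y - a)) / L)]
      · simp
      · intro y _
        have := (((hasDerivAt_id y).sub_const a).const_mul L).exp.div_const L
        exact this.congr_deriv (by simp [hL.ne'])
      · exact (by fun_prop : Continuous fun y => Real.exp (L * (y - a))).intervalIntegrable _ _
    have hge : 1 ≤ Real.exp (L * (x - a)) :=
      Real.one_le_exp (mul_nonneg hL.le (sub_nonneg.2 h))
    rw [e, i, abs_of_nonneg (sub_nonneg.2 h), ← sub_div, abs_of_nonneg (div_nonneg (by linarith) hL.le)]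
    gcongr
    linarith
  · have e : ∫ y in a..x, Real.exp (L * |y - a|) = ∫ y in a..x, Real.exp (L * (a - y)) :=
      intervalIntegral.integral_congr fun y hy => by
        rw [uIcc_of_ge h] at hy
        simp only [abs_sub_comm y a, abs_of_nonneg (sub_nonneg.2 hy.2)]
    have i : ∫ y in a..x, Real.exp (L * (a - y)) = 1 / L - Real.exp (L * (a - x)) / L := by
      rw [intervalIntegral.integral_eq_sub_of_hasDerivAt
        (f := fun y => -(Real.exp (L * (a - y)) / L))]
      · simp; ring
      · intro y _
        have := ((((hasDerivAt_id y).const_sub a).const_mul L).exp.div_const L).neg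
        exact this.congr_deriv (by simp [neg_div, hL.ne'])
      · exact (by fun_prop : Continuous fun y => Real.exp (L * (a - y))).intervalIntegrable _ _
    have hge : 1 ≤ Real.exp (L * (a - x)) :=
      Real.one_le_exp (mul_nonneg hL.le (sub_nonneg.2 h))
    rw [e, i, abs_sub_comm x a, abs_of_nonneg (sub_nonneg.2 h), ← sub_div, abs_div,
      abs_of_pos hL, abs_sub_comm, abs_of_nonneg (by linarith)]
    gcongr
    linarith

/-- The integral operator of the Goursat problem in scaling coordinates. -/
noncomputable def goursatOperator (κ η : ℝ → ℝ → ℂ) (a x : ℝ) : ℂ :=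
  ∫ y in a..x, ∫ l in (0 : ℝ)..1, κ l y * η (l * a) (l * y)

theorem continuous_goursatOperator_inner {κ η : ℝ → ℝ → ℂ}
    (hκ : Continuous fun p : ℝ × ℝ => κ p.1 p.2) (hη : Continuous fun p : ℝ × ℝ => η p.1 p.2) :
    Continuous fun p : ℝ × ℝ => ∫ l in (0 : ℝ)..1, κ l p.2 * η (l * p.1) (l * p.2) := by
  refine intervalIntegral.continuous_parametric_intervalIntegral_of_continuous'
    (f := fun (p : ℝ × ℝ) l => κ l p.2 * η (l * p.1) (l * p.2)) ?_ 0 1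
  have h1 : Continuous fun z : (ℝ × ℝ) × ℝ => κ z.2 z.1.2 :=
    hκ.comp (f := fun z : (ℝ × ℝ) × ℝ => (z.2, z.1.2)) (by fun_prop)
  have h2 : Continuous fun z : (ℝ × ℝ) × ℝ => η (z.2 * z.1.1) (z.2 * z.1.2) :=
    hη.comp (f := fun z : (ℝ × ℝ) × ℝ => (z.2 * z.1.1, z.2 * z.1.2)) (by fun_prop)
  exact h1.mul h2

theorem continuous_goursatOperator {κ η : ℝ → ℝ → ℂ}
    (hκ : Continuous fun p : ℝ × ℝ => κ p.1 p.2) (hη : Continuous fun p : ℝ × ℝ => η p.1 p.2) :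
    Continuous fun p : ℝ × ℝ => goursatOperator κ η p.1 p.2 := by
  have hin := continuous_goursatOperator_inner hκ hη
  have h : ∀ e : ℝ × ℝ → ℝ, Continuous e → Continuous fun p : ℝ × ℝ =>
      ∫ y in (0 : ℝ)..e p, ∫ l in (0 : ℝ)..1, κ l y * η (l * p.1) (l * y) := fun e he =>
    intervalIntegral.continuous_parametric_intervalIntegral_of_continuous
      (f := fun (p : ℝ × ℝ) y => ∫ l in (0 : ℝ)..1, κ l y * η (l * p.1) (l * y))
      (hin.comp (f := fun z : (ℝ × ℝ) × ℝ => (z.1.1, z.2)) (by fun_prop)) he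
  refine ((h _ continuous_snd).sub (h _ continuous_fst)).congr fun p => ?_
  have hc : Continuous fun y => ∫ l in (0 : ℝ)..1, κ l y * η (l * p.1) (l * y) :=
    hin.comp (f := fun y : ℝ => (p.1, y)) (by fun_prop)
  exact intervalIntegral.integral_interval_sub_left (hc.intervalIntegrable _ _)
    (hc.intervalIntegrable _ _)

theorem goursatOperator_sub {κ η η' : ℝ → ℝ → ℂ}
    (hκ : Continuous fun p : ℝ × ℝ => κ p.1 p.2) (hη : Continuous fun p : ℝ × ℝ => η p.1 p.2)
    (hη' : Continuous fun p : ℝ × ℝ => η' p.1 p.2) (a x : ℝ) :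
    goursatOperator κ η a x - goursatOperator κ η' a x =
      goursatOperator κ (fun a x => η a x - η' a x) a x := by
  unfold goursatOperator
  have hi : ∀ {η : ℝ → ℝ → ℂ}, (Continuous fun p : ℝ × ℝ => η p.1 p.2) →
      Continuous fun y => ∫ l in (0 : ℝ)..1, κ l y * η (l * a) (l * y) := fun {η} h =>
    (continuous_goursatOperator_inner hκ h).comp (f := fun y : ℝ => (a, y)) (by fun_prop)
  have hj : ∀ {η : ℝ → ℝ → ℂ}, (Continuous fun p : ℝ × ℝ => η p.1 p.2) → ∀ y,
      Continuous fun l => κ l y * η (l * a) (l * y) := fun {η} h y =>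
    (hκ.comp (f := fun l : ℝ => (l, y)) (by fun_prop)).mul
      (h.comp (f := fun l : ℝ => (l * a, l * y)) (by fun_prop))
  rw [← intervalIntegral.integral_sub ((hi hη).intervalIntegrable _ _)
    ((hi hη').intervalIntegrable _ _)]
  refine intervalIntegral.integral_congr fun y _ => ?_
  simp only
  rw [← intervalIntegral.integral_sub ((hj hη y).intervalIntegrable _ _)
    ((hj hη' y).intervalIntegrable _ _)]
  simp only [mul_sub]

theorem norm_goursatOperator_le {κ η : ℝ → ℝ → ℂ} {C M L : ℝ} (hL : 0 < L) (hM : 0 ≤ M)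
    (hC : ∀ l ∈ Icc (0 : ℝ) 1, ∀ y, ‖κ l y‖ ≤ C)
    (hη : ∀ a x, ‖η a x‖ ≤ M * Real.exp (L * |x - a|)) (a x : ℝ) :
    ‖goursatOperator κ η a x‖ ≤ C * M / L * Real.exp (L * |x - a|) := by
  have hC0 : 0 ≤ C := (norm_nonneg _).trans (hC 0 (by simp) 0)
  have hin : ∀ y, ‖∫ l in (0 : ℝ)..1, κ l y * η (l * a) (l * y)‖ ≤
      C * M * Real.exp (L * |y - a|) := by
    intro y
    have := intervalIntegral.norm_integral_le_of_norm_le_const (a := 0) (b := 1)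
      (f := fun l => κ l y * η (l * a) (l * y)) (C := C * M * Real.exp (L * |y - a|)) ?_
    · simpa using this
    · intro l hl
      rw [uIoc_of_le zero_le_one] at hl
      rw [norm_mul, mul_assoc]
      refine mul_le_mul (hC l ⟨hl.1.le, hl.2⟩ y) ((hη _ _).trans ?_) (norm_nonneg _) hC0
      refine mul_le_mul_of_nonneg_left (Real.exp_le_exp.2 (mul_le_mul_of_nonneg_left ?_ hL.le)) hM
      rw [← mul_sub, abs_mul, abs_of_pos hl.1]
      exact mul_le_of_le_one_left (abs_nonneg _) hl.2
  have h1 : ‖goursatOperator κ η a x‖ ≤ |∫ y in a..x, C * M * Real.exp (L * |y - a|)| :=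
    intervalIntegral.norm_integral_le_abs_of_norm_le (Eventually.of_forall fun y => hin y)
      ((by fun_prop : Continuous fun y => C * M * Real.exp (L * |y - a|)).intervalIntegrable _ _)
  refine h1.trans ?_
  rw [intervalIntegral.integral_const_mul, abs_mul, abs_of_nonneg (mul_nonneg hC0 hM)]
  refine (mul_le_mul_of_nonneg_left (abs_integral_exp_mul_abs_sub_le hL a x)
    (mul_nonneg hC0 hM)).trans_eq ?_
  ring

/-- The Goursat problem in scaling coordinates has a continuous solution. -/
theorem exists_goursat_solution {γ₀ κ : ℝ → ℝ → ℂ}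
    (hγ₀ : Continuous fun p : ℝ × ℝ => γ₀ p.1 p.2) (hκ : Continuous fun p : ℝ × ℝ => κ p.1 p.2)
    {B C : ℝ} (hB : ∀ a x, ‖γ₀ a x‖ ≤ B) (hC : ∀ l ∈ Icc (0 : ℝ) 1, ∀ y, ‖κ l y‖ ≤ C) :
    ∃ γ : ℝ → ℝ → ℂ, (Continuous fun p : ℝ × ℝ => γ p.1 p.2) ∧
      ∀ a x, γ a x = γ₀ a x + ∫ y in a..x, ∫ l in (0 : ℝ)..1, κ l y * γ (l * a) (l * y) := by
  have hC0 : 0 ≤ C := (norm_nonneg _).trans (hC 0 (by simp) 0)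
  have hB0 : 0 ≤ B := (norm_nonneg _).trans (hB 0 0)
  set L : ℝ := 2 * C + 1 with hLdef
  have hL : 0 < L := by positivity
  let w : ℝ × ℝ → ℝ := fun p => Real.exp (L * |p.2 - p.1|)
  have hw : Continuous w := by fun_prop
  have hw1 : ∀ p, 1 ≤ w p := fun p => Real.one_le_exp (by positivity)
  have hw0 : ∀ p, 0 < w p := fun p => Real.exp_pos _
  let lift : BoundedContinuousFunction (ℝ × ℝ) ℂ → ℝ → ℝ → ℂ := fun η a x => (w (a, x) : ℂ) * η (a, x)
  have hlift : ∀ η, Continuous fun p : ℝ × ℝ => lift η p.1 p.2 := fun η =>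
    (Complex.continuous_ofReal.comp hw).mul η.continuous
  have hliftle : ∀ η a x, ‖lift η a x‖ ≤ ‖η‖ * Real.exp (L * |x - a|) := by
    intro η a x
    simp only [lift, norm_mul, Complex.norm_real, Real.norm_eq_abs, abs_of_pos (hw0 _)]
    rw [mul_comm]
    exact mul_le_mul_of_nonneg_right (η.norm_coe_le_norm _) (hw0 _).le
  let Φ : BoundedContinuousFunction (ℝ × ℝ) ℂ → BoundedContinuousFunction (ℝ × ℝ) ℂ := fun η =>
    BoundedContinuousFunction.ofNormedAddCommGroup
      (fun p => ((w p)⁻¹ : ℝ) * (γ₀ p.1 p.2 + goursatOperator κ (lift η) p.1 p.2))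
      ((Complex.continuous_ofReal.comp (hw.inv₀ fun p => (hw0 p).ne')).mul
        (hγ₀.add (continuous_goursatOperator hκ (hlift η)))) (B + C * ‖η‖ / L) (by
        intro p
        rw [norm_mul, Complex.norm_real, Real.norm_eq_abs, abs_of_pos (inv_pos.2 (hw0 p)),
          inv_mul_le_iff₀ (hw0 p)]
        refine (norm_add_le _ _).trans ?_
        have h1 := norm_goursatOperator_le hL (norm_nonneg η) hC (hliftle η) p.1 p.2
        have h2 := hB p.1 p.2
        have h3 := mul_le_mul_of_nonneg_left (hw1 p) hB0
        change _ ≤ _ * w p at h1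
        nlinarith)
  have hΦ : ContractingWith (1 / 2) Φ := by
    refine ⟨by rw [← NNReal.coe_lt_coe]; norm_num, LipschitzWith.of_dist_le_mul fun η η' => ?_⟩
    rw [BoundedContinuousFunction.dist_le (by positivity)]
    intro p
    have hsub : Φ η p - Φ η' p = ((w p)⁻¹ : ℝ) *
        goursatOperator κ (fun a x => lift η a x - lift η' a x) p.1 p.2 := by
      rw [← goursatOperator_sub hκ (hlift η) (hlift η')]
      simp only [Φ, BoundedContinuousFunction.coe_ofNormedAddCommGroup]
      ring
    have hle : ∀ a x, ‖lift η a x - lift η' a x‖ ≤ ‖η - η'‖ * Real.exp (L * |x - a|) := by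
      intro a x
      have := hliftle (η - η') a x
      simpa only [lift, BoundedContinuousFunction.coe_sub, Pi.sub_apply, mul_sub] using this
    rw [dist_eq_norm, hsub, norm_mul, Complex.norm_real, Real.norm_eq_abs,
      abs_of_pos (inv_pos.2 (hw0 p)), inv_mul_le_iff₀ (hw0 p), dist_eq_norm]
    refine (norm_goursatOperator_le hL (norm_nonneg _) hC hle p.1 p.2).trans ?_
    rw [mul_comm]
    refine mul_le_mul_of_nonneg_left ?_ (hw0 p).le
    rw [div_le_iff₀ hL]
    have : ((1 / 2 : NNReal) : ℝ) = 1 / 2 := by norm_num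
    rw [this]
    nlinarith [norm_nonneg (η - η')]
  refine ⟨lift (hΦ.fixedPoint Φ), hlift _, fun a x => ?_⟩
  have hfix : Φ (hΦ.fixedPoint Φ) = hΦ.fixedPoint Φ := hΦ.fixedPoint_isFixedPt
  have h := DFunLike.congr_fun hfix (a, x)
  generalize hΦ.fixedPoint Φ = η at h ⊢
  simp only [Φ, BoundedContinuousFunction.coe_ofNormedAddCommGroup] at h
  have hne : ((w (a, x) : ℝ) : ℂ) ≠ 0 := by exact_mod_cast (hw0 _).ne'
  change (w (a, x) : ℂ) * η (a, x) = _ + goursatOperator κ _ a x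
  rw [← h]
  push_cast
  rw [← mul_assoc, mul_inv_cancel₀ hne, one_mul]

end Goursat

namespace RadialVekua

section CharacteristicKernel

/-- The transmutation kernel in the scaling coordinates. -/
theorem exists_scaledKernel {p : ℝ → ℂ} (hp : Continuous p) {C : ℝ} (hC : ∀ x, ‖p x‖ ≤ C) :
    ∃ γ : ℝ → ℝ → ℂ, (Continuous fun z : ℝ × ℝ => γ z.1 z.2) ∧
      ∀ a x, γ a x = (1 / 4) * (∫ l in (0 : ℝ)..1, p (a * l)) +
        ∫ y in a..x, ∫ l in (0 : ℝ)..1, (1 / 4 * (l : ℂ) * p (l * y)) * γ (l * a) (l * y) := by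
  refine exists_goursat_solution (γ₀ := fun a _ => (1 / 4) * (∫ l in (0 : ℝ)..1, p (a * l)))
    (κ := fun l y => 1 / 4 * (l : ℂ) * p (l * y)) (B := C) (C := C) ?_ (by fun_prop) ?_ ?_
  · refine continuous_const.mul ?_
    exact intervalIntegral.continuous_parametric_intervalIntegral_of_continuous'
      (f := fun (z : ℝ × ℝ) l => p (z.1 * l)) (by fun_prop) 0 1
  · intro a _
    have h0 := intervalIntegral.norm_integral_le_of_norm_le_const (a := 0) (b := 1)
      (f := fun l => p (a * l)) (C := C) fun l _ => hC _
    have hC0 := (norm_nonneg _).trans (hC 0)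
    rw [norm_mul]
    norm_num at h0 ⊢
    linarith
  · intro l hl y
    have hC0 := (norm_nonneg _).trans (hC 0)
    have h := hC (l * y)
    rw [norm_mul, norm_mul, Complex.norm_real, Real.norm_of_nonneg hl.1]
    norm_num
    nlinarith [hl.1, hl.2, norm_nonneg (p (l * y))]

variable {p : ℝ → ℂ} {γ : ℝ → ℝ → ℂ}

/-- The kernel in characteristic coordinates satisfies the integrated hyperbolic equation. -/
theorem characteristicKernel_eq
    (hγ : ∀ a x, γ a x = (1 / 4) * (∫ l in (0 : ℝ)..1, p (a * l)) +
        ∫ y in a..x, ∫ l in (0 : ℝ)..1, (1 / 4 * (l : ℂ) * p (l * y)) * γ (l * a) (l * y))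
    (a b : ℝ) :
    (a : ℂ) * γ a (a * b) = (1 / 4) * (∫ x in (0 : ℝ)..a, p x) +
      (1 / 4) * ∫ b' in (1 : ℝ)..b, ∫ a' in (0 : ℝ)..a, p (a' * b') * (a' * γ a' (a' * b')) := by
  rw [hγ, mul_add]
  congr 1
  · have := intervalIntegral.smul_integral_comp_mul_left (a := 0) (b := 1) (fun x => p x) a
    simp only [mul_zero, mul_one] at this
    rw [← this, Complex.real_smul]
    ring
  · have h1 := intervalIntegral.smul_integral_comp_mul_left (a := 1) (b := b)
      (fun y => ∫ l in (0 : ℝ)..1, (1 / 4 * (l : ℂ) * p (l * y)) * γ (l * a) (l * y)) a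
    rw [mul_one] at h1
    rw [← h1, Complex.real_smul, ← intervalIntegral.integral_const_mul,
      ← intervalIntegral.integral_const_mul, ← intervalIntegral.integral_const_mul]
    refine intervalIntegral.integral_congr fun b' _ => ?_
    have h2 := intervalIntegral.smul_integral_comp_mul_left (a := 0) (b := 1)
      (fun a' : ℝ => p (a' * b') * (a' * γ a' (a' * b'))) a
    simp only [mul_zero, mul_one] at h2
    rw [← h2, Complex.real_smul, ← intervalIntegral.integral_const_mul,
      ← intervalIntegral.integral_const_mul, ← intervalIntegral.integral_const_mul,
      ← intervalIntegral.integral_const_mul]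
    refine intervalIntegral.integral_congr fun l _ => ?_
    have e1 : l * (a * b') = a * l * b' := by ring
    rw [e1, mul_comm l a]
    push_cast
    ring

variable {k : ℝ → ℝ → ℂ}

/-- The derivative of the characteristic kernel in the first variable. -/
noncomputable def kernelFst (p : ℝ → ℂ) (k : ℝ → ℝ → ℂ) (a b : ℝ) : ℂ :=
  (1 / 4) * p a + (1 / 4) * ∫ y in (1 : ℝ)..b, p (a * y) * k a y

/-- The derivative of the characteristic kernel in the second variable. -/
noncomputable def kernelSnd (p : ℝ → ℂ) (k : ℝ → ℝ → ℂ) (a b : ℝ) : ℂ :=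
  (1 / 4) * ∫ a' in (0 : ℝ)..a, p (a' * b) * k a' b

theorem continuous_kernelFst (hp : Continuous p) (hk : Continuous fun z : ℝ × ℝ => k z.1 z.2) :
    Continuous fun z : ℝ × ℝ => kernelFst p k z.1 z.2 := by
  unfold kernelFst
  refine (continuous_const.mul (by fun_prop)).add (continuous_const.mul ?_)
  refine intervalIntegral.continuous_parametric_intervalIntegral_of_continuous
    (f := fun (z : ℝ × ℝ) b' => p (z.1 * b') * k z.1 b') ?_ continuous_snd
  exact (by fun_prop : Continuous fun w : (ℝ × ℝ) × ℝ => p (w.1.1 * w.2)).mul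
    (hk.comp (f := fun w : (ℝ × ℝ) × ℝ => (w.1.1, w.2)) (by fun_prop))

theorem continuous_kernelSnd (hp : Continuous p) (hk : Continuous fun z : ℝ × ℝ => k z.1 z.2) :
    Continuous fun z : ℝ × ℝ => kernelSnd p k z.1 z.2 := by
  unfold kernelSnd
  refine continuous_const.mul ?_
  refine intervalIntegral.continuous_parametric_intervalIntegral_of_continuous
    (f := fun (z : ℝ × ℝ) a' => p (a' * z.2) * k a' z.2) ?_ continuous_fst
  exact (by fun_prop : Continuous fun w : (ℝ × ℝ) × ℝ => p (w.2 * w.1.2)).mul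
    (hk.comp (f := fun w : (ℝ × ℝ) × ℝ => (w.2, w.1.2)) (by fun_prop))

theorem continuous_kernel_source (hp : Continuous p)
    (hk : Continuous fun z : ℝ × ℝ => k z.1 z.2) :
    Continuous fun z : ℝ × ℝ => p (z.1 * z.2) * k z.1 z.2 :=
  (by fun_prop : Continuous fun z : ℝ × ℝ => p (z.1 * z.2)).mul hk

theorem hasDerivAt_kernel_fst (hp : Continuous p) (hk : Continuous fun z : ℝ × ℝ => k z.1 z.2)
    (hkeq : ∀ a b, k a b = (1 / 4) * (∫ x in (0 : ℝ)..a, p x) +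
      (1 / 4) * ∫ b' in (1 : ℝ)..b, ∫ a' in (0 : ℝ)..a, p (a' * b') * k a' b') (a b : ℝ) :
    HasDerivAt (fun a => k a b) (kernelFst p k a b) a := by
  have hs := continuous_kernel_source hp hk
  have h1 : HasDerivAt (fun a => ∫ x in (0 : ℝ)..a, p x) (p a) a :=
    (hp.integral_hasStrictDerivAt 0 a).hasDerivAt
  have h2 : HasDerivAt (fun a => ∫ b' in (1 : ℝ)..b, ∫ a' in (0 : ℝ)..a, p (a' * b') * k a' b')
      (∫ b' in (1 : ℝ)..b, p (a * b') * k a b') a := by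
    refine hasDerivAt_intervalIntegral_param (I := univ) isOpen_univ
      (H := fun a b' => ∫ a' in (0 : ℝ)..a, p (a' * b') * k a' b')
      (H' := fun a b' => p (a * b') * k a b') ?_ hs.continuousOn ?_ (mem_univ a)
    · refine Continuous.continuousOn ?_
      exact intervalIntegral.continuous_parametric_intervalIntegral_of_continuous
        (f := fun (z : ℝ × ℝ) a' => p (a' * z.2) * k a' z.2)
        (hs.comp (f := fun w : (ℝ × ℝ) × ℝ => (w.2, w.1.2)) (by fun_prop)) continuous_fst
    · intro r _ b' _
      exact ((hs.comp (f := fun a' : ℝ => (a', b')) (by fun_prop)).integral_hasStrictDerivAt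
        0 r).hasDerivAt
  have := (h1.const_mul (1 / 4 : ℂ)).add (h2.const_mul (1 / 4 : ℂ))
  refine this.congr_of_eventuallyEq (Eventually.of_forall fun a => ?_)
  exact hkeq a b

theorem hasDerivAt_kernel_snd (hp : Continuous p) (hk : Continuous fun z : ℝ × ℝ => k z.1 z.2)
    (hkeq : ∀ a b, k a b = (1 / 4) * (∫ x in (0 : ℝ)..a, p x) +
      (1 / 4) * ∫ b' in (1 : ℝ)..b, ∫ a' in (0 : ℝ)..a, p (a' * b') * k a' b') (a b : ℝ) :
    HasDerivAt (fun b => k a b) (kernelSnd p k a b) b := by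
  have hs := continuous_kernel_source hp hk
  have hc : Continuous fun b' => ∫ a' in (0 : ℝ)..a, p (a' * b') * k a' b' :=
    intervalIntegral.continuous_parametric_intervalIntegral_of_continuous'
      (f := fun b' a' => p (a' * b') * k a' b')
      (hs.comp (f := fun w : ℝ × ℝ => (w.2, w.1)) (by fun_prop)) 0 a
  have := ((hc.integral_hasStrictDerivAt 1 b).hasDerivAt.const_mul (1 / 4 : ℂ)).const_add
    ((1 / 4) * (∫ x in (0 : ℝ)..a, p x))
  refine this.congr_of_eventuallyEq (Eventually.of_forall fun b => ?_)
  exact hkeq a b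

theorem hasDerivAt_kernelFst_snd (hp : Continuous p)
    (hk : Continuous fun z : ℝ × ℝ => k z.1 z.2) (a b : ℝ) :
    HasDerivAt (fun b => kernelFst p k a b) (1 / 4 * (p (a * b) * k a b)) b := by
  have hs := continuous_kernel_source hp hk
  exact (((hs.comp (f := fun b' : ℝ => (a, b')) (by fun_prop)).integral_hasStrictDerivAt
    1 b).hasDerivAt.const_mul (1 / 4 : ℂ)).const_add _

attribute [local irreducible] kernelFst kernelSnd

theorem hasDerivAt_kernel_comp (hp : Continuous p) (hk : Continuous fun z : ℝ × ℝ => k z.1 z.2)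
    (hkeq : ∀ a b, k a b = (1 / 4) * (∫ x in (0 : ℝ)..a, p x) +
      (1 / 4) * ∫ b' in (1 : ℝ)..b, ∫ a' in (0 : ℝ)..a, p (a' * b') * k a' b')
    {a b : ℝ → ℝ} {a' b' t : ℝ} (ha : HasDerivAt a a' t) (hb : HasDerivAt b b' t) :
    HasDerivAt (fun t => k (a t) (b t))
      ((a' : ℂ) * kernelFst p k (a t) (b t) + (b' : ℂ) * kernelSnd p k (a t) (b t)) t := by
  have hjoint := (hasStrictFDerivAt_of_partials (f := k) isOpen_univ
    (fun z _ => hasDerivAt_kernel_fst hp hk hkeq z.1 z.2)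
    (fun z _ => hasDerivAt_kernel_snd hp hk hkeq z.1 z.2)
    (continuous_kernelFst hp hk).continuousOn (continuous_kernelSnd hp hk).continuousOn
    (p := (a t, b t)) (mem_univ _)).hasFDerivAt
  refine (hjoint.comp_hasDerivAt t (ha.prodMk hb)).congr_deriv ?_
  simp [Complex.real_smul]

theorem hasDerivAt_const_div (y : ℝ) {b : ℝ} (hb : b ≠ 0) :
    HasDerivAt (fun b : ℝ => y / b) (-(y / b ^ 2)) b := by
  have := (hasDerivAt_inv hb).const_mul y
  exact (this.congr_deriv (by field_simp)).congr_of_eventuallyEq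
    (Eventually.of_forall fun x => div_eq_mul_inv _ _)

theorem contDiffOn_kernelSnd (hp : Continuous p) (hk : Continuous fun z : ℝ × ℝ => k z.1 z.2)
    (hkeq : ∀ a b, k a b = (1 / 4) * (∫ x in (0 : ℝ)..a, p x) +
      (1 / 4) * ∫ b' in (1 : ℝ)..b, ∫ a' in (0 : ℝ)..a, p (a' * b') * k a' b') :
    ContDiffOn ℝ 1 (fun z : ℝ × ℝ => kernelSnd p k z.1 z.2) (univ ×ˢ Ioi 0) := by
  have hka := continuous_kernelFst hp hk
  have hkb := continuous_kernelSnd hp hk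
  have hdiv : ContinuousOn (fun z : ℝ × ℝ => (z.2 / z.1, z.1)) (Ioi 0 ×ˢ univ) :=
    (continuousOn_snd.div continuousOn_fst fun z hz => (ne_of_gt hz.1)).prodMk continuousOn_fst
  have hk1 : ContinuousOn (fun z : ℝ × ℝ => k (z.2 / z.1) z.1) (Ioi 0 ×ˢ univ) :=
    hk.comp_continuousOn hdiv
  have hka1 : ContinuousOn (fun z : ℝ × ℝ => kernelFst p k (z.2 / z.1) z.1) (Ioi 0 ×ˢ univ) :=
    hka.comp_continuousOn hdiv
  have hkb1 : ContinuousOn (fun z : ℝ × ℝ => kernelSnd p k (z.2 / z.1) z.1) (Ioi 0 ×ˢ univ) :=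
    hkb.comp_continuousOn hdiv
  have hp1 : ContinuousOn (fun z : ℝ × ℝ => p z.2) (Ioi 0 ×ˢ univ) :=
    (hp.comp continuous_snd).continuousOn
  have hc1 : ContinuousOn (fun z : ℝ × ℝ => ((-(z.2 / z.1 ^ 2) : ℝ) : ℂ)) (Ioi 0 ×ˢ univ) :=
    Complex.continuous_ofReal.comp_continuousOn
      (continuousOn_snd.div (continuousOn_fst.pow 2) fun z hz => pow_ne_zero 2 (ne_of_gt hz.1)).neg
  have hprim : ContDiffOn ℝ 1 (fun z : ℝ × ℝ => ∫ y in (0 : ℝ)..z.2, p y * k (y / z.1) z.1)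
      (Ioi 0 ×ˢ univ) := by
    refine contDiffOn_primitive_param (H := fun b y => p y * k (y / b) b)
      (H' := fun b y => p y * (((-(y / b ^ 2) : ℝ) : ℂ) * kernelFst p k (y / b) b + kernelSnd p k (y / b) b))
      isOpen_Ioi 0 ?_ ?_ ?_
    · exact hp1.mul hk1
    · exact hp1.mul ((hc1.mul hka1).add hkb1)
    · intro b hb y
      have hb' : b ≠ 0 := ne_of_gt hb
      have := (hasDerivAt_kernel_comp hp hk hkeq (hasDerivAt_const_div y hb')
        (hasDerivAt_id b)).const_mul (p y)
      exact this.congr_deriv (by simp)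
  have hmap : ContDiffOn ℝ 1 (fun z : ℝ × ℝ => (z.2, z.1 * z.2)) (univ ×ˢ Ioi 0) := by fun_prop
  have hcomp : ContDiffOn ℝ 1 (fun z : ℝ × ℝ => ∫ y in (0 : ℝ)..(z.1 * z.2), p y * k (y / z.2) z.2)
      (univ ×ˢ Ioi 0) := hprim.comp hmap fun z hz => ⟨hz.2, mem_univ _⟩
  have hinv : ContDiffOn ℝ 1 (fun z : ℝ × ℝ => (z.2)⁻¹) (univ ×ˢ Ioi 0) :=
    contDiffOn_snd.inv fun z hz => ne_of_gt hz.2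
  have hprod : ContDiffOn ℝ 1 (fun z : ℝ × ℝ =>
      (1 / 4 : ℂ) * (z.2⁻¹ • ∫ y in (0 : ℝ)..(z.1 * z.2), p y * k (y / z.2) z.2)) (univ ×ˢ Ioi 0) :=
    contDiffOn_const.mul (hinv.smul hcomp)
  refine hprod.congr fun z hz => ?_
  have hz2 : z.2 ≠ 0 := ne_of_gt hz.2
  have := intervalIntegral.inv_smul_integral_comp_div (a := 0) (b := z.1 * z.2)
    (fun a' => p (a' * z.2) * k a' z.2) z.2
  rw [zero_div, mul_div_cancel_right₀ _ hz2] at this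
  unfold kernelSnd
  rw [← this]
  simp only [div_mul_cancel₀ _ hz2]

theorem contDiffOn_kernelFst (hp : Continuous p) (hk : Continuous fun z : ℝ × ℝ => k z.1 z.2)
    (hkeq : ∀ a b, k a b = (1 / 4) * (∫ x in (0 : ℝ)..a, p x) +
      (1 / 4) * ∫ b' in (1 : ℝ)..b, ∫ a' in (0 : ℝ)..a, p (a' * b') * k a' b')
    {X : ℝ} (hpd : ContDiffOn ℝ 1 p (Ioo 0 X)) :
    ContDiffOn ℝ 1 (fun z : ℝ × ℝ => kernelFst p k z.1 z.2) (Ioo 0 X ×ˢ univ) := by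
  have hka := continuous_kernelFst hp hk
  have hkb := continuous_kernelSnd hp hk
  have hdiv : ContinuousOn (fun z : ℝ × ℝ => (z.1, z.2 / z.1)) (Ioi 0 ×ˢ univ) :=
    continuousOn_fst.prodMk (continuousOn_snd.div continuousOn_fst fun z hz => (ne_of_gt hz.1))
  have hk1 : ContinuousOn (fun z : ℝ × ℝ => k z.1 (z.2 / z.1)) (Ioi 0 ×ˢ univ) :=
    hk.comp_continuousOn hdiv
  have hka1 : ContinuousOn (fun z : ℝ × ℝ => kernelFst p k z.1 (z.2 / z.1)) (Ioi 0 ×ˢ univ) :=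
    hka.comp_continuousOn hdiv
  have hkb1 : ContinuousOn (fun z : ℝ × ℝ => kernelSnd p k z.1 (z.2 / z.1)) (Ioi 0 ×ˢ univ) :=
    hkb.comp_continuousOn hdiv
  have hp1 : ContinuousOn (fun z : ℝ × ℝ => p z.2) (Ioi 0 ×ˢ univ) :=
    (hp.comp continuous_snd).continuousOn
  have hc1 : ContinuousOn (fun z : ℝ × ℝ => ((-(z.2 / z.1 ^ 2) : ℝ) : ℂ)) (Ioi 0 ×ˢ univ) :=
    Complex.continuous_ofReal.comp_continuousOn
      (continuousOn_snd.div (continuousOn_fst.pow 2) fun z hz => pow_ne_zero 2 (ne_of_gt hz.1)).neg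
  have hprim : ContDiffOn ℝ 1 (fun z : ℝ × ℝ => ∫ y in (0 : ℝ)..z.2, p y * k z.1 (y / z.1))
      (Ioi 0 ×ˢ univ) := by
    refine contDiffOn_primitive_param (H := fun a y => p y * k a (y / a))
      (H' := fun a y => p y * (kernelFst p k a (y / a) + ((-(y / a ^ 2) : ℝ) : ℂ) * kernelSnd p k a (y / a)))
      isOpen_Ioi 0 ?_ ?_ ?_
    · exact hp1.mul hk1
    · exact hp1.mul (hka1.add (hc1.mul hkb1))
    · intro b hb y
      have hb' : b ≠ 0 := ne_of_gt hb
      have := (hasDerivAt_kernel_comp hp hk hkeq (hasDerivAt_id b)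
        (hasDerivAt_const_div y hb')).const_mul (p y)
      exact this.congr_deriv (by simp)
  have hcomp1 : ContDiffOn ℝ 1 (fun z : ℝ × ℝ => ∫ y in (0 : ℝ)..(z.1 * z.2), p y * k z.1 (y / z.1))
      (Ioo 0 X ×ˢ univ) :=
    hprim.comp (f := fun z : ℝ × ℝ => (z.1, z.1 * z.2)) (by fun_prop)
      fun z hz => ⟨hz.1.1, mem_univ _⟩
  have hcomp2 : ContDiffOn ℝ 1 (fun z : ℝ × ℝ => ∫ y in (0 : ℝ)..z.1, p y * k z.1 (y / z.1))
      (Ioo 0 X ×ˢ univ) :=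
    hprim.comp (f := fun z : ℝ × ℝ => (z.1, z.1)) (by fun_prop)
      fun z hz => ⟨hz.1.1, mem_univ _⟩
  have hinv : ContDiffOn ℝ 1 (fun z : ℝ × ℝ => (z.1)⁻¹) (Ioo 0 X ×ˢ univ) :=
    contDiffOn_fst.inv fun z hz => ne_of_gt hz.1.1
  have hp2 : ContDiffOn ℝ 1 (fun z : ℝ × ℝ => p z.1) (Ioo 0 X ×ˢ univ) :=
    hpd.comp contDiffOn_fst fun z hz => hz.1
  have hsum : ContDiffOn ℝ 1 (fun z : ℝ × ℝ => (1 / 4 : ℂ) * p z.1 + (1 / 4 : ℂ) * (z.1⁻¹ •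
      ((∫ y in (0 : ℝ)..(z.1 * z.2), p y * k z.1 (y / z.1)) -
        ∫ y in (0 : ℝ)..z.1, p y * k z.1 (y / z.1)))) (Ioo 0 X ×ˢ univ) :=
    (contDiffOn_const.mul hp2).add (contDiffOn_const.mul (hinv.smul (hcomp1.sub hcomp2)))
  refine hsum.congr fun z hz => ?_
  have hz1 : z.1 ≠ 0 := ne_of_gt hz.1.1
  have := intervalIntegral.inv_smul_integral_comp_div (a := z.1) (b := z.1 * z.2)
    (fun b' => p (z.1 * b') * k z.1 b') z.1
  rw [div_self hz1, mul_div_cancel_left₀ _ hz1] at this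
  have hc : Continuous fun y => p y * k z.1 (y / z.1) :=
    hp.mul (hk.comp (f := fun y : ℝ => (z.1, y / z.1)) (by fun_prop))
  unfold kernelFst
  rw [← this, intervalIntegral.integral_interval_sub_left (hc.intervalIntegrable _ _)
    (hc.intervalIntegrable _ _)]
  simp only [mul_div_cancel₀ _ hz1]

end CharacteristicKernel

end RadialVekua

namespace RadialVekua

section KernelExistence

/-- A transmutation kernel from a solution of the Goursat problem in scaling coordinates. -/
theorem isTransmutationKernel_of_scaled {R : ℝ} {q p : ℝ → ℂ} {γ : ℝ → ℝ → ℂ}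
    (hp : Continuous p) (hpq : ∀ r ∈ Icc 0 R, p (r ^ 2) = q r)
    (hpd : ContDiffOn ℝ 1 p (Ioo 0 (R ^ 2)))
    (hγc : Continuous fun z : ℝ × ℝ => γ z.1 z.2)
    (hγ : ∀ a x, γ a x = (1 / 4) * (∫ l in (0 : ℝ)..1, p (a * l)) +
        ∫ y in a..x, ∫ l in (0 : ℝ)..1, (1 / 4 * (l : ℂ) * p (l * y)) * γ (l * a) (l * y)) :
    IsTransmutationKernel R q (fun r t => 2 * (r : ℂ) ^ 2 * γ (r ^ 2 * (1 - t)) (r ^ 2)) := by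
  set k : ℝ → ℝ → ℂ := fun a b => (a : ℂ) * γ a (a * b) with hkdef
  have hkc : Continuous fun z : ℝ × ℝ => k z.1 z.2 :=
    (by fun_prop : Continuous fun z : ℝ × ℝ => (z.1 : ℂ)).mul
      (hγc.comp (f := fun z : ℝ × ℝ => (z.1, z.1 * z.2)) (by fun_prop))
  have hkeq : ∀ a b, k a b = (1 / 4) * (∫ x in (0 : ℝ)..a, p x) +
      (1 / 4) * ∫ b' in (1 : ℝ)..b, ∫ a' in (0 : ℝ)..a, p (a' * b') * k a' b' :=
    characteristicKernel_eq hγ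
  have hGk : ∀ r t : ℝ, t < 1 → 2 * (r : ℂ) ^ 2 * γ (r ^ 2 * (1 - t)) (r ^ 2) =
      2 * ((1 - t)⁻¹ : ℝ) * k (r ^ 2 * (1 - t)) (1 - t)⁻¹ := by
    intro r t ht
    have h1 : (1 - t : ℝ) ≠ 0 := by linarith
    have h1' : (1 - t : ℂ) ≠ 0 := by exact_mod_cast h1
    simp only [hkdef]
    rw [mul_assoc (r ^ 2) (1 - t), mul_inv_cancel₀ h1, mul_one]
    push_cast
    field_simp
  have hGr : ∀ r t : ℝ, t < 1 →
      HasDerivAt (fun s : ℝ => 2 * (s : ℂ) ^ 2 * γ (s ^ 2 * (1 - t)) (s ^ 2))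
        (4 * r * kernelFst p k (r ^ 2 * (1 - t)) (1 - t)⁻¹) r := by
    intro r t ht
    have h1 : (1 - t : ℂ) ≠ 0 := by
      have : (1 - t : ℝ) ≠ 0 := by linarith
      exact_mod_cast this
    have hpath : HasDerivAt (fun s : ℝ => s ^ 2 * (1 - t)) (2 * r * (1 - t)) r := by
      simpa using (hasDerivAt_pow 2 r).mul_const (1 - t)
    have := (hasDerivAt_kernel_comp hp hkc hkeq hpath
      (hasDerivAt_const r (1 - t)⁻¹)).const_mul (2 * ((1 - t)⁻¹ : ℝ) : ℂ)
    refine (this.congr_deriv ?_).congr_of_eventuallyEq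
      (Eventually.of_forall fun s => hGk s t ht)
    push_cast
    field_simp
    ring
  have hkab : ∀ r ∈ Ioo 0 R, ∀ t ∈ Ioo (0 : ℝ) 1,
      r ^ 2 * (1 - t) ∈ Ioo 0 (R ^ 2) ∧ (1 - t)⁻¹ ∈ Ioi (0 : ℝ) := by
    intro r hr t ht
    have h1 : 0 < 1 - t := by linarith [ht.2]
    have h2 : 0 < r ^ 2 := pow_pos hr.1 2
    have h3 : r ^ 2 < R ^ 2 := pow_lt_pow_left₀ hr.2 hr.1.le two_ne_zero
    exact ⟨⟨by positivity, by nlinarith [ht.1]⟩, inv_pos.2 h1⟩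
  refine ⟨?_, ?_, ?_, ?_, ?_⟩
  · refine Continuous.continuousOn ?_
    exact (by fun_prop : Continuous fun z : ℝ × ℝ => 2 * (z.1 : ℂ) ^ 2).mul
      (hγc.comp (f := fun z : ℝ × ℝ => (z.1 ^ 2 * (1 - z.2), z.1 ^ 2)) (by fun_prop))
  · have hk2 : ContDiffOn ℝ 2 (fun z : ℝ × ℝ => k z.1 z.2) (Ioo 0 (R ^ 2) ×ˢ Ioi 0) := by
      refine contDiffOn_succ_of_partials (n := 1) (isOpen_Ioo.prod isOpen_Ioi)
        (fun z _ => hasDerivAt_kernel_fst hp hkc hkeq z.1 z.2)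
        (fun z _ => hasDerivAt_kernel_snd hp hkc hkeq z.1 z.2) ?_ ?_
      · exact (contDiffOn_kernelFst hp hkc hkeq hpd).mono (prod_mono le_rfl (subset_univ _))
      · exact (contDiffOn_kernelSnd hp hkc hkeq).mono (prod_mono (subset_univ _) le_rfl)
    have hinv : ContDiffOn ℝ 2 (fun z : ℝ × ℝ => (1 - z.2)⁻¹) (Ioo 0 R ×ˢ Ioo 0 1) :=
      (contDiffOn_const.sub contDiffOn_snd).inv fun z hz => by
        have := hz.2.2
        linarith
    have hmap : ContDiffOn ℝ 2 (fun z : ℝ × ℝ => (z.1 ^ 2 * (1 - z.2), (1 - z.2)⁻¹))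
        (Ioo 0 R ×ˢ Ioo 0 1) := ContDiffOn.prodMk (by fun_prop) hinv
    have hcomp : ContDiffOn ℝ 2 (fun z : ℝ × ℝ => k (z.1 ^ 2 * (1 - z.2)) (1 - z.2)⁻¹)
        (Ioo 0 R ×ˢ Ioo 0 1) := hk2.comp hmap fun z hz => hkab z.1 hz.1 z.2 hz.2
    have hc : ContDiffOn ℝ 2 (fun z : ℝ × ℝ => (((1 - z.2)⁻¹ : ℝ) : ℂ)) (Ioo 0 R ×ˢ Ioo 0 1) :=
      Complex.ofRealCLM.contDiff.comp_contDiffOn hinv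
    have hprod : ContDiffOn ℝ 2 (fun z : ℝ × ℝ => 2 * (((1 - z.2)⁻¹ : ℝ) : ℂ) *
        k (z.1 ^ 2 * (1 - z.2)) (1 - z.2)⁻¹) (Ioo 0 R ×ˢ Ioo 0 1) :=
      (contDiffOn_const.mul hc).mul hcomp
    exact hprod.congr fun z hz => hGk z.1 z.2 hz.2.2
  · intro r hr t ht
    obtain ⟨hα, hb⟩ := hkab r hr t ht
    have h1 : (1 - t : ℝ) ≠ 0 := by linarith [ht.2]
    have h1' : (1 - t : ℂ) ≠ 0 := by exact_mod_cast h1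
    set α := r ^ 2 * (1 - t)
    set b := (1 - t)⁻¹ with hbdef
    have hdiff : DifferentiableAt ℝ (fun z : ℝ × ℝ => kernelFst p k z.1 z.2) (α, b) :=
      ((contDiffOn_kernelFst hp hkc hkeq hpd).differentiableOn one_ne_zero).differentiableAt
        ((isOpen_Ioo.prod isOpen_univ).mem_nhds ⟨hα, mem_univ _⟩)
    set D := fderiv ℝ (fun z : ℝ × ℝ => kernelFst p k z.1 z.2) (α, b)
    have hD2 : D (0, 1) = 1 / 4 * (p (α * b) * k α b) := by
      have hpath : HasDerivAt (fun b' : ℝ => (α, b')) (0, 1) b :=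
        (hasDerivAt_const b α).prodMk (hasDerivAt_id b)
      exact (hdiff.hasFDerivAt.comp_hasDerivAt b hpath).unique
        (hasDerivAt_kernelFst_snd hp hkc α b)
    have hDlin : ∀ x y : ℝ, D (x, y) = (x : ℂ) * D (1, 0) + y * (1 / 4 * (p (α * b) * k α b)) := by
      intro x y
      have : ((x, y) : ℝ × ℝ) = x • ((1, 0) : ℝ × ℝ) + y • ((0, 1) : ℝ × ℝ) := by simp
      rw [this, map_add, map_smul, map_smul, hD2, Complex.real_smul, Complex.real_smul]
    have hαb : α * b = r ^ 2 := by
      simp only [α, hbdef]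
      field_simp
    have hfirst : ∀ s τ : ℝ, τ < 1 →
        deriv (fun s' : ℝ => 2 * (s' : ℂ) ^ 2 * γ (s' ^ 2 * (1 - τ)) (s' ^ 2)) s =
          4 * s * kernelFst p k (s ^ 2 * (1 - τ)) (1 - τ)⁻¹ := fun s τ hτ => (hGr s τ hτ).deriv
    have hrr : deriv (fun s => deriv (fun s' : ℝ => 2 * (s' : ℂ) ^ 2 *
        γ (s' ^ 2 * (1 - t)) (s' ^ 2)) s) r =
        4 * kernelFst p k α b + 8 * (r : ℂ) ^ 2 * (1 - t) * D (1, 0) := by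
      have hpath : HasDerivAt (fun s : ℝ => (s ^ 2 * (1 - t), (1 - t)⁻¹)) (2 * r * (1 - t), 0) r := by
        refine HasDerivAt.prodMk ?_ (hasDerivAt_const _ _)
        simpa using (hasDerivAt_pow 2 r).mul_const (1 - t)
      have hk' := hdiff.hasFDerivAt.comp_hasDerivAt r hpath
      have hlin : HasDerivAt (fun s : ℝ => 4 * (s : ℂ)) 4 r := by
        simpa using (Complex.ofRealCLM.hasDerivAt (x := r)).const_mul (4 : ℂ)
      have := hlin.mul hk'
      rw [show (fun s => deriv (fun s' : ℝ => 2 * (s' : ℂ) ^ 2 *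
        γ (s' ^ 2 * (1 - t)) (s' ^ 2)) s) =
        fun s : ℝ => 4 * s * kernelFst p k (s ^ 2 * (1 - t)) (1 - t)⁻¹ from
        funext fun s => hfirst s t ht.2]
      refine (HasDerivAt.deriv this).trans ?_
      change 4 * kernelFst p k α b + 4 * r * D (2 * r * (1 - t), 0) = _
      rw [hDlin]
      push_cast
      ring
    have hrt : deriv (fun τ => deriv (fun s' : ℝ => 2 * (s' : ℂ) ^ 2 *
        γ (s' ^ 2 * (1 - τ)) (s' ^ 2)) r) t =
        4 * r * (-(r : ℂ) ^ 2 * D (1, 0) + ((1 - t : ℂ) ^ 2)⁻¹ * (1 / 4 * (q r * k α b))) := by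
      have hpath : HasDerivAt (fun τ : ℝ => (r ^ 2 * (1 - τ), (1 - τ)⁻¹))
          (-r ^ 2, ((1 - t) ^ 2)⁻¹) t := by
        have h0 : HasDerivAt (fun τ : ℝ => 1 - τ) (-1) t := by
          simpa using (hasDerivAt_id t).const_sub 1
        refine HasDerivAt.prodMk ?_ ?_
        · simpa using h0.const_mul (r ^ 2)
        · exact (h0.fun_inv h1).congr_deriv (by simp [div_eq_mul_inv])
      have hk' := (hdiff.hasFDerivAt.comp_hasDerivAt t hpath).const_mul (4 * (r : ℂ))
      have hev : (fun τ => deriv (fun s' : ℝ => 2 * (s' : ℂ) ^ 2 *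
          γ (s' ^ 2 * (1 - τ)) (s' ^ 2)) r) =ᶠ[𝓝 t]
          fun τ : ℝ => 4 * r * kernelFst p k (r ^ 2 * (1 - τ)) (1 - τ)⁻¹ := by
        filter_upwards [Iio_mem_nhds ht.2] with τ hτ using hfirst r τ hτ
      rw [hev.deriv_eq]
      refine (HasDerivAt.deriv hk').trans ?_
      change 4 * r * D (-r ^ 2, ((1 - t) ^ 2)⁻¹) = _
      rw [hDlin, hαb, hpq r ⟨hr.1.le, hr.2.le⟩]
      push_cast
      ring
    rw [hrr, hrt, hfirst r t ht.2, hGk r t ht.2]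
    change r * (4 * kernelFst p k α b + 8 * (r : ℂ) ^ 2 * (1 - t) * D (1, 0) -
      q r * (2 * ((1 - t)⁻¹ : ℝ) * k α b)) - 4 * r * kernelFst p k α b + _ = 0
    push_cast
    field_simp
    ring
  · intro r hr
    have h1 := intervalIntegral.smul_integral_comp_mul_left (a := 0) (b := 1) (fun x => p x) (r ^ 2)
    have h2 := intervalIntegral.integral_deriv_smul_comp (a := 0) (b := r)
      (f := fun τ : ℝ => τ ^ 2) (f' := fun τ : ℝ => 2 * τ) (g := fun x => p x)
      (fun τ _ => by simpa using hasDerivAt_pow 2 τ) (by fun_prop) hp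
    simp only [mul_zero, mul_one] at h1
    have h3 : ∫ τ in (0 : ℝ)..r, (τ : ℂ) * q τ = (1 / 2) * ∫ x in (0 : ℝ)..(r ^ 2), p x := by
      rw [show (0 : ℝ) = 0 ^ 2 by norm_num, ← h2]
      rw [show (0 : ℝ) ^ 2 = 0 by norm_num, ← intervalIntegral.integral_const_mul]
      refine intervalIntegral.integral_congr fun τ hτ => ?_
      rw [uIcc_of_le hr.1] at hτ
      simp only [Function.comp]
      rw [hpq τ ⟨hτ.1, hτ.2.trans hr.2⟩, Complex.real_smul]
      push_cast
      ring
    rw [hγ, sub_zero, mul_one, intervalIntegral.integral_same, h3, ← h1, Complex.real_smul]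
    push_cast
    ring
  · intro t _
    simp

theorem exists_isTransmutationKernel {R : ℝ} (hR : 0 < R) {q : ℝ → ℂ}
    (hq : ContDiffOn ℝ 1 q (Icc 0 R)) : ∃ G, IsTransmutationKernel R q G := by
  have hR2 : (0 : ℝ) ≤ R ^ 2 := by positivity
  have hmem : ∀ x : ℝ, √(projIcc 0 (R ^ 2) hR2 x : ℝ) ∈ Icc 0 R := fun x =>
    ⟨Real.sqrt_nonneg _, Real.sqrt_le_iff.2 ⟨hR.le, (projIcc 0 (R ^ 2) hR2 x).2.2⟩⟩
  set p : ℝ → ℂ := fun x => q √(projIcc 0 (R ^ 2) hR2 x : ℝ) with hpdef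
  have hp : Continuous p := hq.continuousOn.comp_continuous (by fun_prop) hmem
  obtain ⟨C, hC⟩ := isCompact_Icc.exists_bound_of_continuousOn hq.continuousOn
  obtain ⟨γ, hγc, hγ⟩ := exists_scaledKernel hp fun x => hC _ (hmem x)
  refine ⟨_, isTransmutationKernel_of_scaled hp ?_ ?_ hγc hγ⟩
  · intro r hr
    simp only [hpdef]
    rw [projIcc_of_mem hR2 (x := r ^ 2) ⟨by positivity, pow_le_pow_left₀ hr.1 hr.2 2⟩,
      Real.sqrt_sq hr.1]
  · have hs : ContDiffOn ℝ 1 (fun x : ℝ => √x) (Ioo 0 (R ^ 2)) := fun x hx =>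
      (Real.contDiffAt_sqrt (ne_of_gt hx.1)).contDiffWithinAt
    have hc : ContDiffOn ℝ 1 (fun x : ℝ => q √x) (Ioo 0 (R ^ 2)) :=
      hq.comp hs fun x hx => ⟨Real.sqrt_nonneg _, Real.sqrt_le_iff.2 ⟨hR.le, hx.2.le⟩⟩
    refine hc.congr fun x hx => ?_
    simp only [hpdef]
    rw [projIcc_of_mem hR2 (x := x) ⟨hx.1.le, hx.2.le⟩]

theorem isTransmutationKernel_transmutationKernel {R : ℝ} (hR : 0 < R) {q : ℝ → ℂ}
    (hq : ContDiffOn ℝ 1 q (Icc 0 R)) : IsTransmutationKernel R q (transmutationKernel R q) :=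
  Classical.epsilon_spec (exists_isTransmutationKernel hR hq)

end KernelExistence

end RadialVekua

namespace RadialVekua

section RadialEquation

theorem hasDerivAt_ofReal_pow_div (m : ℕ) {r : ℝ} (hr : r ≠ 0) :
    HasDerivAt (fun s : ℝ => (s : ℂ) ^ m) (m * ((r : ℂ) ^ m / r)) r := by
  have hr' : (r : ℂ) ≠ 0 := by exact_mod_cast hr
  have h := (Complex.ofRealCLM.hasDerivAt (x := r)).pow m
  refine h.congr_deriv ?_
  rcases m with _ | m
  · simp
  · simp [pow_succ, hr']

/-- Continuity of `s ↦ s ^ m / s` away from zero. -/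
theorem continuousOn_pow_div (m : ℕ) (R : ℝ) :
    ContinuousOn (fun s : ℝ => (s : ℂ) ^ m / s) (Ioo 0 R) :=
  (by fun_prop : Continuous fun s : ℝ => (s : ℂ) ^ m).continuousOn.div
    Complex.continuous_ofReal.continuousOn fun s hs => by
      exact_mod_cast (ne_of_gt hs.1)

theorem uIcc_subset_Ioo_of_mem {R a b : ℝ} (ha : a ∈ Ioo 0 R) (hb : b ∈ Ioo 0 R) :
    uIcc a b ⊆ Ioo 0 R := (ordConnected_Ioo.uIcc_subset ha hb)

/-- Limits of solutions of the once integrated radial equation solve it as well. -/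
theorem exists_hasDerivAt_of_tendsto_radial {R K : ℝ} {n : ℕ} {q y B : ℝ → ℂ}
    {Y Y' Bs : ℕ → ℝ → ℂ}
    (hq : ContinuousOn q (Ioo 0 R)) (hB : ContinuousOn B (Ioo 0 R))
    (hY : ∀ j, ∀ r ∈ Ioo 0 R, HasDerivAt (Y j) (Y' j r) r)
    (hBc : ∀ j, ContinuousOn (Bs j) (Ioo 0 R))
    (hZ : ∀ j, ∀ r ∈ Ioo 0 R,
      HasDerivAt (fun s : ℝ => (s : ℂ) * Y' j s + 2 * n * Y j s + Bs j s) (r * q r * Y j r) r)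
    (hYK : ∀ j, ∀ r ∈ Ioo 0 R, ‖Y j r‖ ≤ K) (hBK : ∀ j, ∀ r ∈ Ioo 0 R, ‖Bs j r‖ ≤ K)
    (hYl : ∀ r ∈ Ioo 0 R, Tendsto (fun j => Y j r) atTop (𝓝 (y r)))
    (hBl : ∀ r ∈ Ioo 0 R, Tendsto (fun j => Bs j r) atTop (𝓝 (B r)))
    (hy : ContinuousOn y (Ioo 0 R)) {r₀ : ℝ} (hr₀ : r₀ ∈ Ioo 0 R) :
    ∃ C : ℂ, ∀ r ∈ Ioo 0 R,
      HasDerivAt y ((C - B r + (∫ s in r₀..r, (s : ℂ) * q s * y s) - 2 * n * y r) / r) r := by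
  have hsub : ∀ r ∈ Ioo 0 R, uIcc r₀ r ⊆ Ioo 0 R := fun r hr => uIcc_subset_Ioo_of_mem hr₀ hr
  have hYc : ∀ j, ContinuousOn (Y j) (Ioo 0 R) := fun j r hr =>
    (hY j r hr).continuousAt.continuousWithinAt
  have hid : ContinuousOn (fun s : ℝ => (s : ℂ)) (Ioo 0 R) :=
    Complex.continuous_ofReal.continuousOn
  have hprim : ∀ {h : ℝ → ℂ}, ContinuousOn h (Ioo 0 R) → ∀ r ∈ Ioo 0 R,
      HasDerivAt (fun x => ∫ s in r₀..x, h s) (h r) r := fun {h} hh r hr =>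
    intervalIntegral.integral_hasDerivAt_right ((hh.mono (hsub r hr)).intervalIntegrable)
      (hh.stronglyMeasurableAtFilter isOpen_Ioo r hr) (hh.continuousAt (isOpen_Ioo.mem_nhds hr))
  have hprimc : ∀ {h : ℝ → ℂ}, ContinuousOn h (Ioo 0 R) →
      ContinuousOn (fun x => ∫ s in r₀..x, h s) (Ioo 0 R) := fun hh r hr =>
    (hprim hh r hr).continuousAt.continuousWithinAt
  have hint : ∀ {h : ℝ → ℂ}, ContinuousOn h (Ioo 0 R) → ∀ r ∈ Ioo 0 R,
      IntervalIntegrable h MeasureTheory.volume r₀ r := fun hh r hr =>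
    (hh.mono (hsub r hr)).intervalIntegrable
  set w : ℝ → ℂ := fun s => (s : ℂ) ^ (2 * n) / s with hw
  have hwc : ContinuousOn w (Ioo 0 R) := continuousOn_pow_div (2 * n) R
  set F : ℕ → ℝ → ℂ := fun j r => -Bs j r + ∫ s in r₀..r, (s : ℂ) * q s * Y j s with hF
  set Fl : ℝ → ℂ := fun r => -B r + ∫ s in r₀..r, (s : ℂ) * q s * y s with hFl
  have hFc : ∀ j, ContinuousOn (F j) (Ioo 0 R) := fun j =>
    (hBc j).neg.add (hprimc ((hid.mul hq).mul (hYc j)))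
  have hFlc : ContinuousOn Fl (Ioo 0 R) := hB.neg.add (hprimc ((hid.mul hq).mul hy))
  -- dominated convergence on the subintervals
  have hdct : ∀ {h : ℝ → ℂ} {V : ℕ → ℝ → ℂ} {v : ℝ → ℂ} {r : ℝ}, r ∈ Ioo 0 R →
      ContinuousOn h (Ioo 0 R) → (∀ j, ContinuousOn (V j) (Ioo 0 R)) →
      (∃ K', ∀ j, ∀ s ∈ uIcc r₀ r, ‖V j s‖ ≤ K') →
      (∀ s ∈ Ioo 0 R, Tendsto (fun j => V j s) atTop (𝓝 (v s))) →
      Tendsto (fun j => ∫ s in r₀..r, h s * V j s) atTop (𝓝 (∫ s in r₀..r, h s * v s)) := by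
    rintro h V v r hr hh hV ⟨K', hK'⟩ hl
    refine intervalIntegral.tendsto_integral_filter_of_dominated_convergence
      (fun s => ‖h s‖ * K') ?_ ?_ ?_ ?_
    · exact Eventually.of_forall fun j => (((hh.mul (hV j)).mono (hsub r hr)).mono
        uIoc_subset_uIcc).aestronglyMeasurable measurableSet_uIoc
    · exact Eventually.of_forall fun j => Eventually.of_forall fun s hs => by
        rw [norm_mul]
        exact mul_le_mul_of_nonneg_left (hK' j s (uIoc_subset_uIcc hs)) (norm_nonneg _)
    · exact (((hh.mono (hsub r hr)).norm).mul continuousOn_const).intervalIntegrable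
    · exact Eventually.of_forall fun s hs =>
        (hl s (hsub r hr (uIoc_subset_uIcc hs))).const_mul _
  have hFlim : ∀ r ∈ Ioo 0 R, Tendsto (fun j => F j r) atTop (𝓝 (Fl r)) := fun r hr =>
    (hBl r hr).neg.add (hdct hr (hid.mul hq) hYc
      ⟨K, fun j s hs => hYK j s (hsub r hr hs)⟩ hYl)
  have hFb : ∀ r ∈ Ioo 0 R, ∃ K', ∀ j, ∀ s ∈ uIcc r₀ r, ‖F j s‖ ≤ K' := by
    intro r hr
    obtain ⟨Q, hQ⟩ := isCompact_uIcc.exists_bound_of_continuousOn ((hid.mul hq).mono (hsub r hr))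
    refine ⟨K + Q * K * |r - r₀|, fun j s hs => ?_⟩
    have hK0 : 0 ≤ K := (norm_nonneg _).trans (hYK 0 r hr)
    have hQ0 : 0 ≤ Q := (norm_nonneg _).trans (hQ r right_mem_uIcc)
    refine (norm_add_le _ _).trans (add_le_add ?_ ?_)
    · rw [norm_neg]
      exact hBK j s (hsub r hr hs)
    · have h1 : ‖∫ x in r₀..s, (x : ℂ) * q x * Y j x‖ ≤ Q * K * |s - r₀| := by
        refine intervalIntegral.norm_integral_le_of_norm_le_const fun x hx => ?_
        have hx' : x ∈ uIcc r₀ r := uIcc_subset_uIcc left_mem_uIcc hs (uIoc_subset_uIcc hx)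
        rw [norm_mul]
        exact mul_le_mul (hQ x hx') (hYK j x (hsub r hr hx')) (norm_nonneg _) hQ0
      refine h1.trans (mul_le_mul_of_nonneg_left ?_ (mul_nonneg hQ0 hK0))
      exact abs_sub_left_of_mem_uIcc hs
  have hcj : ∀ j, ∃ c : ℂ, ∀ r ∈ Ioo 0 R, r * Y' j r + 2 * n * Y j r = c + F j r := by
    intro j
    refine ⟨r₀ * Y' j r₀ + 2 * n * Y j r₀ + Bs j r₀, fun r hr => ?_⟩
    have h := intervalIntegral.integral_eq_sub_of_hasDerivAt
      (fun s hs => hZ j s (hsub r hr hs)) (hint ((hid.mul hq).mul (hYc j)) r hr)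
    simp only [hF]
    rw [h]
    ring
  choose c hc using hcj
  have hrep : ∀ j, ∀ r ∈ Ioo 0 R, (r : ℂ) ^ (2 * n) * Y j r - (r₀ : ℂ) ^ (2 * n) * Y j r₀ =
      c j * (∫ s in r₀..r, w s) + ∫ s in r₀..r, w s * F j s := by
    intro j r hr
    have hd : ∀ s ∈ uIcc r₀ r, HasDerivAt (fun s : ℝ => (s : ℂ) ^ (2 * n) * Y j s)
        (c j * w s + w s * F j s) s := by
      intro s hs
      have hs' := hsub r hr hs
      have hs0 : (s : ℂ) ≠ 0 := by exact_mod_cast (ne_of_gt hs'.1)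
      refine ((hasDerivAt_ofReal_pow_div (2 * n) (ne_of_gt hs'.1)).mul
        (hY j s hs')).congr_deriv ?_
      have := hc j s hs'
      simp only [hw]
      push_cast
      field_simp
      linear_combination this
    have h1 : IntervalIntegrable (fun s => c j * w s) MeasureTheory.volume r₀ r :=
      (hint hwc r hr).const_mul _
    have h2 : IntervalIntegrable (fun s => w s * F j s) MeasureTheory.volume r₀ r :=
      hint (hwc.mul (hFc j)) r hr
    rw [← intervalIntegral.integral_eq_sub_of_hasDerivAt hd (h1.add h2),
      intervalIntegral.integral_add h1 h2, intervalIntegral.integral_const_mul]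
  -- the constants converge
  obtain ⟨C, hC⟩ : ∃ C, Tendsto c atTop (𝓝 C) := by
    obtain ⟨r₁, hr₁⟩ : ∃ r₁, r₁ ∈ Ioo r₀ R := exists_between hr₀.2
    have hr₁' : r₁ ∈ Ioo 0 R := ⟨hr₀.1.trans hr₁.1, hr₁.2⟩
    have hpos : (∫ s in r₀..r₁, w s) ≠ 0 := by
      have he : ∫ s in r₀..r₁, w s = ((∫ s in r₀..r₁, s ^ (2 * n) / s : ℝ) : ℂ) := by
        rw [← intervalIntegral.integral_ofReal]
        refine intervalIntegral.integral_congr fun s _ => ?_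
        simp [hw]
      rw [he]
      refine Complex.ofReal_ne_zero.2 (ne_of_gt ?_)
      refine intervalIntegral.intervalIntegral_pos_of_pos_on ?_ (fun s hs => ?_) hr₁.1
      · refine ContinuousOn.intervalIntegrable ?_
        refine ContinuousOn.div (by fun_prop) continuousOn_id fun s hs => ?_
        exact ne_of_gt (hsub r₁ hr₁' hs).1
      · have : 0 < s := hr₀.1.trans hs.1
        positivity
    have hl := (((hYl r₁ hr₁').const_mul ((r₁ : ℂ) ^ (2 * n))).sub
      ((hYl r₀ hr₀).const_mul ((r₀ : ℂ) ^ (2 * n)))).sub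
        (hdct hr₁' hwc hFc (hFb r₁ hr₁') hFlim)
    refine ⟨_, (hl.div_const (∫ s in r₀..r₁, w s)).congr fun j => ?_⟩
    rw [hrep j r₁ hr₁', add_sub_cancel_right, mul_div_cancel_right₀ _ hpos]
  refine ⟨C, fun r hr => ?_⟩
  have hlim : ∀ r ∈ Ioo 0 R, (r : ℂ) ^ (2 * n) * y r - (r₀ : ℂ) ^ (2 * n) * y r₀ =
      C * (∫ s in r₀..r, w s) + ∫ s in r₀..r, w s * Fl s := by
    intro r hr
    refine tendsto_nhds_unique (((hYl r hr).const_mul ((r : ℂ) ^ (2 * n))).sub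
      ((hYl r₀ hr₀).const_mul ((r₀ : ℂ) ^ (2 * n)))) ?_
    refine ((hC.mul_const _).add (hdct hr hwc hFc (hFb r hr) hFlim)).congr fun j => ?_
    exact (hrep j r hr).symm
  have hr0 : (r : ℂ) ≠ 0 := by exact_mod_cast (ne_of_gt hr.1)
  have hd1 : HasDerivAt (fun r => (r₀ : ℂ) ^ (2 * n) * y r₀ +
      (C * (∫ s in r₀..r, w s) + ∫ s in r₀..r, w s * Fl s)) (C * w r + w r * Fl r) r :=
    (((hprim hwc r hr).const_mul C).add (hprim (hwc.mul hFlc) r hr)).const_add _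
  have hpow := hasDerivAt_ofReal_pow_div (2 * n) (ne_of_gt hr.1)
  have hd2 := hd1.div hpow (pow_ne_zero _ hr0)
  have hev : y =ᶠ[𝓝 r] fun r => ((r₀ : ℂ) ^ (2 * n) * y r₀ +
      (C * (∫ s in r₀..r, w s) + ∫ s in r₀..r, w s * Fl s)) / (r : ℂ) ^ (2 * n) := by
    filter_upwards [isOpen_Ioo.mem_nhds hr] with s hs
    have hs0 : (s : ℂ) ≠ 0 := by exact_mod_cast (ne_of_gt hs.1)
    rw [eq_div_iff (pow_ne_zero _ hs0), ← hlim s hs]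
    ring
  refine (hd2.congr_of_eventuallyEq hev).congr_deriv ?_
  rw [← hlim r hr]
  simp only [hw, hFl]
  push_cast
  field_simp
  ring

/-- The constant of integration in the radial equation is determined by the value at zero. -/
theorem radial_constant_eq {R : ℝ} (hR : 0 < R) {φ E : ℝ → ℂ} {c m : ℂ}
    (hφ : ContinuousOn φ (Icc 0 R)) (hE : ContinuousOn E (Icc 0 R)) (hE0 : E 0 = 0)
    (hd : ∀ r ∈ Ioo 0 R, HasDerivAt φ ((c + E r - m * φ r) / r) r) : c = m * φ 0 := by
  have hIoo : Ioo 0 R ∈ 𝓝[>] (0 : ℝ) := Ioo_mem_nhdsGT hR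
  have hlim : ∀ {h : ℝ → ℂ}, ContinuousOn h (Icc 0 R) → Tendsto h (𝓝[>] 0) (𝓝 (h 0)) := by
    intro h hh
    exact (hh 0 ⟨le_rfl, hR.le⟩).tendsto.mono_left
      (nhdsWithin_le_of_mem (mem_of_superset hIoo Ioo_subset_Icc_self))
  have hid : Continuous fun r : ℝ => (r : ℂ) := Complex.continuous_ofReal
  set y : ℝ → ℂ := fun r => (r : ℂ) * φ r with hy
  have hyd : ∀ r ∈ Ioo 0 R, HasDerivAt y (φ r + (c + E r - m * φ r)) r := by
    intro r hr
    have hr0 : (r : ℂ) ≠ 0 := by exact_mod_cast (ne_of_gt hr.1)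
    have h1 : HasDerivAt (fun r : ℝ => (r : ℂ)) 1 r := Complex.ofRealCLM.hasDerivAt
    refine (h1.mul (hd r hr)).congr_deriv ?_
    field_simp
  have h1 : HasDerivWithinAt y (φ 0 + (c + 0 - m * φ 0)) (Ici 0) 0 := by
    refine hasDerivWithinAt_Ici_of_tendsto_deriv (s := Ioo 0 R)
      (fun r hr => (hyd r hr).differentiableAt.differentiableWithinAt) ?_ hIoo ?_
    · exact ((hid.continuousOn.mul hφ) 0 ⟨le_rfl, hR.le⟩).mono Ioo_subset_Icc_self
    · have : Tendsto (fun r => φ r + (c + E r - m * φ r)) (𝓝[>] 0)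
          (𝓝 (φ 0 + (c + 0 - m * φ 0))) := by
        have hE' := hlim hE
        rw [hE0] at hE'
        exact (hlim hφ).add ((hE'.const_add c).sub ((hlim hφ).const_mul m))
      refine this.congr' ?_
      filter_upwards [hIoo] with r hr using (hyd r hr).deriv.symm
  have h2 : HasDerivWithinAt y (φ 0) (Ici 0) 0 := by
    rw [hasDerivWithinAt_iff_tendsto_slope]
    have hset : Ici (0 : ℝ) \ {0} = Ioi 0 := by
      ext x
      simp [lt_iff_le_and_ne, eq_comm]
    rw [hset]
    refine (hlim hφ).congr' ?_
    filter_upwards [self_mem_nhdsWithin] with r hr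
    have hr0 : (r : ℂ) ≠ 0 := by exact_mod_cast (ne_of_gt hr)
    simp [slope_def_module, hy, hr0]
  have h := (uniqueDiffWithinAt_Ici (0 : ℝ)).eq_deriv _ h1 h2
  linear_combination h

end RadialEquation

end RadialVekua

namespace RadialVekua

section KernelMoments

theorem contDiffOn_deriv_fst {g : ℝ → ℝ → ℂ} {U : Set (ℝ × ℝ)} (hU : IsOpen U) {n : ℕ}
    (hg : ContDiffOn ℝ (n + 1) (fun z : ℝ × ℝ => g z.1 z.2) U) :
    (∀ z ∈ U, HasDerivAt (fun s => g s z.2) (deriv (fun s => g s z.2) z.1) z.1) ∧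
      ContDiffOn ℝ n (fun z : ℝ × ℝ => deriv (fun s => g s z.2) z.1) U := by
  have hd : ∀ z ∈ U, HasDerivAt (fun s => g s z.2)
      (fderiv ℝ (fun z : ℝ × ℝ => g z.1 z.2) z (1, 0)) z.1 := by
    intro z hz
    have h1 := ((hg.differentiableOn (by simp)).differentiableAt (hU.mem_nhds hz)).hasFDerivAt
    exact h1.comp_hasDerivAt z.1 (f := fun s : ℝ => (s, z.2))
      ((hasDerivAt_id z.1).prodMk (hasDerivAt_const z.1 z.2))
  refine ⟨fun z hz => (hd z hz).differentiableAt.hasDerivAt, ?_⟩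
  have h2 := ((contDiffOn_succ_iff_fderiv_of_isOpen hU).1 hg).2.2
  exact (h2.clm_apply contDiffOn_const).congr fun z hz => (hd z hz).deriv

theorem contDiffOn_deriv_snd {g : ℝ → ℝ → ℂ} {U : Set (ℝ × ℝ)} (hU : IsOpen U) {n : ℕ}
    (hg : ContDiffOn ℝ (n + 1) (fun z : ℝ × ℝ => g z.1 z.2) U) :
    (∀ z ∈ U, HasDerivAt (fun t => g z.1 t) (deriv (fun t => g z.1 t) z.2) z.2) ∧
      ContDiffOn ℝ n (fun z : ℝ × ℝ => deriv (fun t => g z.1 t) z.2) U := by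
  have hd : ∀ z ∈ U, HasDerivAt (fun t => g z.1 t)
      (fderiv ℝ (fun z : ℝ × ℝ => g z.1 z.2) z (0, 1)) z.2 := by
    intro z hz
    have h1 := ((hg.differentiableOn (by simp)).differentiableAt (hU.mem_nhds hz)).hasFDerivAt
    exact h1.comp_hasDerivAt z.2 (f := fun t : ℝ => (z.1, t))
      ((hasDerivAt_const z.2 z.1).prodMk (hasDerivAt_id z.2))
  refine ⟨fun z hz => (hd z hz).differentiableAt.hasDerivAt, ?_⟩
  have h2 := ((contDiffOn_succ_iff_fderiv_of_isOpen hU).1 hg).2.2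
  exact (h2.clm_apply contDiffOn_const).congr fun z hz => (hd z hz).deriv

theorem hasDerivAt_one_sub_pow (n : ℕ) (t : ℝ) :
    HasDerivAt (fun t : ℝ => (1 - (t : ℂ)) ^ (n + 1)) (-(n + 1) * (1 - (t : ℂ)) ^ n) t := by
  have h1 : HasDerivAt (fun t : ℝ => 1 - (t : ℂ)) (-1) t := by
    simpa using (Complex.ofRealCLM.hasDerivAt (x := t)).const_sub (1 : ℂ)
  refine (h1.pow (n + 1)).congr_deriv ?_
  push_cast
  simp
  ring

/-- The moments of a kernel cut off away from the ends satisfy a once integrated radial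
equation. -/
theorem hasDerivAt_truncated_moment {R : ℝ} {q : ℝ → ℂ} {G : ℝ → ℝ → ℂ}
    (hG : IsTransmutationKernel R q G) (n : ℕ) {ε δ : ℝ} (hε : 0 < ε) (hεδ : ε ≤ δ) (hδ : δ < 1) :
    ∃ Y' : ℝ → ℂ, (∀ r ∈ Ioo 0 R,
        HasDerivAt (fun r => ∫ t in ε..δ, (1 - (t : ℂ)) ^ n * G r t) (Y' r) r) ∧
      ∀ r ∈ Ioo 0 R, HasDerivAt (fun s : ℝ => (s : ℂ) * Y' s
        + 2 * n * (∫ t in ε..δ, (1 - (t : ℂ)) ^ n * G s t)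
        + 2 * ((1 - (δ : ℂ)) ^ (n + 1) * G s δ - (1 - (ε : ℂ)) ^ (n + 1) * G s ε))
        (r * q r * ∫ t in ε..δ, (1 - (t : ℂ)) ^ n * G r t) r := by
  set U : Set (ℝ × ℝ) := Ioo 0 R ×ˢ Ioo 0 1 with hUdef
  have hU : IsOpen U := isOpen_Ioo.prod isOpen_Ioo
  have hI : uIcc ε δ ⊆ Ioo 0 1 := by
    rw [uIcc_of_le hεδ]
    exact fun t ht => ⟨hε.trans_le ht.1, ht.2.trans_lt hδ⟩
  have hsub : Ioo 0 R ×ˢ uIcc ε δ ⊆ U := prod_mono le_rfl hI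
  set Gr : ℝ → ℝ → ℂ := fun r t => deriv (fun s => G s t) r with hGr
  obtain ⟨d1, c1⟩ := contDiffOn_deriv_fst (n := 1) (g := G) hU hG.contDiffOn
  obtain ⟨d2, c2⟩ := contDiffOn_deriv_fst (n := 0) (g := Gr) hU c1
  obtain ⟨d3, c3⟩ := contDiffOn_deriv_snd (n := 0) (g := Gr) hU c1
  set Grr : ℝ → ℝ → ℂ := fun r t => deriv (fun s => Gr s t) r with hGrr
  set Grt : ℝ → ℝ → ℂ := fun r t => deriv (fun τ => Gr r τ) t with hGrt
  have hwc : ∀ m : ℕ, Continuous fun z : ℝ × ℝ => (1 - (z.2 : ℂ)) ^ m := fun m => by fun_prop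
  have hc0 := hG.contDiffOn.continuousOn
  have hw : ∀ (m : ℕ) {K : ℝ → ℝ → ℂ}, ContinuousOn (fun z : ℝ × ℝ => K z.1 z.2) U →
      ContinuousOn (fun z : ℝ × ℝ => (1 - (z.2 : ℂ)) ^ m * K z.1 z.2) (Ioo 0 R ×ˢ uIcc ε δ) :=
    fun m {K} hK => (hwc m).continuousOn.mul (hK.mono hsub)
  have hint : ∀ (m : ℕ) {K : ℝ → ℝ → ℂ}, ContinuousOn (fun z : ℝ × ℝ => K z.1 z.2) U →
      ∀ r ∈ Ioo 0 R, IntervalIntegrable (fun t : ℝ => (1 - (t : ℂ)) ^ m * K r t)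
        MeasureTheory.volume ε δ := fun m {K} hK r hr =>
    ((hw m hK).comp (f := fun t : ℝ => (r, t)) (by fun_prop) fun t ht =>
      ⟨hr, ht⟩).intervalIntegrable
  have hY : ∀ r ∈ Ioo 0 R, HasDerivAt (fun r => ∫ t in ε..δ, (1 - (t : ℂ)) ^ n * G r t)
      (∫ t in ε..δ, (1 - (t : ℂ)) ^ n * Gr r t) r := fun r hr =>
    hasDerivAt_intervalIntegral_param (H := fun r t => (1 - (t : ℂ)) ^ n * G r t)
      (H' := fun r t => (1 - (t : ℂ)) ^ n * Gr r t) isOpen_Ioo (hw n hc0) (hw n c1.continuousOn)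
      (fun r hr t ht => (d1 (r, t) ⟨hr, hI ht⟩).const_mul _) hr
  have hY2 : ∀ r ∈ Ioo 0 R, HasDerivAt (fun r => ∫ t in ε..δ, (1 - (t : ℂ)) ^ n * Gr r t)
      (∫ t in ε..δ, (1 - (t : ℂ)) ^ n * Grr r t) r := fun r hr =>
    hasDerivAt_intervalIntegral_param (H := fun r t => (1 - (t : ℂ)) ^ n * Gr r t)
      (H' := fun r t => (1 - (t : ℂ)) ^ n * Grr r t) isOpen_Ioo (hw n c1.continuousOn) (hw n c2.continuousOn)
      (fun r hr t ht => (d2 (r, t) ⟨hr, hI ht⟩).const_mul _) hr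
  refine ⟨_, hY, fun r hr => ?_⟩
  have hend : ∀ t ∈ Ioo (0 : ℝ) 1, HasDerivAt (fun s => (1 - (t : ℂ)) ^ (n + 1) * G s t)
      ((1 - (t : ℂ)) ^ (n + 1) * Gr r t) r := fun t ht => (d1 (r, t) ⟨hr, ht⟩).const_mul _
  have hid : HasDerivAt (fun s : ℝ => (s : ℂ)) 1 r := Complex.ofRealCLM.hasDerivAt
  have hparts : (1 - (δ : ℂ)) ^ (n + 1) * Gr r δ - (1 - (ε : ℂ)) ^ (n + 1) * Gr r ε =
      (∫ t in ε..δ, (1 - (t : ℂ)) ^ (n + 1) * Grt r t) -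
        (n + 1) * ∫ t in ε..δ, (1 - (t : ℂ)) ^ n * Gr r t := by
    have hd : ∀ t ∈ uIcc ε δ, HasDerivAt (fun t : ℝ => (1 - (t : ℂ)) ^ (n + 1) * Gr r t)
        ((1 - (t : ℂ)) ^ (n + 1) * Grt r t - (n + 1) * ((1 - (t : ℂ)) ^ n * Gr r t)) t := by
      intro t ht
      refine ((hasDerivAt_one_sub_pow n t).mul (d3 (r, t) ⟨hr, hI ht⟩)).congr_deriv ?_
      ring
    have i1 := hint (n + 1) (K := Grt) c3.continuousOn r hr
    have i2 := (hint n (K := Gr) c1.continuousOn r hr).const_mul ((n : ℂ) + 1)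
    rw [← intervalIntegral.integral_eq_sub_of_hasDerivAt hd (i1.sub i2),
      intervalIntegral.integral_sub i1 i2, intervalIntegral.integral_const_mul]
  have hpde : r * (∫ t in ε..δ, (1 - (t : ℂ)) ^ n * Grr r t)
      - (∫ t in ε..δ, (1 - (t : ℂ)) ^ n * Gr r t)
      + 2 * (∫ t in ε..δ, (1 - (t : ℂ)) ^ (n + 1) * Grt r t)
      = r * q r * ∫ t in ε..δ, (1 - (t : ℂ)) ^ n * G r t := by
    have i1 := (hint n (K := Grr) c2.continuousOn r hr).const_mul (r : ℂ)
    have i2 := hint n (K := Gr) c1.continuousOn r hr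
    have i3 := (hint (n + 1) (K := Grt) c3.continuousOn r hr).const_mul (2 : ℂ)
    rw [← intervalIntegral.integral_const_mul, ← intervalIntegral.integral_const_mul,
      ← intervalIntegral.integral_const_mul, ← intervalIntegral.integral_sub i1 i2,
      ← intervalIntegral.integral_add (i1.sub i2) i3]
    refine intervalIntegral.integral_congr fun t ht => ?_
    have := hG.pde r hr t (hI ht)
    simp only [hGrr, hGrt, hGr]
    linear_combination (1 - (t : ℂ)) ^ n * this
  have hδm : δ ∈ Ioo (0 : ℝ) 1 := hI right_mem_uIcc
  have hεm : ε ∈ Ioo (0 : ℝ) 1 := hI left_mem_uIcc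
  refine (((hid.mul (hY2 r hr)).add ((hY r hr).const_mul (2 * (n : ℂ)))).add
    (((hend δ hδm).sub (hend ε hεm)).const_mul 2)).congr_deriv ?_
  rw [hparts, ← hpde]
  ring

/-- The radial factor of the transmuted homogeneous functions of degree `n`. -/
noncomputable def radialFactor (G : ℝ → ℝ → ℂ) (n : ℕ) (r : ℝ) : ℂ :=
  1 + (1 / 2) * ∫ t in (0 : ℝ)..1, (1 - (t : ℂ)) ^ n * G r t

theorem norm_one_sub_pow_le {t : ℝ} (ht : t ∈ Icc (0 : ℝ) 1) (n : ℕ) :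
    ‖(1 - (t : ℂ)) ^ n‖ ≤ 1 := by
  rw [norm_pow, show (1 - (t : ℂ)) = ((1 - t : ℝ) : ℂ) by push_cast; ring, Complex.norm_real,
    Real.norm_of_nonneg (by linarith [ht.2])]
  exact pow_le_one₀ (by linarith [ht.2]) (by linarith [ht.1])

variable {R : ℝ} {q : ℝ → ℂ} {G : ℝ → ℝ → ℂ}

theorem IsTransmutationKernel.exists_bound (hG : IsTransmutationKernel R q G) :
    ∃ K, ∀ r ∈ Icc 0 R, ∀ t ∈ Icc (0 : ℝ) 1, ‖G r t‖ ≤ K := by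
  obtain ⟨K, hK⟩ := (isCompact_Icc.prod isCompact_Icc).exists_bound_of_continuousOn hG.continuousOn
  exact ⟨K, fun r hr t ht => hK (r, t) ⟨hr, ht⟩⟩

theorem continuousOn_radialFactor (hG : IsTransmutationKernel R q G) (n : ℕ) :
    ContinuousOn (radialFactor G n) (Icc 0 R) := by
  refine continuousOn_const.add (continuousOn_const.mul ?_)
  refine continuousOn_intervalIntegral_param ?_
  rw [uIcc_of_le zero_le_one]
  exact (by fun_prop : Continuous fun z : ℝ × ℝ => (1 - (z.2 : ℂ)) ^ n).continuousOn.mul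
    hG.continuousOn

theorem radialFactor_zero (hG : IsTransmutationKernel R q G) (n : ℕ) :
    radialFactor G n 0 = 1 := by
  have : ∫ t in (0 : ℝ)..1, (1 - (t : ℂ)) ^ n * G 0 t = ∫ t in (0 : ℝ)..1, (0 : ℂ) :=
    intervalIntegral.integral_congr fun t ht => by
      rw [uIcc_of_le zero_le_one] at ht
      simp [hG.initial_r t ht]
  simp [radialFactor, this]

theorem exists_norm_radialFactor_le (hG : IsTransmutationKernel R q G) :
    ∃ K, ∀ n, ∀ r ∈ Icc 0 R, ‖radialFactor G n r‖ ≤ K := by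
  obtain ⟨K, hK⟩ := hG.exists_bound
  refine ⟨1 + K, fun n r hr => ?_⟩
  have hK0 : 0 ≤ K := (norm_nonneg _).trans (hK r hr 0 (by simp))
  have h1 : ‖∫ t in (0 : ℝ)..1, (1 - (t : ℂ)) ^ n * G r t‖ ≤ K * |1 - 0| := by
    refine intervalIntegral.norm_integral_le_of_norm_le_const fun t ht => ?_
    rw [uIoc_of_le zero_le_one] at ht
    have ht' : t ∈ Icc (0 : ℝ) 1 := ⟨ht.1.le, ht.2⟩
    rw [norm_mul]
    nlinarith [norm_one_sub_pow_le ht' n, hK r hr t ht', norm_nonneg (G r t),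
      norm_nonneg ((1 - (t : ℂ)) ^ n)]
  refine (norm_add_le _ _).trans ?_
  rw [norm_one, norm_mul]
  norm_num at h1 ⊢
  linarith

/-- The radial factors satisfy the once integrated radial equation. -/
theorem hasDerivAt_radialFactor (hR : 0 < R) (hq : ContinuousOn q (Icc 0 R))
    (hG : IsTransmutationKernel R q G) (n : ℕ) {r : ℝ} (hr : r ∈ Ioo 0 R) :
    HasDerivAt (radialFactor G n)
      ((2 * n + (∫ s in (0 : ℝ)..r, (s : ℂ) * q s * radialFactor G n s)
        - 2 * n * radialFactor G n r) / r) r := by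
  obtain ⟨K, hK⟩ := hG.exists_bound
  have hK0 : 0 ≤ K := (norm_nonneg _).trans (hK 0 ⟨le_rfl, hR.le⟩ 0 (by simp))
  set φ := radialFactor G n with hφdef
  have hφ : ContinuousOn φ (Icc 0 R) := continuousOn_radialFactor hG n
  set M : ℝ → ℂ := fun r => ∫ t in (0 : ℝ)..1, (1 - (t : ℂ)) ^ n * G r t with hM
  have hMφ : ∀ r, M r = 2 * φ r - 2 := fun r => by
    simp only [hφdef, radialFactor, hM]
    ring
  have hMc : ContinuousOn M (Icc 0 R) :=
    ((continuousOn_const.mul hφ).sub continuousOn_const).congr fun r _ => hMφ r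
  have hid : ContinuousOn (fun s : ℝ => (s : ℂ)) (Icc 0 R) :=
    Complex.continuous_ofReal.continuousOn
  set e : ℕ → ℝ := fun j => 1 / ((j : ℝ) + 3) with he
  have he0 : ∀ j, 0 < e j := fun j => by positivity
  have he3 : ∀ j, e j ≤ 1 / 3 := fun j => by
    simp only [he]
    gcongr
    linarith [Nat.cast_nonneg (α := ℝ) j]
  have hel : Tendsto e atTop (𝓝 0) := by
    have h1 : Tendsto (fun j : ℕ => (j : ℝ) + 3) atTop atTop :=
      tendsto_atTop_add_const_right _ _ tendsto_natCast_atTop_atTop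
    simpa [he, Function.comp_def] using tendsto_inv_atTop_zero.comp h1
  have hem : ∀ j, e j ∈ Icc (0 : ℝ) 1 := fun j => ⟨(he0 j).le, by linarith [he3 j]⟩
  have hem' : ∀ j, 1 - e j ∈ Icc (0 : ℝ) 1 := fun j => ⟨by linarith [he3 j], by linarith [he0 j]⟩
  have hslice : ∀ r ∈ Icc 0 R, ContinuousOn (fun t => G r t) (Icc 0 1) := fun r hr =>
    hG.continuousOn.comp (f := fun t : ℝ => (r, t)) (by fun_prop) fun t ht => ⟨hr, ht⟩
  have hslice' : ∀ t ∈ Icc (0 : ℝ) 1, ContinuousOn (fun r => G r t) (Ioo 0 R) := fun t ht =>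
    hG.continuousOn.comp (f := fun r : ℝ => (r, t)) (by fun_prop) fun r hr =>
      ⟨Ioo_subset_Icc_self hr, ht⟩
  have hpt : ∀ r ∈ Icc 0 R, ∀ t ∈ Icc (0 : ℝ) 1, ∀ m, ‖(1 - (t : ℂ)) ^ m * G r t‖ ≤ K := by
    intro r hr t ht m
    rw [norm_mul]
    nlinarith [norm_one_sub_pow_le ht m, hK r hr t ht, norm_nonneg (G r t),
      norm_nonneg ((1 - (t : ℂ)) ^ m)]
  have hintr : ∀ r ∈ Icc 0 R, ContinuousOn (fun t : ℝ => (1 - (t : ℂ)) ^ n * G r t) (Icc 0 1) :=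
    fun r hr => (by fun_prop : Continuous fun t : ℝ => (1 - (t : ℂ)) ^ n).continuousOn.mul
      (hslice r hr)
  have hex := fun j => hasDerivAt_truncated_moment hG n (he0 j) (δ := 1 - e j)
    (by linarith [he3 j]) (by linarith [he0 j])
  choose Y' hY hZ using hex
  have hr₀ : R / 2 ∈ Ioo 0 R := ⟨by linarith, by linarith⟩
  obtain ⟨C, hC⟩ : ∃ C : ℂ, ∀ r ∈ Ioo 0 R, HasDerivAt M ((C - 2 * (0 - G r 0)
      + (∫ s in (R / 2)..r, (s : ℂ) * q s * M s) - 2 * n * M r) / r) r := by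
    refine exists_hasDerivAt_of_tendsto_radial (R := R) (K := 4 * K) (n := n) (q := q)
      (y := M) (B := fun r => 2 * (0 - G r 0)) (r₀ := R / 2)
      (hq.mono Ioo_subset_Icc_self)
      (continuousOn_const.mul (continuousOn_const.sub (hslice' 0 (by simp)))) hY
      (Bs := fun j s => 2 * ((1 - ((1 - e j : ℝ) : ℂ)) ^ (n + 1) * G s (1 - e j)
        - (1 - (e j : ℂ)) ^ (n + 1) * G s (e j)))
      (fun j => continuousOn_const.mul ((continuousOn_const.mul (hslice' _ (hem' j))).sub
        (continuousOn_const.mul (hslice' _ (hem j))))) hZ ?_ ?_ ?_ ?_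
      (hMc.mono Ioo_subset_Icc_self) hr₀
    · intro j r hr
      have hr' := Ioo_subset_Icc_self hr
      have h1 : ‖∫ t in (e j)..(1 - e j), (1 - (t : ℂ)) ^ n * G r t‖ ≤ K * |1 - e j - e j| := by
        refine intervalIntegral.norm_integral_le_of_norm_le_const fun t ht => ?_
        rw [uIoc_of_le (by linarith [he3 j])] at ht
        exact hpt r hr' t ⟨(he0 j).le.trans ht.1.le, ht.2.trans (hem' j).2⟩ n
      refine h1.trans ?_
      have : |1 - e j - e j| ≤ 1 := by
        rw [abs_of_nonneg (by linarith [he3 j])]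
        linarith [he0 j]
      nlinarith
    · intro j r hr
      have hr' := Ioo_subset_Icc_self hr
      have h1 := hpt r hr' _ (hem' j) (n + 1)
      have h2 := hpt r hr' _ (hem j) (n + 1)
      rw [norm_mul, RCLike.norm_ofNat]
      have := norm_sub_le ((1 - ((1 - e j : ℝ) : ℂ)) ^ (n + 1) * G r (1 - e j))
        ((1 - (e j : ℂ)) ^ (n + 1) * G r (e j))
      linarith
    · intro r hr
      have hr' := Ioo_subset_Icc_self hr
      have hi : IntervalIntegrable (fun t : ℝ => (1 - (t : ℂ)) ^ n * G r t)
          MeasureTheory.volume 0 1 := by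
        refine ContinuousOn.intervalIntegrable ?_
        rw [uIcc_of_le zero_le_one]
        exact hintr r hr'
      have hcont := intervalIntegral.continuousOn_primitive_interval' hi left_mem_uIcc
      rw [uIcc_of_le zero_le_one] at hcont
      have hl : ∀ {x : ℕ → ℝ} {x₀ : ℝ}, (∀ j, x j ∈ Icc (0 : ℝ) 1) → x₀ ∈ Icc (0 : ℝ) 1 →
          Tendsto x atTop (𝓝 x₀) → Tendsto (fun j => ∫ t in (0 : ℝ)..x j, (1 - (t : ℂ)) ^ n * G r t)
            atTop (𝓝 (∫ t in (0 : ℝ)..x₀, (1 - (t : ℂ)) ^ n * G r t)) := fun {x x₀} hx hx₀ hl =>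
        (hcont x₀ hx₀).tendsto.comp (tendsto_nhdsWithin_iff.2 ⟨hl, Eventually.of_forall hx⟩)
      have h1 := hl hem' (x₀ := 1) (by simp) (by simpa using hel.const_sub 1)
      have h0 := hl hem (x₀ := 0) (by simp) hel
      rw [intervalIntegral.integral_same] at h0
      have := h1.sub h0
      rw [sub_zero] at this
      refine this.congr fun j => ?_
      have hsubi : ∀ x ∈ Icc (0 : ℝ) 1, IntervalIntegrable (fun t : ℝ => (1 - (t : ℂ)) ^ n * G r t)
          MeasureTheory.volume 0 x := fun x hx => hi.mono_set (by
        rw [uIcc_of_le zero_le_one, uIcc_of_le hx.1]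
        exact Icc_subset_Icc_right hx.2)
      exact intervalIntegral.integral_interval_sub_left (hsubi _ (hem' j)) (hsubi _ (hem j))
    · intro r hr
      have hr' := Ioo_subset_Icc_self hr
      have hl : ∀ {x : ℕ → ℝ} {x₀ : ℝ}, (∀ j, x j ∈ Icc (0 : ℝ) 1) → x₀ ∈ Icc (0 : ℝ) 1 →
          Tendsto x atTop (𝓝 x₀) → Tendsto (fun j => (1 - (x j : ℂ)) ^ (n + 1) * G r (x j))
            atTop (𝓝 ((1 - (x₀ : ℂ)) ^ (n + 1) * G r x₀)) := fun {x x₀} hx hx₀ hl => by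
        have hc : ContinuousOn (fun t : ℝ => (1 - (t : ℂ)) ^ (n + 1) * G r t) (Icc 0 1) :=
          (by fun_prop : Continuous fun t : ℝ => (1 - (t : ℂ)) ^ (n + 1)).continuousOn.mul
            (hslice r hr')
        exact (hc x₀ hx₀).tendsto.comp (tendsto_nhdsWithin_iff.2 ⟨hl, Eventually.of_forall hx⟩)
      have h1 := hl hem' (x₀ := 1) (by simp) (by simpa using hel.const_sub 1)
      have h0 := hl hem (x₀ := 0) (by simp) hel
      have := (h1.sub h0).const_mul 2
      simpa using this
  have hqφ : ContinuousOn (fun s : ℝ => (s : ℂ) * q s * φ s) (Icc 0 R) := (hid.mul hq).mul hφ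
  have hq1 : ContinuousOn (fun s : ℝ => (s : ℂ) * q s) (Icc 0 R) := hid.mul hq
  have hqM : ContinuousOn (fun s : ℝ => (s : ℂ) * q s * M s) (Icc 0 R) := (hid.mul hq).mul hMc
  have hi : ∀ {h : ℝ → ℂ}, ContinuousOn h (Icc 0 R) → ∀ a ∈ Icc 0 R, ∀ b ∈ Icc 0 R,
      IntervalIntegrable h MeasureTheory.volume a b := fun hh a ha b hb =>
    (hh.mono (ordConnected_Icc.uIcc_subset ha hb)).intervalIntegrable
  have h0R : (0 : ℝ) ∈ Icc 0 R := ⟨le_rfl, hR.le⟩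
  set c : ℂ := 2 * n + (C - ∫ s in (0 : ℝ)..(R / 2), (s : ℂ) * q s * M s) / 2 with hc
  have hd : ∀ r ∈ Ioo 0 R, HasDerivAt φ
      ((c + (∫ s in (0 : ℝ)..r, (s : ℂ) * q s * φ s) - 2 * n * φ r) / r) r := by
    intro r hr
    have hr' := Ioo_subset_Icc_self hr
    have h := ((hC r hr).const_mul (1 / 2 : ℂ)).const_add 1
    refine h.congr_deriv ?_
    have hs1 : ∫ s in (R / 2)..r, (s : ℂ) * q s * M s = (∫ s in (0 : ℝ)..r, (s : ℂ) * q s * M s) -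
        ∫ s in (0 : ℝ)..(R / 2), (s : ℂ) * q s * M s :=
      (intervalIntegral.integral_interval_sub_left (hi hqM _ h0R _ hr')
        (hi hqM _ h0R _ (Ioo_subset_Icc_self hr₀))).symm
    have hs2 : ∫ s in (0 : ℝ)..r, (s : ℂ) * q s * M s =
        2 * (∫ s in (0 : ℝ)..r, (s : ℂ) * q s * φ s) - 2 * ∫ s in (0 : ℝ)..r, (s : ℂ) * q s := by
      rw [← intervalIntegral.integral_const_mul, ← intervalIntegral.integral_const_mul,
        ← intervalIntegral.integral_sub ((hi hqφ _ h0R _ hr').const_mul _)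
          ((hi hq1 _ h0R _ hr').const_mul _)]
      refine intervalIntegral.integral_congr fun s _ => ?_
      simp only [hMφ]
      ring
    rw [hG.initial_t r hr', hs1, hs2, hMφ r, hc]
    ring
  have hE : ContinuousOn (fun r => ∫ s in (0 : ℝ)..r, (s : ℂ) * q s * φ s) (Icc 0 R) := by
    have := intervalIntegral.continuousOn_primitive_interval'
      (hi hqφ 0 h0R R ⟨hR.le, le_rfl⟩) left_mem_uIcc
    rwa [uIcc_of_le hR.le] at this
  have hcn := radial_constant_eq hR hφ hE (by simp) hd
  have hφ0 : φ 0 = 1 := radialFactor_zero hG n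
  rw [hφ0, mul_one] at hcn
  have := hd r hr
  rwa [hcn] at this

end KernelMoments

end RadialVekua

namespace RadialVekua

section FirstOrderSystem

/-- The expression `r φ'(r)` for a regular solution of `φ'' + (2n+1) φ' / r = q φ`, `φ(0) = 1`. -/
noncomputable def eulerTerm (q : ℝ → ℂ) (n : ℕ) (φ : ℝ → ℂ) (r : ℝ) : ℂ :=
  2 * n + (∫ s in (0 : ℝ)..r, (s : ℂ) * q s * φ s) - 2 * n * φ r

/-- `φ` is the regular solution of `φ'' + (2n+1) φ' / r = q φ`, `φ(0) = 1`, on `[0, R]`. -/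
structure IsRadialSolution (R : ℝ) (q : ℝ → ℂ) (n : ℕ) (φ : ℝ → ℂ) : Prop where
  continuousOn : ContinuousOn φ (Icc 0 R)
  map_zero : φ 0 = 1
  hasDerivAt : ∀ r ∈ Ioo 0 R, HasDerivAt φ (eulerTerm q n φ r / r) r

theorem isRadialSolution_radialFactor {R : ℝ} {q : ℝ → ℂ} {G : ℝ → ℝ → ℂ} (hR : 0 < R)
    (hq : ContinuousOn q (Icc 0 R)) (hG : IsTransmutationKernel R q G) (n : ℕ) :
    IsRadialSolution R q n (radialFactor G n) :=
  ⟨continuousOn_radialFactor hG n, radialFactor_zero hG n,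
    fun _ hr => hasDerivAt_radialFactor hR hq hG n hr⟩

/-- Primitives of functions continuous on a compact interval. -/
theorem hasDerivAt_primitive_of_continuousOn_Icc {R : ℝ} {h : ℝ → ℂ}
    (hh : ContinuousOn h (Icc 0 R)) {r : ℝ} (hr : r ∈ Ioo 0 R) :
    HasDerivAt (fun x => ∫ s in (0 : ℝ)..x, h s) (h r) r := by
  refine intervalIntegral.integral_hasDerivAt_right ?_
    ((hh.mono Ioo_subset_Icc_self).stronglyMeasurableAtFilter isOpen_Ioo r hr)
    ((hh.mono Ioo_subset_Icc_self).continuousAt (isOpen_Ioo.mem_nhds hr))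
  refine (hh.mono ?_).intervalIntegrable
  rw [uIcc_of_le hr.1.le]
  exact Icc_subset_Icc_right hr.2.le

theorem continuousOn_primitive_Icc_zero {R : ℝ} (hR : 0 ≤ R) {h : ℝ → ℂ}
    (hh : ContinuousOn h (Icc 0 R)) :
    ContinuousOn (fun x => ∫ s in (0 : ℝ)..x, h s) (Icc 0 R) := by
  have hi : IntervalIntegrable h MeasureTheory.volume 0 R := by
    refine ContinuousOn.intervalIntegrable ?_
    rwa [uIcc_of_le hR]
  have := intervalIntegral.continuousOn_primitive_interval' hi left_mem_uIcc
  rwa [uIcc_of_le hR] at this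

variable {R : ℝ} {q : ℝ → ℂ} {n : ℕ} {φ : ℝ → ℂ}

theorem IsRadialSolution.continuousOn_source (hφ : IsRadialSolution R q n φ)
    (hq : ContinuousOn q (Icc 0 R)) :
    ContinuousOn (fun s : ℝ => (s : ℂ) * q s * φ s) (Icc 0 R) :=
  (Complex.continuous_ofReal.continuousOn.mul hq).mul hφ.continuousOn

theorem IsRadialSolution.continuousOn_eulerTerm (hφ : IsRadialSolution R q n φ) (hR : 0 ≤ R)
    (hq : ContinuousOn q (Icc 0 R)) : ContinuousOn (eulerTerm q n φ) (Icc 0 R) :=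
  (continuousOn_const.add (continuousOn_primitive_Icc_zero hR (hφ.continuousOn_source hq))).sub
    (continuousOn_const.mul hφ.continuousOn)

theorem IsRadialSolution.eulerTerm_zero (hφ : IsRadialSolution R q n φ) :
    eulerTerm q n φ 0 = 0 := by
  simp [eulerTerm, hφ.map_zero]

theorem IsRadialSolution.hasDerivAt_eulerTerm (hφ : IsRadialSolution R q n φ)
    (hq : ContinuousOn q (Icc 0 R)) {r : ℝ} (hr : r ∈ Ioo 0 R) :
    HasDerivAt (eulerTerm q n φ) (((r : ℂ) ^ 2 * q r * φ r - 2 * n * eulerTerm q n φ r) / r) r := by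
  have hr0 : (r : ℂ) ≠ 0 := by exact_mod_cast (ne_of_gt hr.1)
  refine (((hasDerivAt_primitive_of_continuousOn_Icc (hφ.continuousOn_source hq) hr).const_add
    (2 * (n : ℂ))).sub ((hφ.hasDerivAt r hr).const_mul (2 * (n : ℂ)))).congr_deriv ?_
  field_simp

/-- The derivative of a regular radial solution is `r` times a continuous function. -/
theorem IsRadialSolution.exists_eulerTerm_eq (hφ : IsRadialSolution R q n φ) (hR : 0 < R)
    (hq : ContinuousOn q (Icc 0 R)) :
    ∃ ω : ℝ → ℂ, ContinuousOn ω (Icc 0 R) ∧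
      ∀ r ∈ Ico 0 R, eulerTerm q n φ r = (r : ℂ) ^ 2 * ω r := by
  refine ⟨fun r => ∫ l in (0 : ℝ)..1, (l : ℂ) ^ (2 * n + 1) * (q (l * r) * φ (l * r)), ?_, ?_⟩
  · refine continuousOn_intervalIntegral_param
      (H := fun (r l : ℝ) => (l : ℂ) ^ (2 * n + 1) * (q (l * r) * φ (l * r))) ?_
    rw [uIcc_of_le zero_le_one]
    have hmap : MapsTo (fun z : ℝ × ℝ => z.2 * z.1) (Icc 0 R ×ˢ Icc 0 1) (Icc 0 R) :=
      fun z hz => ⟨mul_nonneg hz.2.1 hz.1.1,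
        (mul_le_of_le_one_left hz.1.1 hz.2.2).trans hz.1.2⟩
    have hc : ContinuousOn (fun z : ℝ × ℝ => z.2 * z.1) (Icc 0 R ×ˢ Icc 0 1) := by fun_prop
    exact (by fun_prop : Continuous fun z : ℝ × ℝ => (z.2 : ℂ) ^ (2 * n + 1)).continuousOn.mul
      ((hq.comp hc hmap).mul (hφ.continuousOn.comp hc hmap))
  · intro r hr
    rcases hr.1.eq_or_lt with h0 | h0
    · rw [← h0, hφ.eulerTerm_zero]
      simp
    have hrm : r ∈ Ioo 0 R := ⟨h0, hr.2⟩
    have hr0 : (r : ℂ) ≠ 0 := by exact_mod_cast (ne_of_gt h0)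
    have hsub : Icc 0 r ⊆ Icc 0 R := Icc_subset_Icc_right hr.2.le
    have hcs : ContinuousOn (fun s : ℝ => (s : ℂ) ^ (2 * n + 1) * (q s * φ s)) (Icc 0 R) :=
      (by fun_prop : Continuous fun s : ℝ => (s : ℂ) ^ (2 * n + 1)).continuousOn.mul
        (hq.mul hφ.continuousOn)
    have hftc : ∫ s in (0 : ℝ)..r, (s : ℂ) ^ (2 * n + 1) * (q s * φ s) =
        (r : ℂ) ^ (2 * n) * eulerTerm q n φ r - ((0 : ℝ) : ℂ) ^ (2 * n) * eulerTerm q n φ 0 := by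
      refine intervalIntegral.integral_eq_sub_of_hasDerivAt_of_le h0.le
        (f := fun s : ℝ => (s : ℂ) ^ (2 * n) * eulerTerm q n φ s) ?_ (fun s hs => ?_) ?_
      · exact ((by fun_prop : Continuous fun s : ℝ => (s : ℂ) ^ (2 * n)).continuousOn.mul
          (hφ.continuousOn_eulerTerm hR.le hq)).mono hsub
      · have hs' : s ∈ Ioo 0 R := ⟨hs.1, hs.2.trans hr.2⟩
        have hs0 : (s : ℂ) ≠ 0 := by exact_mod_cast (ne_of_gt hs.1)
        refine ((hasDerivAt_ofReal_pow_div (2 * n) (ne_of_gt hs.1)).mul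
          (hφ.hasDerivAt_eulerTerm hq hs')).congr_deriv ?_
        push_cast
        field_simp
        ring
      · refine ContinuousOn.intervalIntegrable ?_
        rw [uIcc_of_le h0.le]
        exact hcs.mono hsub
    rw [hφ.eulerTerm_zero, mul_zero, sub_zero] at hftc
    have hscale := intervalIntegral.smul_integral_comp_mul_right (a := 0) (b := 1)
      (fun s : ℝ => (s : ℂ) ^ (2 * n + 1) * (q s * φ s)) r
    rw [zero_mul, one_mul, hftc, Complex.real_smul] at hscale
    have hpull : ∫ l in (0 : ℝ)..1, ((l * r : ℝ) : ℂ) ^ (2 * n + 1) * (q (l * r) * φ (l * r)) =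
        (r : ℂ) ^ (2 * n + 1) *
          ∫ l in (0 : ℝ)..1, (l : ℂ) ^ (2 * n + 1) * (q (l * r) * φ (l * r)) := by
      rw [← intervalIntegral.integral_const_mul]
      refine intervalIntegral.integral_congr fun l _ => ?_
      push_cast
      ring
    rw [hpull] at hscale
    have hpow : (r : ℂ) ^ (2 * n) ≠ 0 := pow_ne_zero _ hr0
    refine mul_left_cancel₀ hpow ?_
    rw [← hscale]
    ring

/-- Uniqueness for the singular first order system of the radial formal powers. -/
theorem eq_zero_of_singular_system {R : ℝ} {n : ℕ} {X Y F : ℝ → ℂ} {C : ℝ}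
    (hX : ContinuousOn X (Ico 0 R)) (hY : ContinuousOn Y (Ico 0 R)) (hX0 : X 0 = 0) (hY0 : Y 0 = 0)
    (hF : ∀ r ∈ Ioo 0 R, ‖F r‖ ≤ C * r)
    (hdX : ∀ r ∈ Ioo 0 R, HasDerivAt X ((-n * (X r + Y r) - F r * X r) / r) r)
    (hdY : ∀ r ∈ Ioo 0 R, HasDerivAt Y ((-n * (X r + Y r) + F r * Y r) / r) r) :
    ∀ r ∈ Ico 0 R, X r = 0 ∧ Y r = 0 := by
  set v : ℝ → ℝ := fun r => Real.exp (-(2 * C) * r) * (‖X r‖ ^ 2 + ‖Y r‖ ^ 2) with hv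
  have hvc : ContinuousOn v (Ico 0 R) :=
    (by fun_prop : Continuous fun r : ℝ => Real.exp (-(2 * C) * r)).continuousOn.mul
      ((hX.norm.pow 2).add (hY.norm.pow 2))
  have hvd : ∀ r ∈ Ioo 0 R, ∃ d ≤ 0, HasDerivAt v d r := by
    intro r hr
    have hr0 : (r : ℂ) ≠ 0 := by exact_mod_cast (ne_of_gt hr.1)
    have he : HasDerivAt (fun r : ℝ => Real.exp (-(2 * C) * r))
        (Real.exp (-(2 * C) * r) * (-(2 * C))) r := by
      simpa using ((hasDerivAt_id r).const_mul (-(2 * C))).exp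
    refine ⟨_, ?_, he.mul ((hdX r hr).norm_sq.add (hdY r hr).norm_sq)⟩
    have hXs : (-n * (X r + Y r) - F r * X r) / r =
        (-((n : ℝ) / r)) • (X r + Y r) - (F r / r) * X r := by
      rw [Complex.real_smul]
      push_cast
      field_simp
    have hYs : (-n * (X r + Y r) + F r * Y r) / r =
        (-((n : ℝ) / r)) • (X r + Y r) + (F r / r) * Y r := by
      rw [Complex.real_smul]
      push_cast
      field_simp
    have hFr : ‖F r / r‖ ≤ C := by
      rw [norm_div, Complex.norm_real, Real.norm_of_nonneg hr.1.le, div_le_iff₀ hr.1]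
      exact hF r hr
    have hcs : ∀ Z : ℂ, |inner ℝ Z (F r / r * Z)| ≤ C * ‖Z‖ ^ 2 := by
      intro Z
      refine (abs_real_inner_le_norm _ _).trans ?_
      rw [norm_mul]
      nlinarith [norm_nonneg Z, mul_le_mul_of_nonneg_right hFr (sq_nonneg ‖Z‖)]
    have hsum : inner ℝ (X r) (X r + Y r) + inner ℝ (Y r) (X r + Y r) = ‖X r + Y r‖ ^ 2 := by
      rw [← inner_add_left, real_inner_self_eq_norm_sq]
    have h1 := abs_le.1 (hcs (X r))
    have h2 := abs_le.1 (hcs (Y r))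
    have hnr : 0 ≤ (n : ℝ) / r := div_nonneg (Nat.cast_nonneg n) hr.1.le
    have hneg : inner ℝ (X r) ((-n * (X r + Y r) - F r * X r) / r) +
        inner ℝ (Y r) ((-n * (X r + Y r) + F r * Y r) / r) ≤ C * (‖X r‖ ^ 2 + ‖Y r‖ ^ 2) := by
      rw [hXs, hYs, inner_sub_right, inner_add_right, real_inner_smul_right, real_inner_smul_right]
      have := mul_nonneg hnr (sq_nonneg ‖X r + Y r‖)
      rw [← hsum] at this
      nlinarith
    have hexp := Real.exp_pos (-(2 * C) * r)
    nlinarith [mul_le_mul_of_nonneg_left hneg hexp.le]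
  have hanti : AntitoneOn v (Ico 0 R) := by
    refine antitoneOn_of_deriv_nonpos (convex_Ico 0 R) hvc ?_ ?_
    · rw [interior_Ico]
      intro r hr
      obtain ⟨d, _, hd⟩ := hvd r hr
      exact hd.differentiableAt.differentiableWithinAt
    · rw [interior_Ico]
      intro r hr
      obtain ⟨d, hd0, hd⟩ := hvd r hr
      rwa [hd.deriv]
  intro r hr
  have h0 : (0 : ℝ) ∈ Ico 0 R := ⟨le_rfl, hr.1.trans_lt hr.2⟩
  have hle := hanti h0 hr hr.1
  have hv0 : v 0 = 0 := by simp [hv, hX0, hY0]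
  rw [hv0] at hle
  have hsum : ‖X r‖ ^ 2 + ‖Y r‖ ^ 2 ≤ 0 := by
    by_contra hcon
    exact absurd hle (not_le.2 (mul_pos (Real.exp_pos _) (not_le.1 hcon)))
  constructor
  · rw [← norm_eq_zero]
    nlinarith [sq_nonneg ‖X r‖, sq_nonneg ‖Y r‖]
  · rw [← norm_eq_zero]
    nlinarith [sq_nonneg ‖X r‖, sq_nonneg ‖Y r‖]

/-- The logarithmic Euler derivative `r f'(r) / f(r)`. -/
noncomputable def logEuler (q f : ℝ → ℂ) (r : ℝ) : ℂ := eulerTerm q 0 f r / f r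

variable {f q' ψ : ℝ → ℂ}

theorem continuousOn_logEuler (hf : IsRadialSolution R q 0 f) (hR : 0 ≤ R)
    (hq : ContinuousOn q (Icc 0 R)) (hf0 : ∀ r ∈ Icc 0 R, f r ≠ 0) :
    ContinuousOn (logEuler q f) (Icc 0 R) :=
  (hf.continuousOn_eulerTerm hR hq).div hf.continuousOn hf0

theorem exists_logEuler_eq (hf : IsRadialSolution R q 0 f) (hR : 0 < R)
    (hq : ContinuousOn q (Icc 0 R)) (hf0 : ∀ r ∈ Icc 0 R, f r ≠ 0) :
    ∃ g : ℝ → ℂ, ContinuousOn g (Icc 0 R) ∧ ∀ r ∈ Ico 0 R, logEuler q f r = (r : ℂ) ^ 2 * g r := by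
  obtain ⟨ω, hω, he⟩ := hf.exists_eulerTerm_eq hR hq
  refine ⟨fun r => ω r / f r, hω.div hf.continuousOn hf0, fun r hr => ?_⟩
  rw [logEuler, he r hr, mul_div_assoc]

theorem hasDerivAt_logEuler (hf : IsRadialSolution R q 0 f)
    (hq : ContinuousOn q (Icc 0 R)) (hf0 : ∀ r ∈ Icc 0 R, f r ≠ 0) {r : ℝ} (hr : r ∈ Ioo 0 R) :
    HasDerivAt (logEuler q f) (((r : ℂ) ^ 2 * q r - logEuler q f r ^ 2) / r) r := by
  have hr0 : (r : ℂ) ≠ 0 := by exact_mod_cast (ne_of_gt hr.1)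
  have hfr := hf0 r (Ioo_subset_Icc_self hr)
  refine ((hf.hasDerivAt_eulerTerm hq hr).div (hf.hasDerivAt r hr) hfr).congr_deriv ?_
  unfold logEuler
  push_cast
  field_simp
  ring

/-- The radial factors for a potential and its Darboux transform are related by the first order
system of the Vekua equation. -/
theorem first_order_relations (hR : 0 < R) (hq : ContinuousOn q (Icc 0 R))
    (hq' : ContinuousOn q' (Icc 0 R)) (hf : IsRadialSolution R q 0 f)
    (hf0 : ∀ r ∈ Icc 0 R, f r ≠ 0)
    (hqq' : ∀ r ∈ Ioo 0 R, (r : ℂ) ^ 2 * q' r = 2 * logEuler q f r ^ 2 - (r : ℂ) ^ 2 * q r)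
    (hφ : IsRadialSolution R q n φ) (hψ : IsRadialSolution R q' n ψ) {r : ℝ} (hr : r ∈ Ico 0 R) :
    eulerTerm q n φ r + n * φ r - logEuler q f r * φ r = n * ψ r ∧
      eulerTerm q' n ψ r + n * ψ r + logEuler q f r * ψ r = n * φ r := by
  obtain ⟨g, hg, hFg⟩ := exists_logEuler_eq hf hR hq hf0
  obtain ⟨B, hB⟩ := isCompact_Icc.exists_bound_of_continuousOn hg
  have hB0 : 0 ≤ B := (norm_nonneg _).trans (hB 0 ⟨le_rfl, hR.le⟩)
  set F := logEuler q f with hF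
  have hFc : ContinuousOn F (Icc 0 R) := continuousOn_logEuler hf hR.le hq hf0
  have hF0 : F 0 = 0 := by simp [hF, logEuler, hf.eulerTerm_zero]
  set X : ℝ → ℂ := fun r => eulerTerm q n φ r + n * φ r - F r * φ r - n * ψ r with hXdef
  set Y : ℝ → ℂ := fun r => eulerTerm q' n ψ r + n * ψ r + F r * ψ r - n * φ r with hYdef
  have hXc : ContinuousOn X (Icc 0 R) :=
    (((hφ.continuousOn_eulerTerm hR.le hq).add (continuousOn_const.mul hφ.continuousOn)).sub
      (hFc.mul hφ.continuousOn)).sub (continuousOn_const.mul hψ.continuousOn)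
  have hYc : ContinuousOn Y (Icc 0 R) :=
    (((hψ.continuousOn_eulerTerm hR.le hq').add (continuousOn_const.mul hψ.continuousOn)).add
      (hFc.mul hψ.continuousOn)).sub (continuousOn_const.mul hφ.continuousOn)
  have hX0 : X 0 = 0 := by
    simp [hXdef, hφ.eulerTerm_zero, hF0, hφ.map_zero, hψ.map_zero]
  have hY0 : Y 0 = 0 := by
    simp [hYdef, hψ.eulerTerm_zero, hF0, hφ.map_zero, hψ.map_zero]
  have hXY := eq_zero_of_singular_system (R := R) (n := n) (F := F) (C := B * R)
    (hXc.mono Ico_subset_Icc_self) (hYc.mono Ico_subset_Icc_self) hX0 hY0 ?_ ?_ ?_ r hr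
  · exact ⟨sub_eq_zero.1 hXY.1, sub_eq_zero.1 hXY.2⟩
  · intro r hr
    rw [hFg r ⟨hr.1.le, hr.2⟩, norm_mul, norm_pow, Complex.norm_real, Real.norm_of_nonneg hr.1.le]
    have h1 := hB r (Ioo_subset_Icc_self hr)
    have h2 : r ^ 2 * ‖g r‖ ≤ r ^ 2 * B := mul_le_mul_of_nonneg_left h1 (sq_nonneg r)
    have h3 : r * B * r ≤ r * B * R := mul_le_mul_of_nonneg_left hr.2.le (mul_nonneg hr.1.le hB0)
    nlinarith
  · intro r hr
    have hr0 : (r : ℂ) ≠ 0 := by exact_mod_cast (ne_of_gt hr.1)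
    have hd := (((hφ.hasDerivAt_eulerTerm hq hr).add ((hφ.hasDerivAt r hr).const_mul (n : ℂ))).sub
      ((hasDerivAt_logEuler hf hq hf0 hr).mul (hφ.hasDerivAt r hr))).sub
      ((hψ.hasDerivAt r hr).const_mul (n : ℂ))
    refine hd.congr_deriv ?_
    simp only [hXdef, hYdef, ← hF]
    field_simp
    ring
  · intro r hr
    have hr0 : (r : ℂ) ≠ 0 := by exact_mod_cast (ne_of_gt hr.1)
    have hd := (((hψ.hasDerivAt_eulerTerm hq' hr).add ((hψ.hasDerivAt r hr).const_mul (n : ℂ))).add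
      ((hasDerivAt_logEuler hf hq hf0 hr).mul (hψ.hasDerivAt r hr))).sub
      ((hφ.hasDerivAt r hr).const_mul (n : ℂ))
    refine hd.congr_deriv ?_
    have := hqq' r hr
    simp only [hXdef, hYdef, ← hF]
    rw [this]
    field_simp
    ring

end FirstOrderSystem

end RadialVekua

namespace Bicomplex

/-- The identification of the bicomplex numbers with pairs of complex numbers. -/
noncomputable def prodEquiv : Bicomplex ≃L[ℂ] ℂ × ℂ := WithLp.prodContinuousLinearEquiv 2 ℂ ℂ ℂ

/-- The map `(u, v) ↦ u + 𝐣 v`. -/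
noncomputable def mkCLM : ℂ × ℂ →L[ℝ] Bicomplex :=
  (prodEquiv.symm : ℂ × ℂ →L[ℂ] Bicomplex).restrictScalars ℝ

/-- The scalar and vectorial parts. -/
noncomputable def partsCLM : Bicomplex →L[ℝ] ℂ × ℂ :=
  (prodEquiv : Bicomplex →L[ℂ] ℂ × ℂ).restrictScalars ℝ

theorem mkCLM_apply (p : ℂ × ℂ) : mkCLM p = mk p.1 p.2 := rfl

theorem norm_le_sc_add_vec (W : Bicomplex) : ‖W‖ ≤ ‖W.sc‖ + ‖W.vec‖ := by
  rw [norm_eq]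
  refine Real.sqrt_le_iff.2 ⟨by positivity, ?_⟩
  nlinarith [norm_nonneg W.sc, norm_nonneg W.vec]

theorem sc_sub (W Z : Bicomplex) : (W - Z).sc = W.sc - Z.sc := rfl

theorem vec_sub (W Z : Bicomplex) : (W - Z).vec = W.vec - Z.vec := rfl

theorem hasFDerivAt_mk {u v : ℂ → ℂ} {u' v' : ℂ →L[ℝ] ℂ} {z : ℂ} (hu : HasFDerivAt u u' z)
    (hv : HasFDerivAt v v' z) :
    HasFDerivAt (fun w => mk (u w) (v w)) (mkCLM.comp (u'.prod v')) z :=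
  mkCLM.hasFDerivAt.comp z (hu.prodMk hv)

theorem dbar_mk {u v : ℂ → ℂ} {u' v' : ℂ →L[ℝ] ℂ} {z : ℂ} (hu : HasFDerivAt u u' z)
    (hv : HasFDerivAt v v' z) :
    dbar (fun w => mk (u w) (v w)) z =
      mk (1 / 2 * (u' 1 - v' Complex.I)) (1 / 2 * (v' 1 + u' Complex.I)) := by
  rw [dbar, (hasFDerivAt_mk hu hv).fderiv]
  refine ext ?_ ?_
  · simp [mkCLM_apply, j]
    ring
  · simp [mkCLM_apply, j]
    ring

/-- The Vekua equation at a point in terms of the scalar and vectorial parts. -/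
theorem vekua_iff {u v g : ℂ → ℂ} {u' v' g' : ℂ →L[ℝ] ℂ} {z : ℂ} (hu : HasFDerivAt u u' z)
    (hv : HasFDerivAt v v' z) (hg : HasFDerivAt g g' z) :
    dbar (fun w => mk (u w) (v w)) z =
        ((g z)⁻¹ • dbar (fun w => ofScalar (g w)) z) * conj (mk (u z) (v z)) ↔
      u' 1 - v' Complex.I = (g z)⁻¹ * (g' 1 * u z + g' Complex.I * v z) ∧
        v' 1 + u' Complex.I = (g z)⁻¹ * (g' Complex.I * u z - g' 1 * v z) := by
  have hg2 := dbar_mk hg (hasFDerivAt_const (0 : ℂ) z)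
  change dbar (fun w => ofScalar (g w)) z = _ at hg2
  rw [dbar_mk hu hv, hg2]
  constructor
  · intro h
    have h1 := congrArg sc h
    have h2 := congrArg vec h
    simp [conj] at h1 h2
    constructor
    · linear_combination 2 * h1
    · linear_combination 2 * h2
  · rintro ⟨h1, h2⟩
    refine ext ?_ ?_
    · simp [conj]
      linear_combination (1 / 2) * h1
    · simp [conj]
      linear_combination (1 / 2) * h2

/-- The complex numbers obtained by substituting `± i` for `𝐣`. -/
def eval (ε : ℂ) (W : Bicomplex) : ℂ := W.sc + ε * W.vec

theorem eval_mul {ε : ℂ} (hε : ε ^ 2 = -1) (W Z : Bicomplex) :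
    eval ε (W * Z) = eval ε W * eval ε Z := by
  simp only [eval, sc_mul, vec_mul]
  linear_combination -(W.vec * Z.vec) * hε

theorem eval_one (ε : ℂ) : eval ε 1 = 1 := by simp [eval]

theorem eval_pow {ε : ℂ} (hε : ε ^ 2 = -1) (W : Bicomplex) (n : ℕ) :
    eval ε (W ^ n) = eval ε W ^ n := by
  induction n with
  | zero => simp [eval_one]
  | succ n ih => rw [pow_succ, eval_mul hε, ih, pow_succ]

theorem eval_I_hat (z : ℂ) : eval Complex.I (hat z) = z := by
  simp only [eval, hat, sc_mk, vec_mk]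
  rw [mul_comm]
  exact Complex.re_add_im z

theorem eval_neg_I_hat (z : ℂ) : eval (-Complex.I) (hat z) = (starRingEnd ℂ) z := by
  apply Complex.ext <;> simp [eval, hat]

theorem neg_I_sq : (-Complex.I) ^ 2 = -1 := by simp

theorem sc_eq_eval (W : Bicomplex) : W.sc = (eval Complex.I W + eval (-Complex.I) W) / 2 := by
  simp only [eval]
  ring

theorem vec_eq_eval (W : Bicomplex) :
    W.vec = -Complex.I * (eval Complex.I W - eval (-Complex.I) W) / 2 := by
  simp only [eval]
  linear_combination W.vec * Complex.I_sq

theorem eval_mul_hat_pow (A : Bicomplex) (n : ℕ) (z : ℂ) :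
    eval Complex.I (A * hat z ^ n) = eval Complex.I A * z ^ n := by
  rw [eval_mul Complex.I_sq, eval_pow Complex.I_sq, eval_I_hat]

theorem eval_neg_mul_hat_pow (A : Bicomplex) (n : ℕ) (z : ℂ) :
    eval (-Complex.I) (A * hat z ^ n) = eval (-Complex.I) A * (starRingEnd ℂ) z ^ n := by
  rw [eval_mul neg_I_sq, eval_pow neg_I_sq, eval_neg_I_hat]

/-- The derivatives of the components of the bicomplex powers. -/
theorem exists_hasFDerivAt_hat_pow (A : Bicomplex) (n : ℕ) (z : ℂ) :
    ∃ a' b' : ℂ →L[ℝ] ℂ, HasFDerivAt (fun w => (A * hat w ^ n).sc) a' z ∧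
      HasFDerivAt (fun w => (A * hat w ^ n).vec) b' z ∧
      a' 1 = b' Complex.I ∧ b' 1 = -a' Complex.I ∧
      a' z = n * (A * hat z ^ n).sc ∧ b' z = n * (A * hat z ^ n).vec ∧
      a' (Complex.I * z) = -n * (A * hat z ^ n).vec ∧
      b' (Complex.I * z) = n * (A * hat z ^ n).sc := by
  set P := eval Complex.I A with hP
  set Q := eval (-Complex.I) A with hQ
  have hsc : (fun w => (A * hat w ^ n).sc) =
      fun w => (P * w ^ n + Q * (starRingEnd ℂ) w ^ n) / 2 := by
    funext w
    rw [sc_eq_eval, eval_mul_hat_pow, eval_neg_mul_hat_pow]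
  have hvec : (fun w => (A * hat w ^ n).vec) =
      fun w => -Complex.I * (P * w ^ n - Q * (starRingEnd ℂ) w ^ n) / 2 := by
    funext w
    rw [vec_eq_eval, eval_mul_hat_pow, eval_neg_mul_hat_pow]
  have h1 : HasFDerivAt (fun w : ℂ => w ^ n)
      ((n * z ^ (n - 1) : ℂ) • (ContinuousLinearMap.id ℝ ℂ)) z := by
    refine ((hasDerivAt_pow n z).hasFDerivAt.restrictScalars ℝ).congr_fderiv ?_
    ext
    simp [mul_comm]
  have h2 : HasFDerivAt (fun w : ℂ => (starRingEnd ℂ) w ^ n)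
      ((n * (starRingEnd ℂ) z ^ (n - 1) : ℂ) • (Complex.conjCLE : ℂ →L[ℝ] ℂ)) z := by
    have hc : HasFDerivAt (fun w : ℂ => (starRingEnd ℂ) w) (Complex.conjCLE : ℂ →L[ℝ] ℂ) z :=
      Complex.conjCLE.hasFDerivAt
    have hp : HasFDerivAt (fun w : ℂ => w ^ n)
      ((n * (starRingEnd ℂ) z ^ (n - 1) : ℂ) • (ContinuousLinearMap.id ℝ ℂ))
        ((starRingEnd ℂ) z) := by
      refine ((hasDerivAt_pow n ((starRingEnd ℂ) z)).hasFDerivAt.restrictScalars ℝ).congr_fderiv ?_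
      ext
      simp [mul_comm]
    refine (hp.comp z hc).congr_fderiv ?_
    ext; simp
  have ha := (((h1.const_mul P).fun_add (h2.const_mul Q)).mul_const (2⁻¹ : ℂ))
  have hb := ((((h1.const_mul P).fun_sub (h2.const_mul Q)).const_mul (-Complex.I)).mul_const (2⁻¹ : ℂ))
  have hpow : ∀ w : ℂ, (n : ℂ) * w ^ (n - 1) * w = n * w ^ n := by
    intro w
    rcases n with _ | n
    · simp
    · simp [pow_succ, mul_assoc]
  have e1 := hpow z
  have e2 := hpow ((starRingEnd ℂ) z)
  have ea : (A * hat z ^ n).sc = (P * z ^ n + Q * (starRingEnd ℂ) z ^ n) / 2 := congrFun hsc z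
  have eb : (A * hat z ^ n).vec = -Complex.I * (P * z ^ n - Q * (starRingEnd ℂ) z ^ n) / 2 :=
    congrFun hvec z
  refine ⟨_, _, by rw [hsc]; simpa only [div_eq_mul_inv] using ha,
    by rw [hvec]; simpa only [div_eq_mul_inv] using hb, ?_, ?_, ?_, ?_, ?_, ?_⟩
  · simp
    linear_combination (2⁻¹ * (P * (n * z ^ (n - 1)) + Q * (n * (starRingEnd ℂ) z ^ (n - 1)))) *
      Complex.I_sq
  · simp
    ring
  · rw [ea]
    simp
    linear_combination 2⁻¹ * P * e1 + 2⁻¹ * Q * e2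
  · rw [eb]
    simp
    linear_combination (-Complex.I) * 2⁻¹ * (P * e1 - Q * e2)
  · rw [eb]
    simp
    linear_combination 2⁻¹ * Complex.I * (P * e1 - Q * e2)
  · rw [ea]
    simp
    linear_combination 2⁻¹ * P * e1 + 2⁻¹ * Q * e2 - 2⁻¹ * (P * (n * z ^ (n - 1)) * z +
      Q * (n * (starRingEnd ℂ) z ^ (n - 1)) * (starRingEnd ℂ) z) * Complex.I_sq

theorem contDiff_hat_pow (A : Bicomplex) (n : ℕ) :
    ContDiff ℝ 1 (fun w => (A * hat w ^ n).sc) ∧ ContDiff ℝ 1 (fun w => (A * hat w ^ n).vec) := by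
  have hc : ContDiff ℝ 1 (fun w : ℂ => (starRingEnd ℂ) w) := Complex.conjCLE.contDiff
  have hsc : (fun w => (A * hat w ^ n).sc) =
      fun w => (eval Complex.I A * w ^ n + eval (-Complex.I) A * (starRingEnd ℂ) w ^ n) / 2 := by
    funext w
    rw [sc_eq_eval, eval_mul_hat_pow, eval_neg_mul_hat_pow]
  have hvec : (fun w => (A * hat w ^ n).vec) = fun w =>
      -Complex.I * (eval Complex.I A * w ^ n - eval (-Complex.I) A * (starRingEnd ℂ) w ^ n) / 2 := by
    funext w
    rw [vec_eq_eval, eval_mul_hat_pow, eval_neg_mul_hat_pow]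
  rw [hsc, hvec]
  have h1 : ContDiff ℝ 1 (fun w : ℂ => w ^ n) := contDiff_id.pow n
  have h2 := hc.pow n
  exact ⟨((contDiff_const.mul h1).add (contDiff_const.mul h2)).div_const _,
    (contDiff_const.mul ((contDiff_const.mul h1).sub (contDiff_const.mul h2))).div_const _⟩

end Bicomplex

namespace RadialVekua

open Bicomplex

section RadialFunctions

/-- The real differential of `z ↦ φ(|z|)` when `φ'(r) = r ω(r)`. -/
noncomputable def radialFDeriv (ω : ℝ → ℂ) (z : ℂ) : ℂ →L[ℝ] ℂ :=
  (innerSL ℝ z).smulRight (ω ‖z‖)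

theorem radialFDeriv_apply (ω : ℝ → ℂ) (z h : ℂ) :
    radialFDeriv ω z h = ((z.re * h.re + z.im * h.im : ℝ) : ℂ) * ω ‖z‖ := by
  simp [radialFDeriv, Complex.inner, Complex.real_smul]
  left
  ring

variable {R : ℝ} {φ ω : ℝ → ℂ}

theorem hasFDerivAt_radial (hφ : ContinuousOn φ (Ico 0 R)) (hω : ContinuousOn ω (Ico 0 R))
    (hd : ∀ r ∈ Ioo 0 R, HasDerivAt φ (r * ω r) r) {z : ℂ} (hz : ‖z‖ < R) :
    HasFDerivAt (fun w : ℂ => φ ‖w‖) (radialFDeriv ω z) z := by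
  rcases eq_or_ne z 0 with rfl | hz0
  · have hR : 0 < R := by simpa using hz
    have hIoo : Ioo 0 R ∈ 𝓝[>] (0 : ℝ) := Ioo_mem_nhdsGT hR
    have h0 : HasDerivWithinAt φ 0 (Ici 0) 0 := by
      refine hasDerivWithinAt_Ici_of_tendsto_deriv (s := Ioo 0 R)
        (fun r hr => (hd r hr).differentiableAt.differentiableWithinAt)
        ((hφ 0 ⟨le_rfl, hR⟩).mono Ioo_subset_Ico_self) hIoo ?_
      have hc : ContinuousOn (fun r : ℝ => (r : ℂ) * ω r) (Ico 0 R) :=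
        Complex.continuous_ofReal.continuousOn.mul hω
      have hl := (hc 0 ⟨le_rfl, hR⟩).tendsto.mono_left
        (nhdsWithin_le_of_mem (mem_of_superset hIoo Ioo_subset_Ico_self))
      rw [Complex.ofReal_zero, zero_mul] at hl
      refine hl.congr' ?_
      filter_upwards [hIoo] with r hr using (hd r hr).deriv.symm
    have hrad : radialFDeriv ω 0 = 0 := by
      ext
      simp [radialFDeriv]
    rw [hrad, hasFDerivAt_iff_isLittleO]
    have h1 := hasDerivWithinAt_iff_isLittleO.1 h0
    have hn : Tendsto (fun w : ℂ => ‖w‖) (𝓝 0) (𝓝[Ici 0] 0) := by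
      refine tendsto_nhdsWithin_iff.2 ⟨?_, Eventually.of_forall fun w => norm_nonneg w⟩
      simpa using (continuous_norm (E := ℂ)).tendsto 0
    have h2 := h1.comp_tendsto hn
    have h3 : (fun w : ℂ => φ ‖w‖ - φ ‖(0 : ℂ)‖ - (0 : ℂ →L[ℝ] ℂ) (w - 0)) =o[𝓝 0]
        fun w : ℂ => ‖w‖ := by
      simpa [Function.comp_def] using h2
    refine h3.trans_isBigO ?_
    simpa using (Asymptotics.isBigO_refl (fun w : ℂ => w) (𝓝 0)).norm_left
  · have hpos : 0 < ‖z‖ := norm_pos_iff.2 hz0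
    have h1 : HasFDerivAt (fun w : ℂ => ‖w‖ ^ 2) (2 • (innerSL ℝ z)) z := by
      simpa using (hasFDerivAt_id (𝕜 := ℝ) z).norm_sq
    have h2 : HasFDerivAt (fun w : ℂ => ‖w‖) ((‖z‖)⁻¹ • innerSL ℝ z) z := by
      have := h1.sqrt (by positivity)
      simp only [Real.sqrt_sq (norm_nonneg _)] at this
      refine this.congr_fderiv ?_
      ext
      simp
      field_simp
    refine ((hd ‖z‖ ⟨hpos, hz⟩).hasFDerivAt.comp z h2).congr_fderiv ?_
    have hne : ((‖z‖ : ℝ) : ℂ) ≠ 0 := by exact_mod_cast hpos.ne'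
    ext
    simp [radialFDeriv, Complex.real_smul]
    field_simp

theorem contDiffOn_radial (hφ : ContinuousOn φ (Ico 0 R)) (hω : ContinuousOn ω (Ico 0 R))
    (hd : ∀ r ∈ Ioo 0 R, HasDerivAt φ (r * ω r) r) :
    ContDiffOn ℝ 1 (fun w : ℂ => φ ‖w‖) (Metric.ball 0 R) := by
  have hder : ∀ z ∈ Metric.ball (0 : ℂ) R,
      HasFDerivAt (fun w : ℂ => φ ‖w‖) (radialFDeriv ω z) z := fun z hz =>
    hasFDerivAt_radial hφ hω hd (by simpa using hz)
  have := (contDiffOn_succ_iff_fderiv_of_isOpen (𝕜 := ℝ) (n := 0)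
    (f := fun w : ℂ => φ ‖w‖) (s := Metric.ball 0 R) Metric.isOpen_ball).2
    ⟨fun z hz => (hder z hz).differentiableAt.differentiableWithinAt, by simp, ?_⟩
  · simpa using this
  · refine contDiffOn_zero.2 (ContinuousOn.congr (f := radialFDeriv ω) ?_
      fun z hz => (hder z hz).fderiv)
    have hω' : ContinuousOn (fun z : ℂ => ω ‖z‖) (Metric.ball 0 R) :=
      hω.comp continuous_norm.continuousOn fun z hz => ⟨norm_nonneg z, by simpa using hz⟩
    have hre : ContinuousOn (fun z : ℂ => (z.re : ℂ) * ω ‖z‖) (Metric.ball 0 R) :=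
      (Complex.continuous_ofReal.comp Complex.continuous_re).continuousOn.mul hω'
    have him : ContinuousOn (fun z : ℂ => (z.im : ℂ) * ω ‖z‖) (Metric.ball 0 R) :=
      (Complex.continuous_ofReal.comp Complex.continuous_im).continuousOn.mul hω'
    have hsum : ContinuousOn (fun z : ℂ =>
        ((z.re : ℂ) * ω ‖z‖) • (Complex.ofRealCLM.comp Complex.reCLM)
          + ((z.im : ℂ) * ω ‖z‖) • (Complex.ofRealCLM.comp Complex.imCLM)) (Metric.ball 0 R) :=
      (hre.smul continuousOn_const).add (him.smul continuousOn_const)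
    refine hsum.congr fun z _ => ContinuousLinearMap.ext fun h => ?_
    rw [radialFDeriv_apply]
    simp
    ring

end RadialFunctions

section FormalPowers

/-- The transmutation of a homogeneous function is a radial multiple of it. -/
theorem transmutation_of_homogeneous {R : ℝ} {q : ℝ → ℂ}
    (hG : IsTransmutationKernel R q (transmutationKernel R q)) {n : ℕ} {h : ℂ → ℂ}
    (hh : ∀ (s : ℝ) (z : ℂ), h ((s : ℂ) * z) = (s : ℂ) ^ n * h z) {z : ℂ} (hz : ‖z‖ ≤ R) :
    transmutation R q h z = radialFactor (transmutationKernel R q) n ‖z‖ * h z := by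
  set G := transmutationKernel R q
  have hr : ‖z‖ ∈ Icc 0 R := ⟨norm_nonneg z, hz⟩
  have hsub := intervalIntegral.integral_deriv_smul_comp' (a := 0) (b := 1)
    (f := fun σ : ℝ => 1 - σ ^ 2) (f' := fun σ : ℝ => -(2 * σ))
    (g := fun t : ℝ => (1 - (t : ℂ)) ^ n * G ‖z‖ t)
    (fun σ _ => by simpa using (hasDerivAt_pow 2 σ).const_sub 1) (by fun_prop) (by
      have hc : ContinuousOn (fun t : ℝ => (1 - (t : ℂ)) ^ n * G ‖z‖ t) (Icc 0 1) :=
        (by fun_prop : Continuous fun t : ℝ => (1 - (t : ℂ)) ^ n).continuousOn.mul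
          (hG.continuousOn.comp (f := fun t : ℝ => (‖z‖, t)) (by fun_prop) fun t ht => ⟨hr, ht⟩)
      refine hc.mono ?_
      rintro _ ⟨σ, hσ, rfl⟩
      rw [uIcc_of_le zero_le_one] at hσ
      exact ⟨by nlinarith [hσ.1, hσ.2], by nlinarith [hσ.1]⟩)
  simp only [ne_eq, OfNat.ofNat_ne_zero, not_false_eq_true, zero_pow, sub_zero, one_pow,
    sub_self] at hsub
  rw [intervalIntegral.integral_symm 0 1] at hsub
  have hint : ∫ σ in (0 : ℝ)..1, (σ : ℂ) * G ‖z‖ (1 - σ ^ 2) * h ((σ : ℂ) ^ 2 * z) =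
      (-1 / 2 * h z) * ∫ σ in (0 : ℝ)..1, (-(2 * σ)) •
        ((fun t : ℝ => (1 - (t : ℂ)) ^ n * G ‖z‖ t) ∘ fun σ : ℝ => 1 - σ ^ 2) σ := by
    rw [← intervalIntegral.integral_const_mul]
    refine intervalIntegral.integral_congr fun σ _ => ?_
    have h1 := hh (σ ^ 2) z
    push_cast at h1
    simp only [Function.comp, Complex.real_smul]
    rw [h1]
    push_cast
    ring
  rw [transmutation, hint, hsub, radialFactor]
  ring

variable {R : ℝ} {f q : ℝ → ℂ}

theorem hat_real_mul (s : ℝ) (z : ℂ) : hat ((s : ℂ) * z) = ofScalar s * hat z := by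
  refine Bicomplex.ext ?_ ?_ <;> simp [hat, ofScalar]

theorem mul_hat_pow_real_mul (A : Bicomplex) (n : ℕ) (s : ℝ) (z : ℂ) :
    (A * hat ((s : ℂ) * z) ^ n) = (s : ℂ) ^ n • (A * hat z ^ n) := by
  have hs : ∀ B : Bicomplex, ofScalar ((s : ℂ) ^ n) * B = (s : ℂ) ^ n • B := fun B =>
    Bicomplex.ext (by simp [ofScalar]) (by simp [ofScalar])
  have hp : (ofScalar (s : ℂ)) ^ n = ofScalar ((s : ℂ) ^ n) := by
    induction n with
    | zero => exact Bicomplex.ext (by simp [ofScalar]) (by simp [ofScalar])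
    | succ n ih =>
      rw [pow_succ, ih fun B => Bicomplex.ext (by simp [ofScalar]) (by simp [ofScalar]), pow_succ]
      exact Bicomplex.ext (by simp [ofScalar]) (by simp [ofScalar])
  rw [hat_real_mul, mul_pow, hp, ← hs]
  ring

/-- The radial formal powers in terms of the radial factors. -/
theorem formalPower_eq (hG : IsTransmutationKernel R q (transmutationKernel R q))
    (hG' : IsTransmutationKernel R (darbouxPotential R f q)
      (transmutationKernel R (darbouxPotential R f q))) (n : ℕ) (A : Bicomplex) {z : ℂ}
    (hz : ‖z‖ ≤ R) :
    formalPower R f q n A z =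
      mk (radialFactor (transmutationKernel R q) n ‖z‖ * (A * hat z ^ n).sc)
        (radialFactor (transmutationKernel R (darbouxPotential R f q)) n ‖z‖ *
          (A * hat z ^ n).vec) := by
  have hsc : ∀ B : Bicomplex, ∀ (s : ℝ) (z : ℂ),
      (B * hat ((s : ℂ) * z) ^ n).sc = (s : ℂ) ^ n * (B * hat z ^ n).sc := fun B s z => by
    rw [mul_hat_pow_real_mul, sc_smul]
  have hvec : ∀ B : Bicomplex, ∀ (s : ℝ) (z : ℂ),
      (B * hat ((s : ℂ) * z) ^ n).vec = (s : ℂ) ^ n * (B * hat z ^ n).vec := fun B s z => by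
    rw [mul_hat_pow_real_mul, vec_smul]
  have h1 := transmutation_of_homogeneous hG (h := fun w => (1 * hat w ^ n).sc) (hsc 1) hz
  have h2 := transmutation_of_homogeneous hG' (h := fun w => (1 * hat w ^ n).vec) (hvec 1) hz
  have h3 := transmutation_of_homogeneous hG (h := fun w => (j * hat w ^ n).sc) (hsc j) hz
  have h4 := transmutation_of_homogeneous hG' (h := fun w => (j * hat w ^ n).vec) (hvec j) hz
  simp only [one_mul] at h1 h2
  unfold formalPower vekuaTransmutation
  rw [h1, h2, h3, h4]
  refine Bicomplex.ext ?_ ?_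
  · simp [ofScalar, j]
    ring
  · simp [ofScalar, j]
    ring

end FormalPowers

section Setting

/-- The standing assumptions on the potential and the coefficient function. -/
structure IsSetting (R : ℝ) (f q : ℝ → ℂ) : Prop where
  pos : 0 < R
  contDiffOn_q : ContDiffOn ℝ 1 q (Icc 0 R)
  contDiffOn_f : ContDiffOn ℝ 2 f (Icc 0 R)
  ne_zero : ∀ r ∈ Icc 0 R, f r ≠ 0
  map_zero : f 0 = 1
  equation : ∀ r ∈ Ioo 0 R, deriv (deriv f) r + (1 / (r : ℂ)) * deriv f r - q r * f r = 0

variable {R : ℝ} {f q : ℝ → ℂ}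

namespace IsSetting

theorem continuousOn_q (S : IsSetting R f q) : ContinuousOn q (Icc 0 R) :=
  S.contDiffOn_q.continuousOn

theorem isRadialSolution (S : IsSetting R f q) : IsRadialSolution R q 0 f := by
  have hR := S.pos
  have hf := S.contDiffOn_f
  set f' : ℝ → ℂ := derivWithin f (Icc 0 R) with hf'
  have hu := uniqueDiffOn_Icc hR
  have hf'c : ContDiffOn ℝ 1 f' (Icc 0 R) := hf.derivWithin hu (by norm_num)
  have hnhds : ∀ r ∈ Ioo 0 R, Icc 0 R ∈ 𝓝 r := fun r hr => Icc_mem_nhds hr.1 hr.2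
  have hder : ∀ r ∈ Ioo 0 R, deriv f r = f' r := fun r hr =>
    (derivWithin_of_mem_nhds (hnhds r hr)).symm
  have hd1 : ∀ r ∈ Ioo 0 R, HasDerivAt f (f' r) r := fun r hr => by
    rw [← hder r hr]
    exact ((hf.differentiableOn (by norm_num)).differentiableAt (hnhds r hr)).hasDerivAt
  have hd2 : ∀ r ∈ Ioo 0 R, HasDerivAt f' (deriv (deriv f) r) r := fun r hr => by
    have h1 := ((hf'c.differentiableOn (by norm_num)).differentiableAt (hnhds r hr)).hasDerivAt
    have hev : deriv f =ᶠ[𝓝 r] f' := by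
      filter_upwards [isOpen_Ioo.mem_nhds hr] with s hs using hder s hs
    rwa [← hev.deriv_eq] at h1
  have hsrc : ContinuousOn (fun s : ℝ => (s : ℂ) * q s * f s) (Icc 0 R) :=
    (Complex.continuous_ofReal.continuousOn.mul S.continuousOn_q).mul hf.continuousOn
  refine ⟨hf.continuousOn, S.map_zero, fun r hr => ?_⟩
  have hr0 : (r : ℂ) ≠ 0 := by exact_mod_cast (ne_of_gt hr.1)
  have hftc : ∫ s in (0 : ℝ)..r, (s : ℂ) * q s * f s = (r : ℂ) * f' r - ((0 : ℝ) : ℂ) * f' 0 := by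
    have hsub : Icc 0 r ⊆ Icc 0 R := Icc_subset_Icc_right hr.2.le
    refine intervalIntegral.integral_eq_sub_of_hasDerivAt_of_le hr.1.le
      (f := fun s : ℝ => (s : ℂ) * f' s) ?_ (fun s hs => ?_) ?_
    · exact (Complex.continuous_ofReal.continuousOn.mul hf'c.continuousOn).mono hsub
    · have hs' : s ∈ Ioo 0 R := ⟨hs.1, hs.2.trans hr.2⟩
      have hs0 : (s : ℂ) ≠ 0 := by exact_mod_cast (ne_of_gt hs.1)
      have hid : HasDerivAt (fun s : ℝ => (s : ℂ)) 1 s := Complex.ofRealCLM.hasDerivAt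
      refine (hid.mul (hd2 s hs')).congr_deriv ?_
      have := S.equation s hs'
      rw [hder s hs'] at this
      field_simp at this
      linear_combination this
    · refine ContinuousOn.intervalIntegrable ?_
      rw [uIcc_of_le hr.1.le]
      exact hsrc.mono hsub
  refine (hd1 r hr).congr_deriv ?_
  rw [eulerTerm, hftc]
  simp
  field_simp

theorem contDiffOn_darboux (S : IsSetting R f q) :
    ContDiffOn ℝ 1 (darbouxPotential R f q) (Icc 0 R) := by
  have hf' : ContDiffOn ℝ 1 (derivWithin f (Icc 0 R)) (Icc 0 R) :=
    S.contDiffOn_f.derivWithin (uniqueDiffOn_Icc S.pos) (by norm_num)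
  have hf1 : ContDiffOn ℝ 1 f (Icc 0 R) := S.contDiffOn_f.of_le (by norm_num)
  have hdiv : ContDiffOn ℝ 1 (fun r => derivWithin f (Icc 0 R) r / f r) (Icc 0 R) := by
    simp only [div_eq_mul_inv]
    exact hf'.mul (hf1.inv S.ne_zero)
  exact (contDiffOn_const.mul (hdiv.pow 2)).sub S.contDiffOn_q

theorem darboux_eq (S : IsSetting R f q) {r : ℝ} (hr : r ∈ Ioo 0 R) :
    (r : ℂ) ^ 2 * darbouxPotential R f q r = 2 * logEuler q f r ^ 2 - (r : ℂ) ^ 2 * q r := by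
  have hr0 : (r : ℂ) ≠ 0 := by exact_mod_cast (ne_of_gt hr.1)
  have hfr := S.ne_zero r (Ioo_subset_Icc_self hr)
  rw [darbouxPotential, derivWithin_of_mem_nhds (Icc_mem_nhds hr.1 hr.2),
    (S.isRadialSolution.hasDerivAt r hr).deriv, logEuler]
  field_simp

theorem isKernel (S : IsSetting R f q) :
    IsTransmutationKernel R q (transmutationKernel R q) :=
  isTransmutationKernel_transmutationKernel S.pos S.contDiffOn_q

theorem isKernel' (S : IsSetting R f q) :
    IsTransmutationKernel R (darbouxPotential R f q)
      (transmutationKernel R (darbouxPotential R f q)) :=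
  isTransmutationKernel_transmutationKernel S.pos S.contDiffOn_darboux

end IsSetting

/-- The radial factor of the scalar part of the formal powers. -/
noncomputable def scFactor (R : ℝ) (q : ℝ → ℂ) (n : ℕ) : ℝ → ℂ :=
  radialFactor (transmutationKernel R q) n

/-- The radial factor of the vectorial part of the formal powers. -/
noncomputable def vecFactor (R : ℝ) (f q : ℝ → ℂ) (n : ℕ) : ℝ → ℂ :=
  radialFactor (transmutationKernel R (darbouxPotential R f q)) n

namespace IsSetting

theorem isRadialSolution_scFactor (S : IsSetting R f q) (n : ℕ) :
    IsRadialSolution R q n (scFactor R q n) :=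
  isRadialSolution_radialFactor S.pos S.continuousOn_q S.isKernel n

theorem isRadialSolution_vecFactor (S : IsSetting R f q) (n : ℕ) :
    IsRadialSolution R (darbouxPotential R f q) n (vecFactor R f q n) :=
  isRadialSolution_radialFactor S.pos S.contDiffOn_darboux.continuousOn S.isKernel' n

theorem formalPower_eq (S : IsSetting R f q) (n : ℕ) (A : Bicomplex) {z : ℂ} (hz : ‖z‖ ≤ R) :
    formalPower R f q n A z = Bicomplex.mk (scFactor R q n ‖z‖ * (A * hat z ^ n).sc)
      (vecFactor R f q n ‖z‖ * (A * hat z ^ n).vec) :=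
  RadialVekua.formalPower_eq S.isKernel S.isKernel' n A hz

theorem relations (S : IsSetting R f q) (n : ℕ) {r : ℝ} (hr : r ∈ Ico 0 R) :
    eulerTerm q n (scFactor R q n) r + n * scFactor R q n r - logEuler q f r * scFactor R q n r =
        n * vecFactor R f q n r ∧
      eulerTerm (darbouxPotential R f q) n (vecFactor R f q n) r + n * vecFactor R f q n r
        + logEuler q f r * vecFactor R f q n r = n * scFactor R q n r :=
  first_order_relations S.pos S.continuousOn_q S.contDiffOn_darboux.continuousOn
    S.isRadialSolution S.ne_zero (fun _ hr => S.darboux_eq hr)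
    (S.isRadialSolution_scFactor n) (S.isRadialSolution_vecFactor n) hr

end IsSetting

/-- A regular radial solution defines a `C¹` function of `|z|`. -/
theorem IsRadialSolution.exists_hasFDerivAt {n : ℕ} {φ : ℝ → ℂ} (hφ : IsRadialSolution R q n φ)
    (hR : 0 < R) (hq : ContinuousOn q (Icc 0 R)) :
    ∃ ω : ℝ → ℂ, (∀ z : ℂ, ‖z‖ < R →
        HasFDerivAt (fun w : ℂ => φ ‖w‖) (radialFDeriv ω z) z) ∧
      ContDiffOn ℝ 1 (fun w : ℂ => φ ‖w‖) (Metric.ball 0 R) ∧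
      ∀ r ∈ Ico 0 R, eulerTerm q n φ r = (r : ℂ) ^ 2 * ω r := by
  obtain ⟨ω, hω, he⟩ := hφ.exists_eulerTerm_eq hR hq
  have hd : ∀ r ∈ Ioo 0 R, HasDerivAt φ (r * ω r) r := fun r hr => by
    have hr0 : (r : ℂ) ≠ 0 := by exact_mod_cast (ne_of_gt hr.1)
    refine (hφ.hasDerivAt r hr).congr_deriv ?_
    rw [he r ⟨hr.1.le, hr.2⟩]
    field_simp
  have h1 := hφ.continuousOn.mono Ico_subset_Icc_self
  have h2 := hω.mono Ico_subset_Icc_self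
  exact ⟨ω, fun z hz => hasFDerivAt_radial h1 h2 hd hz, contDiffOn_radial h1 h2 hd, he⟩

theorem radialFDeriv_euler (ω : ℝ → ℂ) (z : ℂ) :
    radialFDeriv ω z z = ((‖z‖ : ℝ) : ℂ) ^ 2 * ω ‖z‖ ∧ radialFDeriv ω z (Complex.I * z) = 0 := by
  constructor
  · rw [radialFDeriv_apply]
    have : z.re * z.re + z.im * z.im = ‖z‖ ^ 2 := by
      rw [← Complex.normSq_apply, Complex.normSq_eq_norm_sq]
    rw [this]
    push_cast
    ring
  · rw [radialFDeriv_apply]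
    have : z.re * (Complex.I * z).re + z.im * (Complex.I * z).im = 0 := by
      simp
      ring
    rw [this]
    simp

theorem clm_apply_eq (L : ℂ →L[ℝ] ℂ) (z : ℂ) : L z = z.re * L 1 + z.im * L Complex.I := by
  have h : z = z.re • (1 : ℂ) + z.im • Complex.I := by
    simp [Complex.real_smul, Complex.re_add_im]
  conv_lhs => rw [h]
  rw [map_add, map_smul, map_smul, Complex.real_smul, Complex.real_smul]

theorem clm_apply_I_mul_eq (L : ℂ →L[ℝ] ℂ) (z : ℂ) :
    L (Complex.I * z) = -z.im * L 1 + z.re * L Complex.I := by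
  rw [clm_apply_eq]
  simp

/-- The Vekua equation with a radial coefficient in polar form. -/
theorem vekua_iff_polar {u v : ℂ → ℂ} {u' v' : ℂ →L[ℝ] ℂ} {ω : ℝ → ℂ} {z : ℂ}
    (hu : HasFDerivAt u u' z) (hv : HasFDerivAt v v' z)
    (hf : HasFDerivAt (fun w : ℂ => f ‖w‖) (radialFDeriv ω z) z) (hz : z ≠ 0) :
    dbar (fun w => mk (u w) (v w)) z =
        ((f ‖z‖)⁻¹ • dbar (fun w => ofScalar (f ‖w‖)) z) * conj (mk (u z) (v z)) ↔
      u' z - v' (Complex.I * z) = ((‖z‖ : ℝ) : ℂ) ^ 2 * ω ‖z‖ / f ‖z‖ * u z ∧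
        v' z + u' (Complex.I * z) = -(((‖z‖ : ℝ) : ℂ) ^ 2 * ω ‖z‖ / f ‖z‖ * v z) := by
  rw [vekua_iff hu hv hf]
  have hn : ((‖z‖ : ℝ) : ℂ) ^ 2 = (z.re : ℂ) ^ 2 + (z.im : ℂ) ^ 2 := by
    have : ‖z‖ ^ 2 = z.re ^ 2 + z.im ^ 2 := by
      rw [← Complex.normSq_eq_norm_sq, Complex.normSq_apply]
      ring
    exact_mod_cast this
  have hn0 : (z.re : ℂ) ^ 2 + (z.im : ℂ) ^ 2 ≠ 0 := by
    rw [← hn]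
    have : ‖z‖ ^ 2 ≠ 0 := pow_ne_zero 2 (norm_ne_zero_iff.2 hz)
    exact_mod_cast this
  rw [clm_apply_eq u' z, clm_apply_eq v' z, clm_apply_I_mul_eq u', clm_apply_I_mul_eq v',
    radialFDeriv_apply, radialFDeriv_apply, hn]
  simp only [Complex.one_re, Complex.one_im, Complex.I_re, Complex.I_im, mul_one, mul_zero,
    add_zero, zero_add, div_eq_mul_inv]
  constructor
  · rintro ⟨h1, h2⟩
    constructor
    · linear_combination (z.re : ℂ) * h1 + (z.im : ℂ) * h2
    · linear_combination (z.re : ℂ) * h2 - (z.im : ℂ) * h1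
  · rintro ⟨h1, h2⟩
    constructor
    · refine mul_left_cancel₀ hn0 ?_
      linear_combination (z.re : ℂ) * h1 - (z.im : ℂ) * h2
    · refine mul_left_cancel₀ hn0 ?_
      linear_combination (z.im : ℂ) * h1 + (z.re : ℂ) * h2

/-- The radial formal powers solve the Vekua equation. -/
theorem formalPower_mem_vekuaSolutions (S : IsSetting R f q) {Ω : Set ℂ} (hΩ : IsOpen Ω)
    (hΩR : ∀ z ∈ Ω, ‖z‖ < R) (n : ℕ) (A : Bicomplex) :
    formalPower R f q n A ∈ vekuaSolutions Ω f := by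
  have hφ := S.isRadialSolution_scFactor n
  have hψ := S.isRadialSolution_vecFactor n
  set φ := scFactor R q n with hφdef
  set ψ := vecFactor R f q n with hψdef
  obtain ⟨ω, hφd, hφc, hφe⟩ := hφ.exists_hasFDerivAt S.pos S.continuousOn_q
  obtain ⟨η, hψd, hψc, hψe⟩ := hψ.exists_hasFDerivAt S.pos S.contDiffOn_darboux.continuousOn
  obtain ⟨ν, hfd, hfc, hfe⟩ := S.isRadialSolution.exists_hasFDerivAt S.pos S.continuousOn_q
  have hsub : Ω ⊆ Metric.ball 0 R := fun z hz => by simpa using hΩR z hz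
  obtain ⟨ca, cb⟩ := contDiff_hat_pow A n
  set u : ℂ → ℂ := fun z => φ ‖z‖ * (A * hat z ^ n).sc with hu
  set v : ℂ → ℂ := fun z => ψ ‖z‖ * (A * hat z ^ n).vec with hv
  have heq : EqOn (formalPower R f q n A) (fun z => mk (u z) (v z)) Ω := fun z hz =>
    S.formalPower_eq n A (hΩR z hz).le
  have huc : ContDiffOn ℝ 1 u Ω := (hφc.mono hsub).mul ca.contDiffOn
  have hvc : ContDiffOn ℝ 1 v Ω := (hψc.mono hsub).mul cb.contDiffOn
  refine ⟨(mkCLM.contDiff.comp_contDiffOn (huc.prodMk hvc)).congr heq, fun z hz => ?_⟩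
  have hdb : dbar (formalPower R f q n A) z = dbar (fun z => mk (u z) (v z)) z := by
    have : formalPower R f q n A =ᶠ[𝓝 z] fun z => mk (u z) (v z) := by
      filter_upwards [hΩ.mem_nhds hz] with w hw using heq hw
    simp only [dbar, this.fderiv_eq]
  rw [hdb, heq hz]
  have hzR := hΩR z hz
  have hzI : ‖z‖ ∈ Ico 0 R := ⟨norm_nonneg z, hzR⟩
  obtain ⟨a', b', ha, hb, c1, c2, e1, e2, e3, e4⟩ := exists_hasFDerivAt_hat_pow A n z
  have hud : HasFDerivAt u _ z := (hφd z hzR).mul ha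
  have hvd : HasFDerivAt v _ z := (hψd z hzR).mul hb
  change dbar (fun z => mk (u z) (v z)) z =
    ((f ‖z‖)⁻¹ • dbar (fun w => ofScalar (f ‖w‖)) z) * conj (mk (u z) (v z))
  rcases eq_or_ne z 0 with rfl | hz0
  · rw [vekua_iff hud hvd (hfd 0 hzR)]
    have hr0 : ∀ (ω : ℝ → ℂ) (h : ℂ), radialFDeriv ω 0 h = 0 := fun ω h => by
      rw [radialFDeriv_apply]
      simp
    have hφ0 : φ ‖(0 : ℂ)‖ = 1 := by simpa using hφ.map_zero
    have hψ0 : ψ ‖(0 : ℂ)‖ = 1 := by simpa using hψ.map_zero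
    simp only [_root_.add_apply, _root_.smul_apply, hr0, hφ0, hψ0,
      smul_eq_mul, c1, c2]
    constructor <;> ring
  · rw [vekua_iff_polar hud hvd (hfd z hzR) hz0]
    obtain ⟨r1, r2⟩ := S.relations n hzI
    rw [← hφdef, ← hψdef] at r1 r2
    rw [hφe _ hzI] at r1
    rw [hψe _ hzI] at r2
    have hF : logEuler q f ‖z‖ = ((‖z‖ : ℝ) : ℂ) ^ 2 * ν ‖z‖ / f ‖z‖ := by
      rw [logEuler, hfe _ hzI]
    rw [hF] at r1 r2
    simp only [_root_.add_apply, _root_.smul_apply, smul_eq_mul, e1, e2,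
      e3, e4, (radialFDeriv_euler ω z).1, (radialFDeriv_euler ω z).2, (radialFDeriv_euler η z).1,
      (radialFDeriv_euler η z).2, hu, hv]
    constructor
    · linear_combination (A * hat z ^ n).sc * r1
    · linear_combination (A * hat z ^ n).vec * r2

end Setting

end RadialVekua

namespace RadialVekua

section InverseKernel

/-- The kernels `n ± m` define the operators that intertwine the radial Vekua system with the
Cauchy-Riemann system; `s² p(s)` is the Euler derivative of the logarithm of the coefficient. -/
structure IsInverseKernel (p : ℝ → ℂ) (m n : ℝ → ℝ → ℂ) : Prop where
  continuous_p : Continuous p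
  continuous_m : Continuous fun x : ℝ × ℝ => m x.1 x.2
  continuous_n : Continuous fun x : ℝ × ℝ => n x.1 x.2
  diag : ∀ r, m r r = -p r
  hasDerivAt_m : ∀ c s, HasDerivAt (fun s => m s c) (s * p s * n s c) s
  hasDerivAt_n : ∀ τ r : ℝ, HasDerivAt (fun r : ℝ => (r : ℂ) ^ 2 * n (τ ^ 2 * r) (τ * r))
    ((τ : ℂ) ^ 4 * r ^ 3 * p (τ ^ 2 * r) * m (τ ^ 2 * r) (τ * r)) r

theorem IsInverseKernel.neg {p : ℝ → ℂ} {m n : ℝ → ℝ → ℂ} (h : IsInverseKernel p m n) :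
    IsInverseKernel (fun r => -p r) (fun s c => -m s c) n where
  continuous_p := h.continuous_p.neg
  continuous_m := h.continuous_m.neg
  continuous_n := h.continuous_n
  diag r := by rw [h.diag]
  hasDerivAt_m c s := (h.hasDerivAt_m c s).fun_neg.congr_deriv (by ring)
  hasDerivAt_n τ r := (h.hasDerivAt_n τ r).congr_deriv (by ring)

theorem exists_bound_mul_of_hasCompactSupport {p : ℝ → ℂ} (hp : Continuous p)
    (hs : HasCompactSupport p) (k : ℕ) : ∃ C, ∀ y : ℝ, ‖(y : ℂ) ^ k * p y‖ ≤ C :=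
  (hs.mul_left (f := fun y : ℝ => (y : ℂ) ^ k)).exists_bound_of_continuous (by fun_prop)

theorem exists_isInverseKernel {p : ℝ → ℂ} (hp : Continuous p) (hs : HasCompactSupport p) :
    ∃ m n : ℝ → ℝ → ℂ, IsInverseKernel p m n := by
  obtain ⟨C₀, hC₀⟩ := exists_bound_mul_of_hasCompactSupport hp hs 0
  obtain ⟨C₃, hC₃⟩ := exists_bound_mul_of_hasCompactSupport hp hs 3
  simp only [pow_zero, one_mul] at hC₀
  obtain ⟨γ, hγ, he⟩ := exists_goursat_solution (γ₀ := fun a _ => -p a)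
    (κ := fun l y => (y : ℂ) ^ 3 * p y * ((l : ℂ) ^ 3 * p (l * y))) (by fun_prop) (by fun_prop)
    (B := C₀) (C := C₃ * (1 * C₀)) (fun a _ => by simpa using hC₀ a) (fun l hl y => by
      rw [norm_mul]
      refine mul_le_mul (hC₃ y) ?_ (norm_nonneg _) ((norm_nonneg _).trans (hC₃ y))
      rw [norm_mul]
      refine mul_le_mul ?_ (hC₀ _) (norm_nonneg _) zero_le_one
      rw [norm_pow, Complex.norm_real, Real.norm_of_nonneg hl.1]
      exact pow_le_one₀ hl.1 hl.2)
  have hcomp : ∀ {X : Type} [TopologicalSpace X] {a b : X → ℝ}, Continuous a → Continuous b →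
      Continuous fun x => γ (a x) (b x) := fun ha hb => hγ.comp (ha.prodMk hb)
  set I : ℝ → ℝ → ℂ := fun s c => ∫ l in (0 : ℝ)..1, (l : ℂ) ^ 3 * p (l * s) * γ (l * c) (l * s)
    with hI
  have hIc : Continuous fun x : ℝ × ℝ => I x.1 x.2 := by
    refine intervalIntegral.continuous_parametric_intervalIntegral_of_continuous'
      (f := fun (x : ℝ × ℝ) l => (l : ℂ) ^ 3 * p (l * x.1) * γ (l * x.2) (l * x.1)) ?_ 0 1
    exact (by fun_prop : Continuous fun x : (ℝ × ℝ) × ℝ => (x.2 : ℂ) ^ 3 * p (x.2 * x.1.1)).mul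
      (hcomp (by fun_prop) (by fun_prop))
  have he' : ∀ c s, γ c s = -p c + ∫ y in c..s, (y : ℂ) ^ 3 * p y * I y c := fun c s => by
    rw [he c s]
    congr 1
    refine intervalIntegral.integral_congr fun y _ => ?_
    simp only [hI]
    rw [← intervalIntegral.integral_const_mul]
    refine intervalIntegral.integral_congr fun l _ => ?_
    ring
  refine ⟨fun s c => γ c s, fun s c => (s : ℂ) ^ 2 * I s c, hp, hcomp continuous_snd continuous_fst,
    by fun_prop, fun r => ?_, fun c s => ?_, fun τ r => ?_⟩
  · rw [he' r r]
    simp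
  · have hc : Continuous fun y : ℝ => (y : ℂ) ^ 3 * p y * I y c :=
      (by fun_prop : Continuous fun y : ℝ => (y : ℂ) ^ 3 * p y).mul
        (hIc.comp (by fun_prop : Continuous fun y : ℝ => (y, c)))
    have h1 := ((hc.integral_hasStrictDerivAt c s).hasDerivAt).const_add (-p c)
    simp only [← he'] at h1
    exact h1.congr_deriv (by ring)
  · have hc : Continuous fun y : ℝ =>
        (τ : ℂ) ^ 4 * y ^ 3 * p (τ ^ 2 * y) * γ (τ * y) (τ ^ 2 * y) :=
      (by fun_prop : Continuous fun y : ℝ => (τ : ℂ) ^ 4 * y ^ 3 * p (τ ^ 2 * y)).mul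
        (hcomp (by fun_prop) (by fun_prop))
    have h1 := (hc.integral_hasStrictDerivAt 0 r).hasDerivAt
    refine h1.congr_of_eventuallyEq (Eventually.of_forall fun x => ?_)
    have h2 := intervalIntegral.smul_integral_comp_mul_right (a := 0) (b := 1)
      (fun y : ℝ => (τ : ℂ) ^ 4 * y ^ 3 * p (τ ^ 2 * y) * γ (τ * y) (τ ^ 2 * y)) x
    rw [zero_mul, one_mul] at h2
    simp only [hI]
    rw [← h2, Complex.real_smul, ← intervalIntegral.integral_const_mul,
      ← intervalIntegral.integral_const_mul, ← intervalIntegral.integral_const_mul]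
    refine intervalIntegral.integral_congr fun l _ => ?_
    have e1 : l * (τ ^ 2 * x) = τ ^ 2 * (l * x) := by ring
    have e2 : l * (τ * x) = τ * (l * x) := by ring
    simp only [e1, e2]
    push_cast
    ring

/-- The integral part of a ray operator. -/
noncomputable def rayIntegral (k : ℝ → ℝ → ℂ) (y : ℝ → ℂ) (r : ℝ) : ℂ :=
  ∫ τ in (0 : ℝ)..1, (r : ℂ) ^ 2 * τ * k (τ ^ 2 * r) (τ * r) * y (τ ^ 2 * r)

variable {k k' : ℝ → ℝ → ℂ} {y y₁ y₂ : ℝ → ℂ}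

theorem rayIntegral_eq {r : ℝ} (hr : r ≠ 0) :
    rayIntegral k y r = ∫ c in (0 : ℝ)..r, (c : ℂ) * k (c ^ 2 / r) c * y (c ^ 2 / r) := by
  have h := intervalIntegral.smul_integral_comp_mul_right (a := 0) (b := 1)
    (fun c : ℝ => (c : ℂ) * k (c ^ 2 / r) c * y (c ^ 2 / r)) r
  rw [zero_mul, one_mul] at h
  rw [← h, rayIntegral, Complex.real_smul, ← intervalIntegral.integral_const_mul]
  refine intervalIntegral.integral_congr fun τ _ => ?_
  have e : (τ * r) ^ 2 / r = τ ^ 2 * r := by field_simp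
  simp only [e]
  push_cast
  ring

theorem continuous_rayIntegrand (hk : Continuous fun x : ℝ × ℝ => k x.1 x.2) (hy : Continuous y)
    (r : ℝ) : Continuous fun τ : ℝ =>
      (r : ℂ) ^ 2 * τ * k (τ ^ 2 * r) (τ * r) * y (τ ^ 2 * r) := by
  have h1 : Continuous fun τ : ℝ => k (τ ^ 2 * r) (τ * r) :=
    hk.comp (by fun_prop : Continuous fun τ : ℝ => (τ ^ 2 * r, τ * r))
  fun_prop

theorem rayIntegral_add (hk : Continuous fun x : ℝ × ℝ => k x.1 x.2) (h₁ : Continuous y₁)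
    (h₂ : Continuous y₂) (r : ℝ) :
    rayIntegral k (fun s => y₁ s + y₂ s) r = rayIntegral k y₁ r + rayIntegral k y₂ r := by
  simp only [rayIntegral]
  rw [← intervalIntegral.integral_add
    ((continuous_rayIntegrand hk h₁ r).intervalIntegrable _ _)
    ((continuous_rayIntegrand hk h₂ r).intervalIntegrable _ _)]
  exact intervalIntegral.integral_congr fun τ _ => by ring

theorem rayIntegral_neg (r : ℝ) :
    rayIntegral k (fun s => -y s) r = -rayIntegral k y r := by
  simp only [rayIntegral]
  rw [← intervalIntegral.integral_neg]
  exact intervalIntegral.integral_congr fun τ _ => by ring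

theorem rayIntegral_kernel_add (hk : Continuous fun x : ℝ × ℝ => k x.1 x.2)
    (hk' : Continuous fun x : ℝ × ℝ => k' x.1 x.2) (hy : Continuous y) (r : ℝ) :
    rayIntegral (fun s c => k s c + k' s c) y r = rayIntegral k y r + rayIntegral k' y r := by
  simp only [rayIntegral]
  rw [← intervalIntegral.integral_add
    ((continuous_rayIntegrand hk hy r).intervalIntegrable _ _)
    ((continuous_rayIntegrand hk' hy r).intervalIntegrable _ _)]
  exact intervalIntegral.integral_congr fun τ _ => by ring

theorem rayIntegral_kernel_neg (r : ℝ) :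
    rayIntegral (fun s c => -k s c) y r = -rayIntegral k y r := by
  simp only [rayIntegral]
  rw [← intervalIntegral.integral_neg]
  exact intervalIntegral.integral_congr fun τ _ => by ring

namespace IsInverseKernel

variable {p : ℝ → ℂ} {m n : ℝ → ℝ → ℂ} {y' : ℝ → ℂ}

theorem hasDerivAt_rayIntegral_m (h : IsInverseKernel p m n)
    (hy : ∀ s, HasDerivAt y (y' s) s) (hy' : Continuous y') {r : ℝ} (hr : 0 < r) :
    HasDerivAt (rayIntegral m y) ((-((r : ℂ) ^ 2 * p r * y r)
      - rayIntegral n (fun s => (s : ℂ) ^ 2 * p s * y s) r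
      - rayIntegral m (fun s => s * y' s) r) / r) r := by
  have hyc : Continuous y := continuous_iff_continuousAt.2 fun s => (hy s).continuousAt
  have hm := h.continuous_m
  have hn := h.continuous_n
  have hp := h.continuous_p
  have hr0 : (r : ℂ) ≠ 0 := by exact_mod_cast hr.ne'
  have hσ : ContinuousOn (fun x : ℝ × ℝ => x.2 ^ 2 / x.1) (Ioi 0 ×ˢ univ) :=
    (by fun_prop : Continuous fun x : ℝ × ℝ => x.2 ^ 2).continuousOn.div continuousOn_fst
      fun x hx => (ne_of_gt hx.1)
  have hmσ : ContinuousOn (fun x : ℝ × ℝ => m (x.2 ^ 2 / x.1) x.2) (Ioi 0 ×ˢ univ) :=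
    hm.comp_continuousOn (hσ.prodMk continuousOn_snd)
  have hnσ : ContinuousOn (fun x : ℝ × ℝ => n (x.2 ^ 2 / x.1) x.2) (Ioi 0 ×ˢ univ) :=
    hn.comp_continuousOn (hσ.prodMk continuousOn_snd)
  have hpσ : ContinuousOn (fun x : ℝ × ℝ => p (x.2 ^ 2 / x.1)) (Ioi 0 ×ˢ univ) :=
    hp.comp_continuousOn hσ
  have hyσ : ContinuousOn (fun x : ℝ × ℝ => y (x.2 ^ 2 / x.1)) (Ioi 0 ×ˢ univ) :=
    hyc.comp_continuousOn hσ
  have hyσ' : ContinuousOn (fun x : ℝ × ℝ => y' (x.2 ^ 2 / x.1)) (Ioi 0 ×ˢ univ) :=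
    hy'.comp_continuousOn hσ
  have hcσ : ContinuousOn (fun x : ℝ × ℝ => ((x.2 ^ 2 / x.1 : ℝ) : ℂ)) (Ioi 0 ×ˢ univ) :=
    Complex.continuous_ofReal.comp_continuousOn hσ
  have hc1 : ContinuousOn (fun x : ℝ × ℝ => (x.2 : ℂ)) (Ioi 0 ×ˢ univ) := by fun_prop
  have hc2 : ContinuousOn (fun x : ℝ × ℝ => ((-(x.2 ^ 2 / x.1 ^ 2) : ℝ) : ℂ)) (Ioi 0 ×ˢ univ) := by
    refine Complex.continuous_ofReal.comp_continuousOn (ContinuousOn.neg ?_)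
    exact (by fun_prop : Continuous fun x : ℝ × ℝ => x.2 ^ 2).continuousOn.div
      (by fun_prop) fun x hx => pow_ne_zero 2 (ne_of_gt hx.1)
  have key := hasDerivAt_integral_param_end (I := Ioi 0)
    (H := fun ρ t : ℝ => (t : ℂ) * m (t ^ 2 / ρ) t * y (t ^ 2 / ρ))
    (H' := fun ρ t : ℝ => (t : ℂ) * ((((t ^ 2 / ρ : ℝ) : ℂ) * p (t ^ 2 / ρ) * n (t ^ 2 / ρ) t)
      * y (t ^ 2 / ρ) + m (t ^ 2 / ρ) t * y' (t ^ 2 / ρ)) * ((-(t ^ 2 / ρ ^ 2) : ℝ) : ℂ))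
    isOpen_Ioi 0 ((hc1.mul hmσ).mul hyσ)
    ((hc1.mul ((((hcσ.mul hpσ).mul hnσ).mul hyσ).add (hmσ.mul hyσ'))).mul hc2)
    (fun ρ hρ t => by
      have hρ0 : ρ ≠ 0 := ne_of_gt hρ
      have hs : HasDerivAt (fun ρ : ℝ => t ^ 2 / ρ) (-(t ^ 2 / ρ ^ 2)) ρ := by
        have := (hasDerivAt_inv hρ0).const_mul (t ^ 2)
        simp only [← div_eq_mul_inv] at this
        exact this.congr_deriv (by field_simp)
      have h1 := (h.hasDerivAt_m t (t ^ 2 / ρ)).scomp ρ hs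
      have h2 := (hy (t ^ 2 / ρ)).scomp ρ hs
      have h3 := (h1.mul h2).const_mul (t : ℂ)
      refine (h3.congr_deriv ?_).congr_of_eventuallyEq (Eventually.of_forall fun x => ?_)
      · simp only [Complex.real_smul, Function.comp]
        ring
      · simp only [Function.comp, Pi.mul_apply]
        ring) (r := r) hr
  have hev : rayIntegral m y =ᶠ[𝓝 r] fun ρ => ∫ t in (0 : ℝ)..ρ,
      (t : ℂ) * m (t ^ 2 / ρ) t * y (t ^ 2 / ρ) := by
    filter_upwards [isOpen_Ioi.mem_nhds hr] with ρ hρ using rayIntegral_eq (ne_of_gt hρ)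
  refine (key.congr_of_eventuallyEq hev).congr_deriv ?_
  have hslice : ∀ {u : ℝ × ℝ → ℂ}, ContinuousOn u (Ioi 0 ×ˢ univ) →
      Continuous fun t : ℝ => u (r, t) := fun hu =>
    hu.comp_continuous (f := fun t : ℝ => (r, t)) (by fun_prop) fun t => ⟨hr, mem_univ _⟩
  have hsum : ∫ t in (0 : ℝ)..r, (t : ℂ) * ((((t ^ 2 / r : ℝ) : ℂ) * p (t ^ 2 / r)
        * n (t ^ 2 / r) t) * y (t ^ 2 / r) + m (t ^ 2 / r) t * y' (t ^ 2 / r))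
        * ((-(t ^ 2 / r ^ 2) : ℝ) : ℂ) =
      (-1 / r : ℂ) * (rayIntegral n (fun s => (s : ℂ) ^ 2 * p s * y s) r
        + rayIntegral m (fun s => s * y' s) r) := by
    rw [rayIntegral_eq hr.ne', rayIntegral_eq hr.ne', ← intervalIntegral.integral_add,
      ← intervalIntegral.integral_const_mul]
    · refine intervalIntegral.integral_congr fun t _ => ?_
      push_cast
      field_simp
    · refine Continuous.intervalIntegrable ?_ _ _
      exact hslice ((hc1.mul hnσ).mul (((hcσ.pow 2).mul hpσ).mul hyσ))
    · refine Continuous.intervalIntegrable ?_ _ _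
      exact hslice ((hc1.mul hmσ).mul (hcσ.mul hyσ'))
  rw [hsum]
  have e : r ^ 2 / r = r := by field_simp
  rw [e, h.diag]
  field_simp
  ring

theorem hasDerivAt_rayIntegral_n (h : IsInverseKernel p m n)
    (hy : ∀ s, HasDerivAt y (y' s) s) (hy' : Continuous y') {r : ℝ} (hr : 0 < r) :
    HasDerivAt (rayIntegral n y) ((rayIntegral m (fun s => (s : ℂ) ^ 2 * p s * y s) r
      + rayIntegral n (fun s => s * y' s) r) / r) r := by
  have hyc : Continuous y := continuous_iff_continuousAt.2 fun s => (hy s).continuousAt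
  have hp := h.continuous_p
  have hr0 : (r : ℂ) ≠ 0 := by exact_mod_cast hr.ne'
  have hmc : Continuous fun x : ℝ × ℝ => m (x.2 ^ 2 * x.1) (x.2 * x.1) :=
    h.continuous_m.comp (by fun_prop : Continuous fun x : ℝ × ℝ => (x.2 ^ 2 * x.1, x.2 * x.1))
  have hnc : Continuous fun x : ℝ × ℝ => n (x.2 ^ 2 * x.1) (x.2 * x.1) :=
    h.continuous_n.comp (by fun_prop : Continuous fun x : ℝ × ℝ => (x.2 ^ 2 * x.1, x.2 * x.1))
  have hyr : Continuous fun x : ℝ × ℝ => y (x.2 ^ 2 * x.1) := by fun_prop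
  have key := hasDerivAt_intervalIntegral_param (I := univ) (a := 0) (b := 1)
    (H := fun ρ τ : ℝ => (ρ : ℂ) ^ 2 * τ * n (τ ^ 2 * ρ) (τ * ρ) * y (τ ^ 2 * ρ))
    (H' := fun ρ τ : ℝ => (τ : ℂ) * (((τ : ℂ) ^ 4 * ρ ^ 3 * p (τ ^ 2 * ρ) *
      m (τ ^ 2 * ρ) (τ * ρ)) * y (τ ^ 2 * ρ) + (ρ : ℂ) ^ 2 * n (τ ^ 2 * ρ) (τ * ρ) *
        ((τ : ℂ) ^ 2 * y' (τ ^ 2 * ρ))))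
    isOpen_univ
    (((by fun_prop : Continuous fun x : ℝ × ℝ => (x.1 : ℂ) ^ 2 * x.2).mul hnc).mul hyr).continuousOn
    ((by fun_prop : Continuous fun x : ℝ × ℝ => (x.2 : ℂ)).mul
      ((((by fun_prop : Continuous fun x : ℝ × ℝ => (x.2 : ℂ) ^ 4 * x.1 ^ 3 * p (x.2 ^ 2 * x.1)).mul
        hmc).mul hyr).add (((by fun_prop : Continuous fun x : ℝ × ℝ => (x.1 : ℂ) ^ 2).mul hnc).mul
          (by fun_prop : Continuous fun x : ℝ × ℝ =>
            (x.2 : ℂ) ^ 2 * y' (x.2 ^ 2 * x.1))))).continuousOn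
    (fun ρ _ τ _ => by
      have hs : HasDerivAt (fun ρ : ℝ => τ ^ 2 * ρ) (τ ^ 2) ρ := by
        simpa using (hasDerivAt_id ρ).const_mul (τ ^ 2)
      have h2 := (hy (τ ^ 2 * ρ)).scomp ρ hs
      have h3 := ((h.hasDerivAt_n τ ρ).mul h2).const_mul (τ : ℂ)
      refine (h3.congr_deriv ?_).congr_of_eventuallyEq (Eventually.of_forall fun x => ?_)
      · simp only [Complex.real_smul, Function.comp]
        push_cast
        ring
      · simp only [Function.comp, Pi.mul_apply]
        ring) (mem_univ r)
  refine HasDerivAt.congr_deriv (f' := _) key ?_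
  rw [eq_div_iff hr0, mul_comm]
  simp only [rayIntegral]
  rw [← intervalIntegral.integral_add, ← intervalIntegral.integral_const_mul]
  · refine intervalIntegral.integral_congr fun τ _ => ?_
    push_cast
    ring
  · exact (continuous_rayIntegrand h.continuous_m
      (by fun_prop : Continuous fun s : ℝ => (s : ℂ) ^ 2 * p s * y s) r).intervalIntegrable _ _
  · exact (continuous_rayIntegrand h.continuous_n
      (by fun_prop : Continuous fun s : ℝ => (s : ℂ) * y' s) r).intervalIntegrable _ _

/-- The intertwining relation along a ray. -/
theorem hasDerivAt_add_rayIntegral (h : IsInverseKernel p m n)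
    (hy : ∀ s, HasDerivAt y (y' s) s) (hy' : Continuous y') {r : ℝ} (hr : 0 < r) :
    HasDerivAt (fun ρ => y ρ + rayIntegral (fun s c => n s c + m s c) y ρ)
      (((r * y' r - (r : ℂ) ^ 2 * p r * y r) + rayIntegral (fun s c => n s c + -m s c)
        (fun s => s * y' s - (s : ℂ) ^ 2 * p s * y s) r) / r) r := by
  have hyc : Continuous y := continuous_iff_continuousAt.2 fun s => (hy s).continuousAt
  have hp := h.continuous_p
  have hm := h.continuous_m
  have hn := h.continuous_n
  have hr0 : (r : ℂ) ≠ 0 := by exact_mod_cast hr.ne'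
  have key := (hy r).add ((h.hasDerivAt_rayIntegral_n hy hy' hr).add
    (h.hasDerivAt_rayIntegral_m hy hy' hr))
  refine (key.congr_deriv ?_).congr_of_eventuallyEq (Eventually.of_forall fun x => ?_)
  · have h1 : Continuous fun s : ℝ => (s : ℂ) * y' s := by fun_prop
    have h2 : Continuous fun s : ℝ => (s : ℂ) ^ 2 * p s * y s := by fun_prop
    have h3 : Continuous fun s : ℝ => -((s : ℂ) ^ 2 * p s * y s) := h2.neg
    simp only [sub_eq_add_neg]
    have hm' : Continuous fun x : ℝ × ℝ => -m x.1 x.2 := hm.neg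
    have h4 : Continuous fun s : ℝ => (s : ℂ) * y' s + -((s : ℂ) ^ 2 * p s * y s) := h1.add h3
    rw [rayIntegral_kernel_add (k' := fun s c => -m s c) hn hm' h4, rayIntegral_kernel_neg,
      rayIntegral_add hn h1 h3, rayIntegral_add hm h1 h3, rayIntegral_neg, rayIntegral_neg]
    field_simp
    ring
  · change y x + rayIntegral (fun s c => n s c + m s c) y x = _
    rw [rayIntegral_kernel_add hn hm hyc]
    rfl

end IsInverseKernel

end InverseKernel

end RadialVekua

namespace RadialVekua

section RayOperator

/-- The ray operator with kernel `k`. -/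
noncomputable def rayOp (k : ℝ → ℝ → ℂ) (U : ℂ → ℂ) (z : ℂ) : ℂ :=
  U z + ∫ τ in (0 : ℝ)..1,
    (‖z‖ : ℂ) ^ 2 * τ * k (τ ^ 2 * ‖z‖) (τ * ‖z‖) * U (((τ ^ 2 : ℝ) : ℂ) * z)

variable {k : ℝ → ℝ → ℂ} {U V u v : ℂ → ℂ} {Ω : Set ℂ}

theorem real_mul_mem_of_starConvex (hΩ : StarConvex ℝ (0 : ℂ) Ω) {z : ℂ} (hz : z ∈ Ω) {t : ℝ}
    (ht : t ∈ Icc (0 : ℝ) 1) : (t : ℂ) * z ∈ Ω := by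
  simpa [Complex.real_smul] using hΩ.smul_mem hz ht.1 ht.2

theorem sq_mem_Icc {τ : ℝ} (hτ : τ ∈ Icc (0 : ℝ) 1) : τ ^ 2 ∈ Icc (0 : ℝ) 1 :=
  ⟨sq_nonneg τ, pow_le_one₀ hτ.1 hτ.2⟩

theorem rayOp_congr {z : ℂ} (h : ∀ t ∈ Icc (0 : ℝ) 1, U ((t : ℂ) * z) = V ((t : ℂ) * z)) :
    rayOp k U z = rayOp k V z := by
  have h1 := h 1 (by simp)
  rw [Complex.ofReal_one, one_mul] at h1
  rw [rayOp, rayOp, h1]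
  congr 1
  refine intervalIntegral.integral_congr fun τ hτ => ?_
  rw [uIcc_of_le zero_le_one] at hτ
  simp only [h (τ ^ 2) (sq_mem_Icc hτ)]

theorem rayOp_const_mul (c : ℂ) (z : ℂ) : rayOp k (fun w => c * U w) z = c * rayOp k U z := by
  simp only [rayOp]
  rw [mul_add, ← intervalIntegral.integral_const_mul]
  congr 1
  exact intervalIntegral.integral_congr fun τ _ => by ring

theorem continuousOn_rayIntegrand (hk : Continuous fun x : ℝ × ℝ => k x.1 x.2)
    (hΩ : StarConvex ℝ (0 : ℂ) Ω) (hu : ContinuousOn u Ω) :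
    ContinuousOn (fun x : ℂ × ℝ => (‖x.1‖ : ℂ) ^ 2 * x.2 * k (x.2 ^ 2 * ‖x.1‖) (x.2 * ‖x.1‖)
      * u (((x.2 ^ 2 : ℝ) : ℂ) * x.1)) (Ω ×ˢ uIcc (0 : ℝ) 1) := by
  have h1 : Continuous fun x : ℂ × ℝ => k (x.2 ^ 2 * ‖x.1‖) (x.2 * ‖x.1‖) :=
    hk.comp (by fun_prop : Continuous fun x : ℂ × ℝ => (x.2 ^ 2 * ‖x.1‖, x.2 * ‖x.1‖))
  refine (((by fun_prop : Continuous fun x : ℂ × ℝ => (‖x.1‖ : ℂ) ^ 2 * x.2).mul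
    h1).continuousOn).mul ?_
  refine hu.comp (f := fun x : ℂ × ℝ => ((x.2 ^ 2 : ℝ) : ℂ) * x.1)
    (by fun_prop : Continuous fun x : ℂ × ℝ => ((x.2 ^ 2 : ℝ) : ℂ) * x.1).continuousOn ?_
  rintro ⟨z, τ⟩ ⟨hz, hτ⟩
  rw [uIcc_of_le zero_le_one] at hτ
  exact real_mul_mem_of_starConvex hΩ hz (sq_mem_Icc hτ)

theorem continuousOn_rayOp (hk : Continuous fun x : ℝ × ℝ => k x.1 x.2)
    (hΩ : StarConvex ℝ (0 : ℂ) Ω) (hu : ContinuousOn u Ω) : ContinuousOn (rayOp k u) Ω :=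
  hu.add (continuousOn_intervalIntegral_param
    (H := fun (z : ℂ) (τ : ℝ) => (‖z‖ : ℂ) ^ 2 * τ * k (τ ^ 2 * ‖z‖) (τ * ‖z‖)
      * u (((τ ^ 2 : ℝ) : ℂ) * z)) (continuousOn_rayIntegrand hk hΩ hu))

theorem continuous_rayOp (hk : Continuous fun x : ℝ × ℝ => k x.1 x.2) (hU : Continuous U) :
    Continuous (rayOp k U) :=
  continuousOn_univ.1 (continuousOn_rayOp hk (starConvex_univ 0) hU.continuousOn)

theorem rayOp_add (hk : Continuous fun x : ℝ × ℝ => k x.1 x.2)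
    (hΩ : StarConvex ℝ (0 : ℂ) Ω) (hu : ContinuousOn u Ω) (hv : ContinuousOn v Ω) {z : ℂ}
    (hz : z ∈ Ω) : rayOp k (fun w => u w + v w) z = rayOp k u z + rayOp k v z := by
  have hint : ∀ {u : ℂ → ℂ}, ContinuousOn u Ω → IntervalIntegrable (fun τ : ℝ =>
      (‖z‖ : ℂ) ^ 2 * τ * k (τ ^ 2 * ‖z‖) (τ * ‖z‖) * u (((τ ^ 2 : ℝ) : ℂ) * z))
      MeasureTheory.volume 0 1 := fun hu => by
    refine ContinuousOn.intervalIntegrable ?_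
    exact (continuousOn_rayIntegrand hk hΩ hu).comp (f := fun τ : ℝ => (z, τ))
      (by fun_prop) fun τ hτ => ⟨hz, hτ⟩
  have h : ∫ τ in (0 : ℝ)..1, (‖z‖ : ℂ) ^ 2 * τ * k (τ ^ 2 * ‖z‖) (τ * ‖z‖) *
      (u (((τ ^ 2 : ℝ) : ℂ) * z) + v (((τ ^ 2 : ℝ) : ℂ) * z)) =
      (∫ τ in (0 : ℝ)..1, (‖z‖ : ℂ) ^ 2 * τ * k (τ ^ 2 * ‖z‖) (τ * ‖z‖) *
        u (((τ ^ 2 : ℝ) : ℂ) * z)) + ∫ τ in (0 : ℝ)..1, (‖z‖ : ℂ) ^ 2 * τ *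
          k (τ ^ 2 * ‖z‖) (τ * ‖z‖) * v (((τ ^ 2 : ℝ) : ℂ) * z) := by
    rw [← intervalIntegral.integral_add (hint hu) (hint hv)]
    exact intervalIntegral.integral_congr fun τ _ => by ring
  rw [rayOp, h, rayOp, rayOp]
  ring

theorem rayOp_mul_unit {e : ℂ} (he : ‖e‖ = 1) {y : ℝ → ℂ}
    (hy : ∀ s : ℝ, 0 ≤ s → U ((s : ℂ) * e) = y s) {r : ℝ} (hr : 0 ≤ r) :
    rayOp k U ((r : ℂ) * e) = y r + rayIntegral k y r := by
  have hn : ‖(r : ℂ) * e‖ = r := by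
    rw [norm_mul, he, mul_one, Complex.norm_real, Real.norm_of_nonneg hr]
  rw [rayOp, rayIntegral, hn, hy r hr]
  congr 1
  refine intervalIntegral.integral_congr fun τ _ => ?_
  have h := hy (τ ^ 2 * r) (by positivity)
  rw [Complex.ofReal_mul, mul_assoc] at h
  simp only [h]

namespace IsInverseKernel

variable {p : ℝ → ℂ} {m n : ℝ → ℝ → ℂ}

/-- The radial part of the intertwining property. -/
theorem hasDerivAt_rayOp_exp (h : IsInverseKernel p m n) (hU : ContDiff ℝ 1 U) {z : ℂ}
    (hz : z ≠ 0) (ρ : ℝ) :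
    HasDerivAt (fun ρ : ℝ => rayOp (fun s c => n s c + m s c) U ((Real.exp ρ : ℂ) * z))
      (rayOp (fun s c => n s c + -m s c)
        (fun w => fderiv ℝ U w w - (‖w‖ : ℂ) ^ 2 * p ‖w‖ * U w) ((Real.exp ρ : ℂ) * z)) ρ := by
  have hzn : 0 < ‖z‖ := norm_pos_iff.2 hz
  have hzn' : (‖z‖ : ℂ) ≠ 0 := by exact_mod_cast hzn.ne'
  set e : ℂ := z / ‖z‖ with he
  have he1 : ‖e‖ = 1 := by
    rw [he, norm_div, Complex.norm_real, norm_norm, div_self hzn.ne']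
  have hray : ∀ ρ : ℝ, (Real.exp ρ : ℂ) * z = ((Real.exp ρ * ‖z‖ : ℝ) : ℂ) * e := fun ρ => by
    rw [he]
    push_cast
    field_simp
  set y : ℝ → ℂ := fun s => U ((s : ℂ) * e) with hy
  set y' : ℝ → ℂ := fun s => fderiv ℝ U ((s : ℂ) * e) e with hy'
  have hline : ∀ s : ℝ, HasDerivAt (fun s : ℝ => (s : ℂ) * e) e s := fun s => by
    have := (Complex.ofRealCLM.hasDerivAt (x := s)).mul_const e
    simpa using this
  have hyd : ∀ s, HasDerivAt y (y' s) s := fun s =>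
    ((hU.differentiable (by norm_num)).differentiableAt.hasFDerivAt
      (x := (s : ℂ) * e)).comp_hasDerivAt s (hline s)
  have hyc' : Continuous y' :=
    ((hU.continuous_fderiv (by norm_num)).comp
      (by fun_prop : Continuous fun s : ℝ => (s : ℂ) * e)).clm_apply continuous_const
  set r : ℝ := Real.exp ρ * ‖z‖ with hr
  have hr0 : 0 < r := by positivity
  have hr0' : (r : ℂ) ≠ 0 := by exact_mod_cast hr0.ne'
  have h1 := h.hasDerivAt_add_rayIntegral hyd hyc' hr0
  have h2 := HasDerivAt.scomp (h := fun ρ : ℝ => Real.exp ρ * ‖z‖) ρ h1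
    ((Real.hasDerivAt_exp ρ).mul_const ‖z‖)
  refine (h2.congr_deriv ?_).congr_of_eventuallyEq (Eventually.of_forall fun x => ?_)
  · rw [hray, ← hr, rayOp_mul_unit he1
      (y := fun s : ℝ => s * y' s - (s : ℂ) ^ 2 * p s * y s) (fun s hs => ?_) hr0.le,
      Complex.real_smul]
    · field_simp
    · have hn : ‖(s : ℂ) * e‖ = s := by
        rw [norm_mul, he1, mul_one, Complex.norm_real, Real.norm_of_nonneg hs]
      have hl : fderiv ℝ U ((s : ℂ) * e) ((s : ℂ) * e) = s * y' s := by
        have := (fderiv ℝ U ((s : ℂ) * e)).map_smul s e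
        simpa only [Complex.real_smul] using this
      rw [hn, hl]
  · simp only [Function.comp]
    rw [hray, rayOp_mul_unit he1 (y := y) (fun s _ => rfl) (by positivity)]

end IsInverseKernel

/-- Ray operators commute with rotations. -/
theorem hasDerivAt_rayOp_rotation (hk : Continuous fun x : ℝ × ℝ => k x.1 x.2)
    (hU : ContDiff ℝ 1 U) (z : ℂ) (θ : ℝ) :
    HasDerivAt (fun θ : ℝ => rayOp k U (Complex.exp (θ * Complex.I) * z))
      (rayOp k (fun w => fderiv ℝ U w (Complex.I * w)) (Complex.exp (θ * Complex.I) * z)) θ := by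
  have hn : ∀ θ : ℝ, ‖Complex.exp (θ * Complex.I) * z‖ = ‖z‖ := fun θ => by
    rw [norm_mul, Complex.norm_exp_ofReal_mul_I, one_mul]
  have hcurve : ∀ (a : ℂ) (θ : ℝ), HasDerivAt (fun θ : ℝ => a * (Complex.exp (θ * Complex.I) * z))
      (Complex.I * (a * (Complex.exp (θ * Complex.I) * z))) θ := fun a θ => by
    have h1 : HasDerivAt (fun θ : ℝ => (θ : ℂ) * Complex.I) Complex.I θ := by
      simpa using (Complex.ofRealCLM.hasDerivAt (x := θ)).mul_const Complex.I
    exact ((h1.cexp.mul_const z).const_mul a).congr_deriv (by ring)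
  have hUd : ∀ (a : ℂ) (θ : ℝ), HasDerivAt (fun θ : ℝ => U (a * (Complex.exp (θ * Complex.I) * z)))
      (fderiv ℝ U (a * (Complex.exp (θ * Complex.I) * z))
        (Complex.I * (a * (Complex.exp (θ * Complex.I) * z)))) θ := fun a θ =>
    ((hU.differentiable (by norm_num)).differentiableAt.hasFDerivAt
      (x := a * (Complex.exp (θ * Complex.I) * z))).comp_hasDerivAt θ (hcurve a θ)
  have hcurvec : Continuous fun x : ℝ × ℝ =>
      ((x.2 ^ 2 : ℝ) : ℂ) * (Complex.exp (x.1 * Complex.I) * z) := by fun_prop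
  have hkc : Continuous fun x : ℝ × ℝ =>
      (‖z‖ : ℂ) ^ 2 * x.2 * k (x.2 ^ 2 * ‖z‖) (x.2 * ‖z‖) :=
    (by fun_prop : Continuous fun x : ℝ × ℝ => (‖z‖ : ℂ) ^ 2 * x.2).mul
      (hk.comp (by fun_prop : Continuous fun x : ℝ × ℝ => (x.2 ^ 2 * ‖z‖, x.2 * ‖z‖)))
  have hfd : Continuous fun w : ℂ => fderiv ℝ U w (Complex.I * w) :=
    (hU.continuous_fderiv (by norm_num)).clm_apply (by fun_prop)
  have key := hasDerivAt_intervalIntegral_param (I := univ) (a := 0) (b := 1)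
    (H := fun θ τ : ℝ => (‖z‖ : ℂ) ^ 2 * τ * k (τ ^ 2 * ‖z‖) (τ * ‖z‖)
      * U (((τ ^ 2 : ℝ) : ℂ) * (Complex.exp (θ * Complex.I) * z)))
    (H' := fun θ τ : ℝ => (‖z‖ : ℂ) ^ 2 * τ * k (τ ^ 2 * ‖z‖) (τ * ‖z‖)
      * fderiv ℝ U (((τ ^ 2 : ℝ) : ℂ) * (Complex.exp (θ * Complex.I) * z))
        (Complex.I * (((τ ^ 2 : ℝ) : ℂ) * (Complex.exp (θ * Complex.I) * z))))
    isOpen_univ (hkc.mul (hU.continuous.comp hcurvec)).continuousOn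
    (hkc.mul (hfd.comp hcurvec)).continuousOn
    (fun θ _ τ _ => (hUd _ θ).const_mul _) (mem_univ θ)
  have h0 := hUd 1 θ
  simp only [one_mul] at h0
  simp only [rayOp, hn]
  exact h0.add key

theorem exists_contDiff_eqOn (hΩ : IsOpen Ω) (hu : ContDiffOn ℝ 1 u Ω) {S : Set ℂ}
    (hS : IsClosed S) (hSΩ : S ⊆ Ω) :
    ∃ U : ℂ → ℂ, ContDiff ℝ 1 U ∧ ∀ z ∈ S, U =ᶠ[𝓝 z] u := by
  obtain ⟨χ, h0, h1, -⟩ := exists_contMDiffMap_zero_one_nhds_of_isClosed (n := 1)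
    (modelWithCornersSelf ℝ ℂ) hΩ.isClosed_compl hS (disjoint_compl_left_iff_subset.2 hSΩ)
  have hχ : ContDiff ℝ 1 χ := χ.contMDiff.contDiff
  refine ⟨fun z => (χ z : ℂ) * u z, contDiff_iff_contDiffAt.2 fun z => ?_, fun z hz => ?_⟩
  · by_cases hz : z ∈ Ω
    · exact (Complex.ofRealCLM.contDiff.comp hχ).contDiffAt.mul (hu.contDiffAt (hΩ.mem_nhds hz))
    · refine (contDiffAt_const (c := (0 : ℂ))).congr_of_eventuallyEq ?_
      filter_upwards [h0.filter_mono (nhds_le_nhdsSet (s := Ωᶜ) hz)] with w hw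
      rw [hw, Complex.ofReal_zero, zero_mul]
  · filter_upwards [h1.filter_mono (nhds_le_nhdsSet hz)] with w hw
    rw [hw, Complex.ofReal_one, one_mul]

/-- A `C¹` function on a star-shaped domain agrees near the rays of nearby points with a globally
defined one. -/
theorem exists_contDiff_eq_near_ray (hΩ : IsOpen Ω) (hstar : StarConvex ℝ (0 : ℂ) Ω)
    (hu : ContDiffOn ℝ 1 u Ω) {z : ℂ} (hz : z ∈ Ω) :
    ∃ U : ℂ → ℂ, ContDiff ℝ 1 U ∧
      ∀ᶠ w in 𝓝 z, ∀ t ∈ Icc (0 : ℝ) 1, U =ᶠ[𝓝 ((t : ℂ) * w)] u := by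
  obtain ⟨ε, hε, hball⟩ := Metric.nhds_basis_closedBall.mem_iff.1 (hΩ.mem_nhds hz)
  set S : Set ℂ := (fun x : ℝ × ℂ => (x.1 : ℂ) * x.2) '' (Icc (0 : ℝ) 1 ×ˢ Metric.closedBall z ε)
  have hS : IsCompact S := (isCompact_Icc.prod (isCompact_closedBall z ε)).image (by fun_prop)
  obtain ⟨U, hU, he⟩ := exists_contDiff_eqOn hΩ hu hS.isClosed (S := S) (by
    rintro _ ⟨⟨t, w⟩, ⟨ht, hw⟩, rfl⟩
    exact real_mul_mem_of_starConvex hstar (hball hw) ht)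
  refine ⟨U, hU, ?_⟩
  filter_upwards [Metric.closedBall_mem_nhds z hε] with w hw t ht
  exact he _ ⟨(t, w), ⟨ht, hw⟩, rfl⟩

end RayOperator

end RadialVekua

namespace RadialVekua

section Holomorphic

variable {p : ℝ → ℂ} {m n : ℝ → ℝ → ℂ} {Ω : Set ℂ} {u v U V : ℂ → ℂ}

/-- The radial Vekua system in polar form. -/
structure IsPolarSolution (Ω : Set ℂ) (p : ℝ → ℂ) (u v : ℂ → ℂ) : Prop where
  contDiffOn_left : ContDiffOn ℝ 1 u Ω
  contDiffOn_right : ContDiffOn ℝ 1 v Ω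
  left : ∀ z ∈ Ω, fderiv ℝ u z z - (‖z‖ : ℂ) ^ 2 * p ‖z‖ * u z = fderiv ℝ v z (Complex.I * z)
  right : ∀ z ∈ Ω, fderiv ℝ v z z + (‖z‖ : ℂ) ^ 2 * p ‖z‖ * v z = -fderiv ℝ u z (Complex.I * z)

namespace IsInverseKernel

theorem continuous_add (h : IsInverseKernel p m n) :
    Continuous fun x : ℝ × ℝ => n x.1 x.2 + m x.1 x.2 :=
  h.continuous_n.add h.continuous_m

theorem continuous_sub (h : IsInverseKernel p m n) :
    Continuous fun x : ℝ × ℝ => n x.1 x.2 + -m x.1 x.2 :=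
  h.continuous_n.add h.continuous_m.neg

theorem hasDerivAt_rayOp_exp' (h : IsInverseKernel p m n) (hV : ContDiff ℝ 1 V) {z : ℂ}
    (hz : z ≠ 0) (ρ : ℝ) :
    HasDerivAt (fun ρ : ℝ => rayOp (fun s c => n s c + -m s c) V ((Real.exp ρ : ℂ) * z))
      (rayOp (fun s c => n s c + m s c)
        (fun w => fderiv ℝ V w w + (‖w‖ : ℂ) ^ 2 * p ‖w‖ * V w) ((Real.exp ρ : ℂ) * z)) ρ := by
  have := h.neg.hasDerivAt_rayOp_exp hV hz ρ
  simpa only [neg_neg, mul_neg, neg_mul, sub_neg_eq_add] using this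

theorem differentiableAt_of_polar (h : IsInverseKernel p m n) (hU : ContDiff ℝ 1 U)
    (hV : ContDiff ℝ 1 V) {z : ℂ} (hz : z ≠ 0)
    (h₁ : ∀ t ∈ Icc (0 : ℝ) 1, ∀ w : ℂ, w = t * z →
      fderiv ℝ U w w - (‖w‖ : ℂ) ^ 2 * p ‖w‖ * U w = fderiv ℝ V w (Complex.I * w))
    (h₂ : ∀ t ∈ Icc (0 : ℝ) 1, ∀ w : ℂ, w = t * z →
      fderiv ℝ V w w + (‖w‖ : ℂ) ^ 2 * p ‖w‖ * V w = -fderiv ℝ U w (Complex.I * w)) :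
    DifferentiableAt ℂ (fun z => rayOp (fun s c => n s c + m s c) U z
      + Complex.I * rayOp (fun s c => n s c + -m s c) V z) z := by
  have hP := h.continuous_add
  have hQ := h.continuous_sub
  have hp := h.continuous_p
  set P : ℝ → ℝ → ℂ := fun s c => n s c + m s c
  set Q : ℝ → ℝ → ℂ := fun s c => n s c + -m s c
  set uE : ℂ → ℂ := fun w => fderiv ℝ U w w - (‖w‖ : ℂ) ^ 2 * p ‖w‖ * U w with huE
  set vE : ℂ → ℂ := fun w => fderiv ℝ V w w + (‖w‖ : ℂ) ^ 2 * p ‖w‖ * V w with hvE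
  set uA : ℂ → ℂ := fun w => fderiv ℝ U w (Complex.I * w) with huA
  set vA : ℂ → ℂ := fun w => fderiv ℝ V w (Complex.I * w) with hvA
  have hUc := hU.continuous
  have hVc := hV.continuous
  have huEc : Continuous uE :=
    ((hU.continuous_fderiv (by norm_num)).clm_apply continuous_id).sub (by fun_prop)
  have hvEc : Continuous vE :=
    ((hV.continuous_fderiv (by norm_num)).clm_apply continuous_id).add (by fun_prop)
  have huAc : Continuous uA := (hU.continuous_fderiv (by norm_num)).clm_apply (by fun_prop)
  have hvAc : Continuous vA := (hV.continuous_fderiv (by norm_num)).clm_apply (by fun_prop)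
  set c : ℝ → ℝ → ℂ := fun a b => (Real.exp a : ℂ) * (Complex.exp (b * Complex.I) * z) with hc
  have hcc : Continuous fun x : ℝ × ℝ => c x.1 x.2 := by
    simp only [hc]
    fun_prop
  have hrot : ∀ b : ℝ, Complex.exp (b * Complex.I) * z ≠ 0 := fun b =>
    mul_ne_zero (Complex.exp_ne_zero _) hz
  have hcswap : ∀ a b : ℝ, c a b = Complex.exp (b * Complex.I) * ((Real.exp a : ℂ) * z) :=
    fun a b => by simp only [hc]; ring
  set g : ℝ → ℝ → ℂ := fun a b => rayOp P U (c a b) + Complex.I * rayOp Q V (c a b) with hg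
  set f₁ : ℂ := rayOp Q uE z + Complex.I * rayOp P vE z with hf₁
  have hstrict := hasStrictFDerivAt_of_partials (f := g)
    (f₁ := fun a b => rayOp Q uE (c a b) + Complex.I * rayOp P vE (c a b))
    (f₂ := fun a b => rayOp P uA (c a b) + Complex.I * rayOp Q vA (c a b)) isOpen_univ
    (fun x _ => (h.hasDerivAt_rayOp_exp hU (hrot x.2) x.1).add
      ((h.hasDerivAt_rayOp_exp' hV (hrot x.2) x.1).const_mul Complex.I))
    (fun x _ => by
      have e1 := hasDerivAt_rayOp_rotation (k := P) hP hU ((Real.exp x.1 : ℂ) * z) x.2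
      have e2 := hasDerivAt_rayOp_rotation (k := Q) hQ hV ((Real.exp x.1 : ℂ) * z) x.2
      simp only [← hcswap] at e1 e2
      exact e1.add (e2.const_mul Complex.I))
    (((continuous_rayOp (k := Q) hQ huEc).comp hcc).add
      (((continuous_rayOp (k := P) hP hvEc).comp hcc).const_mul Complex.I)).continuousOn
    (((continuous_rayOp (k := P) hP huAc).comp hcc).add
      (((continuous_rayOp (k := Q) hQ hvAc).comp hcc).const_mul Complex.I)).continuousOn
    (p := (0, 0)) (mem_univ _)
  have hc0 : c 0 0 = z := by simp [hc]
  have e1 : rayOp Q uE z = rayOp Q vA z := rayOp_congr fun t ht => h₁ t ht _ rfl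
  have e2 : rayOp P vE z = -rayOp P uA z := by
    rw [neg_eq_neg_one_mul, ← rayOp_const_mul]
    refine rayOp_congr fun t ht => ?_
    rw [neg_one_mul]
    exact h₂ t ht _ rfl
  have hrel : rayOp P uA z + Complex.I * rayOp Q vA z = Complex.I * f₁ := by
    rw [hf₁, e1, e2]
    linear_combination (rayOp P uA z) * Complex.I_sq
  simp only [hc0] at hstrict
  rw [hrel, ← hf₁] at hstrict
  have hG : HasDerivAt (fun ζ : ℂ => g ζ.re ζ.im) f₁ 0 := by
    have h3 := HasFDerivAt.comp (𝕜 := ℝ) (0 : ℂ) (f := fun ζ : ℂ => (ζ.re, ζ.im))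
      (hstrict.hasFDerivAt) (Complex.equivRealProdCLM.hasFDerivAt (x := (0 : ℂ)))
    rw [hasDerivAt_iff_hasFDerivAt]
    refine hasFDerivAt_of_restrictScalars ℝ h3 (ContinuousLinearMap.ext fun w => ?_)
    simp only [ContinuousLinearMap.coe_restrictScalars', ContinuousLinearMap.toSpanSingleton_apply,
      ContinuousLinearMap.coe_comp, Function.comp, ContinuousLinearMap.coprod_apply,
      smul_eq_mul, ContinuousLinearEquiv.coe_coe, Complex.equivRealProdCLM_apply,
      Complex.real_smul]
    conv_lhs => rw [← Complex.re_add_im w]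
    ring
  have hlog : DifferentiableAt ℂ (fun w : ℂ => Complex.log (w / z)) z := by
    refine DifferentiableAt.clog (by fun_prop) ?_
    rw [div_self hz]
    exact Complex.one_mem_slitPlane
  have hcomp : DifferentiableAt ℂ (fun w : ℂ =>
      g (Complex.log (w / z)).re (Complex.log (w / z)).im) z := by
    refine DifferentiableAt.comp (g := fun ζ : ℂ => g ζ.re ζ.im) z ?_ hlog
    rw [div_self hz, Complex.log_one]
    exact hG.differentiableAt
  refine hcomp.congr_of_eventuallyEq ?_
  filter_upwards [isOpen_ne.mem_nhds hz] with w hw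
  have hcw : c (Complex.log (w / z)).re (Complex.log (w / z)).im = w := by
    simp only [hc]
    rw [Complex.ofReal_exp, ← mul_assoc, ← Complex.exp_add, Complex.re_add_im,
      Complex.exp_log (div_ne_zero hw hz), div_mul_cancel₀ _ hz]
  simp only [hg, hcw]

/-- The image of a solution of the radial Vekua system is holomorphic. -/
theorem differentiableOn_of_isPolarSolution (h : IsInverseKernel p m n) (hΩ : IsOpen Ω)
    (hstar : StarConvex ℝ (0 : ℂ) Ω) (h0 : (0 : ℂ) ∈ Ω) (hs : IsPolarSolution Ω p u v) :
    DifferentiableOn ℂ (fun z => rayOp (fun s c => n s c + m s c) u z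
      + Complex.I * rayOp (fun s c => n s c + -m s c) v z) Ω := by
  rw [← Complex.differentiableOn_compl_singleton_and_continuousAt_iff (hΩ.mem_nhds h0)]
  refine ⟨fun z hz => ?_, ?_⟩
  · obtain ⟨U, hU, hUe⟩ := exists_contDiff_eq_near_ray hΩ hstar hs.contDiffOn_left hz.1
    obtain ⟨V, hV, hVe⟩ := exists_contDiff_eq_near_ray hΩ hstar hs.contDiffOn_right hz.1
    refine DifferentiableAt.differentiableWithinAt ?_
    refine (h.differentiableAt_of_polar hU hV (by simpa using hz.2) ?_ ?_).congr_of_eventuallyEq ?_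
    · rintro t ht _ rfl
      have hu := hUe.self_of_nhds t ht
      have hv := hVe.self_of_nhds t ht
      rw [hu.fderiv_eq, hv.fderiv_eq, hu.eq_of_nhds]
      exact hs.left _ (real_mul_mem_of_starConvex hstar hz.1 ht)
    · rintro t ht _ rfl
      have hu := hUe.self_of_nhds t ht
      have hv := hVe.self_of_nhds t ht
      rw [hu.fderiv_eq, hv.fderiv_eq, hv.eq_of_nhds]
      exact hs.right _ (real_mul_mem_of_starConvex hstar hz.1 ht)
    · filter_upwards [hUe, hVe] with w hu hv
      rw [rayOp_congr fun t ht => (hu t ht).eq_of_nhds, rayOp_congr fun t ht => (hv t ht).eq_of_nhds]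
  · exact ((continuousOn_rayOp h.continuous_add hstar hs.contDiffOn_left.continuousOn).add
      (continuousOn_const.mul (continuousOn_rayOp h.continuous_sub hstar
        hs.contDiffOn_right.continuousOn))).continuousAt (hΩ.mem_nhds h0)

/-- The derivative along the positive real ray. -/
theorem hasDerivAt_rayOp_ofReal (h : IsInverseKernel p m n) (hΩ : IsOpen Ω)
    (hstar : StarConvex ℝ (0 : ℂ) Ω) (hu : ContDiffOn ℝ 1 u Ω) {r : ℝ} (hr : 0 < r)
    (hrΩ : (r : ℂ) ∈ Ω) :
    HasDerivAt (fun s : ℝ => rayOp (fun s c => n s c + m s c) u s)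
      (rayOp (fun s c => n s c + -m s c)
        (fun w => fderiv ℝ u w w - (‖w‖ : ℂ) ^ 2 * p ‖w‖ * u w) r / r) r := by
  obtain ⟨U, hU, hUe⟩ := exists_contDiff_eq_near_ray hΩ hstar hu hrΩ
  have h1 := HasDerivAt.scomp (h := Real.log) r
    (h.hasDerivAt_rayOp_exp hU one_ne_zero (Real.log r)) (Real.hasDerivAt_log hr.ne')
  rw [Real.exp_log hr, mul_one] at h1
  refine (h1.congr_deriv ?_).congr_of_eventuallyEq ?_
  · have e := hUe.self_of_nhds
    rw [Complex.real_smul, Complex.ofReal_inv, inv_mul_eq_div]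
    congr 1
    refine rayOp_congr fun t ht => ?_
    simp only [(e t ht).fderiv_eq, (e t ht).eq_of_nhds]
  · have hev : ∀ᶠ s : ℝ in 𝓝 r, ∀ t ∈ Icc (0 : ℝ) 1, U =ᶠ[𝓝 ((t : ℂ) * s)] u :=
      (Complex.continuous_ofReal.tendsto r).eventually hUe
    filter_upwards [hev, isOpen_Ioi.mem_nhds hr] with s hs hs0
    simp only [Function.comp]
    rw [Real.exp_log hs0, mul_one]
    exact (rayOp_congr fun t ht => (hs t ht).eq_of_nhds).symm

end IsInverseKernel

end Holomorphic

section Bound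

/-- Ray operators are boundedly invertible on compact star-shaped sets. -/
theorem exists_norm_le_of_norm_rayOp_le {k : ℝ → ℝ → ℂ}
    (hk : Continuous fun x : ℝ × ℝ => k x.1 x.2) {R : ℝ} (hR : 0 ≤ R) :
    ∃ C : ℝ, 0 < C ∧ ∀ (K : Set ℂ), IsCompact K → StarConvex ℝ (0 : ℂ) K → (∀ z ∈ K, ‖z‖ ≤ R) →
      ∀ u : ℂ → ℂ, ContinuousOn u K → ∀ ε : ℝ, (∀ z ∈ K, ‖rayOp k u z‖ ≤ ε) →
        ∀ z ∈ K, ‖u z‖ ≤ C * ε := by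
  obtain ⟨B, hB⟩ := ((isCompact_Icc (a := (0 : ℝ)) (b := R)).prod
    (isCompact_Icc (a := (0 : ℝ)) (b := R))).exists_bound_of_continuousOn hk.continuousOn
  have hB0 : 0 ≤ B := (norm_nonneg _).trans (hB (0, 0) ⟨⟨le_rfl, hR⟩, ⟨le_rfl, hR⟩⟩)
  set Λ : ℝ := B * R + 1 with hΛ
  have hΛ0 : 0 < Λ := by positivity
  refine ⟨2 * Real.exp (Λ * R), by positivity, fun K hK hstar hKR u hu ε hε z₀ hz₀ => ?_⟩
  have hε0 : 0 ≤ ε := (norm_nonneg _).trans (hε z₀ hz₀)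
  obtain ⟨zs, hzs, hmax⟩ := hK.exists_isMaxOn ⟨z₀, hz₀⟩
    (f := fun z => ‖u z‖ * Real.exp (-(Λ * ‖z‖))) (hu.norm.mul (by fun_prop))
  set N : ℝ := ‖u zs‖ * Real.exp (-(Λ * ‖zs‖)) with hN
  have hN0 : 0 ≤ N := by positivity
  have hle : ∀ z ∈ K, ‖u z‖ ≤ N * Real.exp (Λ * ‖z‖) := fun z hz => by
    have h1 : ‖u z‖ * Real.exp (-(Λ * ‖z‖)) ≤ N := hmax hz
    calc ‖u z‖ = ‖u z‖ * Real.exp (-(Λ * ‖z‖)) * Real.exp (Λ * ‖z‖) := by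
          rw [mul_assoc, ← Real.exp_add]
          simp
      _ ≤ _ := by gcongr
  set r : ℝ := ‖zs‖ with hr
  have hr0 : 0 ≤ r := norm_nonneg _
  have hrR : r ≤ R := hKR zs hzs
  have hint : ‖∫ τ in (0 : ℝ)..1, (r : ℂ) ^ 2 * τ * k (τ ^ 2 * r) (τ * r)
      * u (((τ ^ 2 : ℝ) : ℂ) * zs)‖ ≤
      ∫ τ in (0 : ℝ)..1, (B * N) * (r ^ 2 * τ * Real.exp (Λ * (τ ^ 2 * r))) := by
    refine intervalIntegral.norm_integral_le_of_norm_le zero_le_one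
      (Eventually.of_forall fun τ hτ => ?_) (Continuous.intervalIntegrable (by fun_prop) _ _)
    have hτ' : τ ∈ Icc (0 : ℝ) 1 := ⟨hτ.1.le, hτ.2⟩
    have hk1 : ‖k (τ ^ 2 * r) (τ * r)‖ ≤ B := hB (τ ^ 2 * r, τ * r)
      ⟨⟨by positivity, (mul_le_of_le_one_left hr0 (sq_mem_Icc hτ').2).trans hrR⟩,
        ⟨mul_nonneg hτ'.1 hr0, (mul_le_of_le_one_left hr0 hτ'.2).trans hrR⟩⟩
    have hu1 := hle _ (real_mul_mem_of_starConvex hstar hzs (sq_mem_Icc hτ'))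
    rw [norm_mul (((τ ^ 2 : ℝ) : ℂ)), Complex.norm_real, Real.norm_of_nonneg (sq_nonneg τ)] at hu1
    rw [norm_mul, norm_mul, norm_mul, norm_pow, Complex.norm_real, Complex.norm_real,
      Real.norm_of_nonneg hr0, Real.norm_of_nonneg hτ'.1]
    calc r ^ 2 * τ * ‖k (τ ^ 2 * r) (τ * r)‖ * ‖u (((τ ^ 2 : ℝ) : ℂ) * zs)‖
        ≤ r ^ 2 * τ * B * (N * Real.exp (Λ * (τ ^ 2 * r))) := by
          have := hτ'.1
          gcongr
      _ = _ := by ring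
  have hval : ∫ τ in (0 : ℝ)..1, (B * N) * (r ^ 2 * τ * Real.exp (Λ * (τ ^ 2 * r))) =
      B * N * (r / (2 * Λ) * (Real.exp (Λ * r) - 1)) := by
    rw [intervalIntegral.integral_const_mul]
    congr 1
    have hd : ∀ τ ∈ uIcc (0 : ℝ) 1, HasDerivAt (fun τ : ℝ => r / (2 * Λ) *
        Real.exp (Λ * (τ ^ 2 * r))) (r ^ 2 * τ * Real.exp (Λ * (τ ^ 2 * r))) τ := fun τ _ => by
      have h1 : HasDerivAt (fun τ : ℝ => Λ * (τ ^ 2 * r)) (Λ * (2 * τ * r)) τ := by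
        have := ((hasDerivAt_pow 2 τ).mul_const r).const_mul Λ
        simpa using this
      refine (h1.exp.const_mul (r / (2 * Λ))).congr_deriv ?_
      field_simp
    rw [intervalIntegral.integral_eq_sub_of_hasDerivAt hd
      (Continuous.intervalIntegrable (by fun_prop) _ _)]
    simp
    ring
  have hmain : ‖u zs‖ ≤ ε + N * Real.exp (Λ * r) / 2 := by
    have h1 : u zs = rayOp k u zs - ∫ τ in (0 : ℝ)..1, (r : ℂ) ^ 2 * τ * k (τ ^ 2 * r) (τ * r)
        * u (((τ ^ 2 : ℝ) : ℂ) * zs) := by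
      rw [rayOp]
      ring
    have h2 : B * N * (r / (2 * Λ) * (Real.exp (Λ * r) - 1)) ≤ N * Real.exp (Λ * r) / 2 := by
      have h3 : B * r / Λ ≤ 1 := by
        rw [div_le_one hΛ0, hΛ]
        nlinarith [mul_le_mul_of_nonneg_left hrR hB0]
      have h4 : 0 ≤ N * (Real.exp (Λ * r) - 1) / 2 := by
        have : 1 ≤ Real.exp (Λ * r) := Real.one_le_exp (by positivity)
        have : 0 ≤ Real.exp (Λ * r) - 1 := by linarith
        positivity
      calc B * N * (r / (2 * Λ) * (Real.exp (Λ * r) - 1))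
          = (B * r / Λ) * (N * (Real.exp (Λ * r) - 1) / 2) := by field_simp
        _ ≤ 1 * (N * (Real.exp (Λ * r) - 1) / 2) := by gcongr
        _ ≤ _ := by linarith
    calc ‖u zs‖ ≤ ‖rayOp k u zs‖ + _ := by
          conv_lhs => rw [h1]
          exact norm_sub_le _ _
      _ ≤ _ := add_le_add (hε zs hzs) (hint.trans (hval.le.trans h2))
  have hN2 : N ≤ 2 * ε := by
    have h1 : N * Real.exp (Λ * r) = ‖u zs‖ := by
      rw [hN, mul_assoc, ← Real.exp_add]
      simp
    have h2 : 1 ≤ Real.exp (Λ * r) := Real.one_le_exp (by positivity)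
    nlinarith
  calc ‖u z₀‖ ≤ N * Real.exp (Λ * ‖z₀‖) := hle z₀ hz₀
    _ ≤ 2 * ε * Real.exp (Λ * R) := by
        have := hKR z₀ hz₀
        gcongr
    _ = _ := by ring

end Bound

end RadialVekua

namespace RadialVekua

open Bicomplex

section Reflection

variable {p : ℝ → ℂ} {Ω : Set ℂ} {u v : ℂ → ℂ} {k : ℝ → ℝ → ℂ}

theorem rayOp_conj (z : ℂ) : rayOp k (fun w => u (starRingEnd ℂ w)) z =
    rayOp k u (starRingEnd ℂ z) := by
  simp only [rayOp, map_mul, Complex.conj_ofReal, Complex.norm_conj]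

theorem IsPolarSolution.conj (hΩ : IsOpen Ω) (h : IsPolarSolution Ω p u v) :
    IsPolarSolution (starRingEnd ℂ ⁻¹' Ω) p (fun w => u (starRingEnd ℂ w))
      (fun w => -1 * v (starRingEnd ℂ w)) := by
  have hc : ContDiff ℝ 1 (fun w : ℂ => (starRingEnd ℂ) w) := Complex.conjCLE.contDiff
  have hd : ∀ {u : ℂ → ℂ}, ContDiffOn ℝ 1 u Ω → ∀ z, starRingEnd ℂ z ∈ Ω →
      HasFDerivAt (fun w => u (starRingEnd ℂ w))
        ((fderiv ℝ u (starRingEnd ℂ z)).comp (Complex.conjCLE : ℂ →L[ℝ] ℂ)) z := fun hu z hz => by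
    have h1 := ((hu.contDiffAt (hΩ.mem_nhds hz)).differentiableAt (by norm_num)).hasFDerivAt
    exact h1.comp z (Complex.conjCLE.hasFDerivAt (x := z))
  refine ⟨h.contDiffOn_left.comp hc.contDiffOn (mapsTo_preimage _ _),
    contDiffOn_const.mul (h.contDiffOn_right.comp hc.contDiffOn (mapsTo_preimage _ _)),
    fun z hz => ?_, fun z hz => ?_⟩
  · have h1 := h.left _ hz
    rw [(hd h.contDiffOn_left z hz).fderiv,
      ((hd h.contDiffOn_right z hz).const_mul (-1 : ℂ)).fderiv]
    rw [Complex.norm_conj] at h1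
    simp only [ContinuousLinearMap.comp_apply, _root_.smul_apply,
      ContinuousLinearEquiv.coe_coe, Complex.conjCLE_apply, map_mul, Complex.conj_I, neg_mul,
      map_neg, smul_eq_mul, one_mul, neg_neg]
    exact h1
  · have h1 := h.right _ hz
    rw [(hd h.contDiffOn_left z hz).fderiv,
      ((hd h.contDiffOn_right z hz).const_mul (-1 : ℂ)).fderiv]
    rw [Complex.norm_conj] at h1
    simp only [ContinuousLinearMap.comp_apply, _root_.smul_apply,
      ContinuousLinearEquiv.coe_coe, Complex.conjCLE_apply, map_mul, Complex.conj_I, neg_mul,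
      map_neg, smul_eq_mul, one_mul, neg_neg]
    linear_combination -h1

end Reflection

section Moments

variable {R : ℝ} {f q p : ℝ → ℂ} {m n : ℝ → ℝ → ℂ} {k : ℝ → ℝ → ℂ}

/-- The action of a ray operator on a radial multiple of a homogeneous function. -/
noncomputable def rayFactor (k : ℝ → ℝ → ℂ) (φ : ℝ → ℂ) (N : ℕ) (r : ℝ) : ℂ :=
  φ r + ∫ τ in (0 : ℝ)..1, (r : ℂ) ^ 2 * τ * k (τ ^ 2 * r) (τ * r) * ((τ ^ 2) ^ N * φ (τ ^ 2 * r))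

theorem rayOp_of_homogeneous {φ : ℝ → ℂ} {N : ℕ} {a : ℂ → ℂ}
    (ha : ∀ (s : ℝ) (z : ℂ), a ((s : ℂ) * z) = (s : ℂ) ^ N * a z) (z : ℂ) :
    rayOp k (fun w => φ ‖w‖ * a w) z = rayFactor k φ N ‖z‖ * a z := by
  rw [rayOp, rayFactor, add_mul, ← intervalIntegral.integral_mul_const]
  congr 1
  refine intervalIntegral.integral_congr fun τ _ => ?_
  simp only [ha (τ ^ 2) z, norm_mul, Complex.norm_real, Real.norm_of_nonneg (sq_nonneg τ)]
  push_cast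
  ring

theorem continuousOn_rayFactor (hk : Continuous fun x : ℝ × ℝ => k x.1 x.2) {φ : ℝ → ℂ}
    (hφ : ContinuousOn φ (Ico 0 R)) (N : ℕ) : ContinuousOn (rayFactor k φ N) (Ico 0 R) := by
  refine hφ.add (continuousOn_intervalIntegral_param (H := fun r τ : ℝ =>
    (r : ℂ) ^ 2 * τ * k (τ ^ 2 * r) (τ * r) * ((τ ^ 2) ^ N * φ (τ ^ 2 * r))) ?_)
  have h1 : Continuous fun x : ℝ × ℝ => k (x.2 ^ 2 * x.1) (x.2 * x.1) :=
    hk.comp (by fun_prop : Continuous fun x : ℝ × ℝ => (x.2 ^ 2 * x.1, x.2 * x.1))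
  have h2 : ContinuousOn (fun x : ℝ × ℝ => φ (x.2 ^ 2 * x.1)) (Ico 0 R ×ˢ uIcc (0 : ℝ) 1) := by
    refine hφ.comp (f := fun x : ℝ × ℝ => x.2 ^ 2 * x.1)
      (by fun_prop : Continuous fun x : ℝ × ℝ => x.2 ^ 2 * x.1).continuousOn ?_
    rintro ⟨r, τ⟩ ⟨hr, hτ⟩
    rw [uIcc_of_le zero_le_one] at hτ
    exact ⟨mul_nonneg (sq_nonneg τ) hr.1,
      (mul_le_of_le_one_left hr.1 (sq_mem_Icc hτ).2).trans_lt hr.2⟩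
  exact ((by fun_prop : Continuous fun x : ℝ × ℝ => (x.1 : ℂ) ^ 2 * x.2).mul h1).continuousOn.mul
    ((by fun_prop : Continuous fun x : ℝ × ℝ => ((x.2 : ℂ) ^ 2) ^ N).continuousOn.mul h2)

theorem IsInverseKernel.hasDerivAt_rayFactor (h : IsInverseKernel p m n) {N : ℕ} {φ ψ ω : ℝ → ℂ}
    (hφ : ∀ z : ℂ, ‖z‖ < R → HasFDerivAt (fun w : ℂ => φ ‖w‖) (radialFDeriv ω z) z)
    (hφc : ContDiffOn ℝ 1 (fun w : ℂ => φ ‖w‖) (Metric.ball 0 R))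
    (hrel : ∀ r ∈ Ico 0 R, (r : ℂ) ^ 2 * ω r + N * φ r - (r : ℂ) ^ 2 * p r * φ r = N * ψ r)
    {r : ℝ} (hr : r ∈ Ioo 0 R) :
    HasDerivAt (rayFactor (fun s c => n s c + m s c) φ N)
      ((N * rayFactor (fun s c => n s c + -m s c) ψ N r
        - N * rayFactor (fun s c => n s c + m s c) φ N r) / r) r := by
  have hr0 : (r : ℂ) ≠ 0 := by exact_mod_cast (ne_of_gt hr.1)
  have hhom : ∀ (s : ℝ) (z : ℂ), ((s : ℂ) * z) ^ N = (s : ℂ) ^ N * z ^ N := fun s z => mul_pow _ _ _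
  have hball : StarConvex ℝ (0 : ℂ) (Metric.ball 0 R) :=
    (convex_ball (0 : ℂ) R).starConvex (Metric.mem_ball_self (hr.1.trans hr.2))
  have hu : ContDiffOn ℝ 1 (fun w : ℂ => φ ‖w‖ * w ^ N) (Metric.ball 0 R) :=
    hφc.mul (contDiff_id.pow N).contDiffOn
  have hrb : (r : ℂ) ∈ Metric.ball (0 : ℂ) R := by
    simpa [abs_of_pos hr.1] using hr.2
  have h1 := h.hasDerivAt_rayOp_ofReal Metric.isOpen_ball hball hu hr.1 hrb
  have hE : ∀ w ∈ Metric.ball (0 : ℂ) R, fderiv ℝ (fun w : ℂ => φ ‖w‖ * w ^ N) w w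
      - (‖w‖ : ℂ) ^ 2 * p ‖w‖ * (φ ‖w‖ * w ^ N) = N * (ψ ‖w‖ * w ^ N) := fun w hw => by
    have hw' : ‖w‖ < R := by simpa using hw
    have hpow : HasFDerivAt (fun w : ℂ => w ^ N)
        ((ContinuousLinearMap.toSpanSingleton ℂ ((N : ℂ) * w ^ (N - 1))).restrictScalars ℝ) w :=
      ((hasDerivAt_pow N w).hasFDerivAt).restrictScalars ℝ
    rw [((hφ w hw').fun_mul hpow).fderiv]
    have h2 : w * ((N : ℂ) * w ^ (N - 1)) = N * w ^ N := by
      rcases N with _ | N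
      · simp
      · rw [Nat.add_sub_cancel, pow_succ]
        ring
    simp only [_root_.add_apply, _root_.smul_apply, ContinuousLinearMap.coe_restrictScalars',
      ContinuousLinearMap.toSpanSingleton_apply, smul_eq_mul, (radialFDeriv_euler ω w).1, h2]
    linear_combination w ^ N * hrel ‖w‖ ⟨norm_nonneg w, hw'⟩
  have h2 : rayOp (fun s c => n s c + -m s c)
      (fun w => fderiv ℝ (fun w : ℂ => φ ‖w‖ * w ^ N) w w
        - (‖w‖ : ℂ) ^ 2 * p ‖w‖ * (φ ‖w‖ * w ^ N)) r =
      N * (rayFactor (fun s c => n s c + -m s c) ψ N r * (r : ℂ) ^ N) := by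
    rw [rayOp_congr (V := fun w => N * (ψ ‖w‖ * w ^ N)) fun t ht =>
      hE _ (real_mul_mem_of_starConvex hball hrb ht), rayOp_const_mul,
      rayOp_of_homogeneous (a := fun w : ℂ => w ^ N) hhom]
    simp [abs_of_pos hr.1]
  rw [h2] at h1
  have hpn : HasDerivAt (fun s : ℝ => ((s : ℂ) ^ N)⁻¹) (-(N * (r : ℂ) ^ (N - 1)) / ((r : ℂ) ^ N) ^ 2)
      r :=
    ((hasDerivAt_pow N (r : ℂ)).inv (pow_ne_zero N hr0)).comp_ofReal
  refine ((h1.mul hpn).congr_deriv ?_).congr_of_eventuallyEq ?_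
  · rw [rayOp_of_homogeneous (a := fun w : ℂ => w ^ N) hhom, Complex.norm_real,
      Real.norm_of_nonneg hr.1.le]
    have hpp := pow_ne_zero N hr0
    rcases N with _ | N
    · simp
    · rw [Nat.add_sub_cancel]
      field_simp
      ring
  · filter_upwards [isOpen_Ioi.mem_nhds hr.1] with s hs
    have hs0 : (s : ℂ) ≠ 0 := by exact_mod_cast (ne_of_gt hs)
    have hs1 : (0 : ℝ) < s := hs
    simp only [Pi.mul_apply]
    rw [rayOp_of_homogeneous (a := fun w : ℂ => w ^ N) hhom, Complex.norm_real,
      Real.norm_of_nonneg hs1.le, mul_assoc, mul_inv_cancel₀ (pow_ne_zero N hs0), mul_one]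

theorem rayFactor_zero {φ : ℝ → ℂ} (N : ℕ) : rayFactor k φ N 0 = φ 0 := by
  simp [rayFactor]

end Moments

section Setting

variable {R : ℝ} {f q p : ℝ → ℂ} {m n : ℝ → ℝ → ℂ}

theorem exists_continuous_hasCompactSupport_extension {g : ℝ → ℂ} (hR : 0 ≤ R)
    (hg : ContinuousOn g (Icc 0 R)) :
    ∃ p : ℝ → ℂ, Continuous p ∧ HasCompactSupport p ∧ ∀ r ∈ Icc 0 R, p r = g r := by
  refine ⟨fun x => ((max 0 (min 1 (R + 1 - |x|)) : ℝ) : ℂ) * g (projIcc 0 R hR x), ?_, ?_, ?_⟩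
  · have h1 : Continuous fun x : ℝ => g (projIcc 0 R hR x) :=
      hg.comp_continuous (by fun_prop) fun x => (projIcc 0 R hR x).2
    have h2 : Continuous fun x : ℝ => ((max 0 (min 1 (R + 1 - |x|)) : ℝ) : ℂ) := by fun_prop
    exact h2.mul h1
  · refine HasCompactSupport.intro (isCompact_Icc (a := -(R + 1)) (b := R + 1)) fun x hx => ?_
    have hx' : R + 1 < |x| := by
      by_contra hcon
      exact hx (abs_le.1 (not_lt.1 hcon))
    rw [max_eq_left ((min_le_right _ _).trans (by linarith))]
    simp
  · intro r hr
    have h1 : min 1 (R + 1 - |r|) = 1 := min_eq_left (by rw [abs_of_nonneg hr.1]; linarith [hr.2])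
    simp only [h1, projIcc_of_mem hR hr]
    simp

theorem IsSetting.exists_isInverseKernel (S : IsSetting R f q) :
    ∃ (p : ℝ → ℂ) (m n : ℝ → ℝ → ℂ), IsInverseKernel p m n ∧
      ∀ r ∈ Ico 0 R, logEuler q f r = (r : ℂ) ^ 2 * p r := by
  obtain ⟨g, hg, he⟩ := exists_logEuler_eq S.isRadialSolution S.pos S.continuousOn_q S.ne_zero
  obtain ⟨p, hp, hs, hpg⟩ := exists_continuous_hasCompactSupport_extension S.pos.le hg
  obtain ⟨m, n, h⟩ := RadialVekua.exists_isInverseKernel hp hs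
  exact ⟨p, m, n, h, fun r hr => by rw [he r hr, hpg r (Ico_subset_Icc_self hr)]⟩

theorem IsSetting.isPolarSolution (S : IsSetting R f q) {Ω : Set ℂ} (hΩ : IsOpen Ω)
    (hΩR : ∀ z ∈ Ω, ‖z‖ < R) (hp : ∀ r ∈ Ico 0 R, logEuler q f r = (r : ℂ) ^ 2 * p r)
    {W : ℂ → Bicomplex} (hW : W ∈ vekuaSolutions Ω f) :
    IsPolarSolution Ω p (fun z => (W z).sc) (fun z => (W z).vec) := by
  obtain ⟨hWc, hWe⟩ := hW
  have hparts : ContDiffOn ℝ 1 (fun z => partsCLM (W z)) Ω := partsCLM.contDiff.comp_contDiffOn hWc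
  have hu : ContDiffOn ℝ 1 (fun z => (W z).sc) Ω := contDiff_fst.comp_contDiffOn hparts
  have hv : ContDiffOn ℝ 1 (fun z => (W z).vec) Ω := contDiff_snd.comp_contDiffOn hparts
  obtain ⟨ν, hfd, -, hfe⟩ := S.isRadialSolution.exists_hasFDerivAt S.pos S.continuousOn_q
  have key : ∀ z ∈ Ω, z ≠ 0 →
      fderiv ℝ (fun z => (W z).sc) z z - (‖z‖ : ℂ) ^ 2 * p ‖z‖ * (W z).sc =
          fderiv ℝ (fun z => (W z).vec) z (Complex.I * z) ∧
        fderiv ℝ (fun z => (W z).vec) z z + (‖z‖ : ℂ) ^ 2 * p ‖z‖ * (W z).vec =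
          -fderiv ℝ (fun z => (W z).sc) z (Complex.I * z) := fun z hz hz0 => by
    have hud := ((hu.contDiffAt (hΩ.mem_nhds hz)).differentiableAt (by norm_num)).hasFDerivAt
    have hvd := ((hv.contDiffAt (hΩ.mem_nhds hz)).differentiableAt (by norm_num)).hasFDerivAt
    have hzI : ‖z‖ ∈ Ico 0 R := ⟨norm_nonneg z, hΩR z hz⟩
    have h1 := (vekua_iff_polar hud hvd (hfd z (hΩR z hz)) hz0).1 (hWe z hz)
    have hF : ((‖z‖ : ℝ) : ℂ) ^ 2 * ν ‖z‖ / f ‖z‖ = (‖z‖ : ℂ) ^ 2 * p ‖z‖ := by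
      rw [← hp _ hzI, logEuler, hfe _ hzI]
    rw [hF] at h1
    exact ⟨by linear_combination h1.1, by linear_combination h1.2⟩
  refine ⟨hu, hv, fun z hz => ?_, fun z hz => ?_⟩
  · rcases eq_or_ne z 0 with rfl | hz0
    · simp
    · exact (key z hz hz0).1
  · rcases eq_or_ne z 0 with rfl | hz0
    · simp
    · exact (key z hz hz0).2

/-- The inverse operators map the radial factors of the formal powers to one. -/
theorem IsSetting.rayFactor_eq_one (S : IsSetting R f q) (h : IsInverseKernel p m n)
    (hp : ∀ r ∈ Ico 0 R, logEuler q f r = (r : ℂ) ^ 2 * p r) (N : ℕ) {r : ℝ} (hr : r ∈ Ico 0 R) :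
    rayFactor (fun s c => n s c + m s c) (scFactor R q N) N r = 1 ∧
      rayFactor (fun s c => n s c + -m s c) (vecFactor R f q N) N r = 1 := by
  have hφ := S.isRadialSolution_scFactor N
  have hψ := S.isRadialSolution_vecFactor N
  have hrel := fun r (hr : r ∈ Ico 0 R) => S.relations N hr
  set φ := scFactor R q N
  set ψ := vecFactor R f q N
  obtain ⟨ω, hφd, hφc, hφe⟩ := hφ.exists_hasFDerivAt S.pos S.continuousOn_q
  obtain ⟨η, hψd, hψc, hψe⟩ := hψ.exists_hasFDerivAt S.pos S.contDiffOn_darboux.continuousOn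
  have hx := fun r (hr : r ∈ Ioo 0 R) => h.hasDerivAt_rayFactor (N := N) (ψ := ψ) hφd hφc
    (fun r hr => by
      have := (hrel r hr).1
      rw [hφe r hr, hp r hr] at this
      exact this) hr
  have hy := fun r (hr : r ∈ Ioo 0 R) => h.neg.hasDerivAt_rayFactor (N := N) (ψ := φ) hψd hψc
    (fun r hr => by
      have := (hrel r hr).2
      rw [hψe r hr, hp r hr] at this
      linear_combination this) hr
  simp only [neg_neg] at hy
  set x := rayFactor (fun s c => n s c + m s c) φ N with hxdef
  set y := rayFactor (fun s c => n s c + -m s c) ψ N with hydef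
  have hxc : ContinuousOn x (Ico 0 R) :=
    continuousOn_rayFactor h.continuous_add (hφ.continuousOn.mono Ico_subset_Icc_self) N
  have hyc : ContinuousOn y (Ico 0 R) :=
    continuousOn_rayFactor h.continuous_sub (hψ.continuousOn.mono Ico_subset_Icc_self) N
  have h0 := eq_zero_of_singular_system (R := R) (n := N) (X := fun r => x r - 1)
    (Y := fun r => 1 - y r) (F := fun _ => 0) (C := 0) (hxc.sub continuousOn_const)
    (continuousOn_const.sub hyc)
    (by rw [hxdef, rayFactor_zero, hφ.map_zero, sub_self])
    (by rw [hydef, rayFactor_zero, hψ.map_zero, sub_self]) (by simp)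
    (fun r hr => ((hx r hr).sub_const 1).congr_deriv (by ring))
    (fun r hr => ((hy r hr).const_sub 1).congr_deriv (by ring)) r hr
  exact ⟨by linear_combination h0.1, by linear_combination -h0.2⟩

theorem IsSetting.rayOp_formalPower (S : IsSetting R f q) (h : IsInverseKernel p m n)
    (hp : ∀ r ∈ Ico 0 R, logEuler q f r = (r : ℂ) ^ 2 * p r) (N : ℕ) (A : Bicomplex) {z : ℂ}
    (hz : ‖z‖ < R) :
    rayOp (fun s c => n s c + m s c) (fun w => (formalPower R f q N A w).sc) z =
        (A * hat z ^ N).sc ∧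
      rayOp (fun s c => n s c + -m s c) (fun w => (formalPower R f q N A w).vec) z =
        (A * hat z ^ N).vec := by
  have hball : ∀ t ∈ Icc (0 : ℝ) 1, ‖(t : ℂ) * z‖ ≤ R := fun t ht => by
    rw [norm_mul, Complex.norm_real, Real.norm_of_nonneg ht.1]
    exact (mul_le_of_le_one_left (norm_nonneg z) ht.2).trans hz.le
  obtain ⟨h1, h2⟩ := S.rayFactor_eq_one h hp N ⟨norm_nonneg z, hz⟩
  constructor
  · rw [rayOp_congr (V := fun w => scFactor R q N ‖w‖ * (A * hat w ^ N).sc) fun t ht => by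
      rw [S.formalPower_eq N A (hball t ht), sc_mk], rayOp_of_homogeneous fun s z => by
      rw [mul_hat_pow_real_mul, sc_smul], h1, one_mul]
  · rw [rayOp_congr (V := fun w => vecFactor R f q N ‖w‖ * (A * hat w ^ N).vec) fun t ht => by
      rw [S.formalPower_eq N A (hball t ht), vec_mk], rayOp_of_homogeneous fun s z => by
      rw [mul_hat_pow_real_mul, vec_smul], h2, one_mul]

end Setting

end RadialVekua

namespace RadialVekua

section PolynomialApproximation

/-- Uniform approximability by complex polynomials. -/
def PolynomiallyApproximable (K : Set ℂ) (g : ℂ → ℂ) : Prop :=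
  ∀ ε > 0, ∃ P : Polynomial ℂ, ∀ z ∈ K, ‖g z - P.eval z‖ ≤ ε

namespace PolynomiallyApproximable

variable {K : Set ℂ} {g g₁ g₂ : ℂ → ℂ}

theorem add (h₁ : PolynomiallyApproximable K g₁) (h₂ : PolynomiallyApproximable K g₂) :
    PolynomiallyApproximable K fun z => g₁ z + g₂ z := fun ε hε => by
  obtain ⟨P, hP⟩ := h₁ (ε / 2) (half_pos hε)
  obtain ⟨Q, hQ⟩ := h₂ (ε / 2) (half_pos hε)
  refine ⟨P + Q, fun z hz => ?_⟩
  rw [Polynomial.eval_add, add_sub_add_comm]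
  exact (norm_add_le _ _).trans (by linarith [hP z hz, hQ z hz])

theorem sum {g : ℕ → ℂ → ℂ} (h : ∀ k, PolynomiallyApproximable K (g k)) (N : ℕ) :
    PolynomiallyApproximable K fun z => ∑ k ∈ Finset.range N, g k z := by
  induction N with
  | zero => exact fun ε hε => ⟨0, fun z _ => by simpa using hε.le⟩
  | succ N ih =>
    simp only [Finset.sum_range_succ]
    exact ih.add (h N)

theorem polynomial_mul (hK : IsCompact K) (Q : Polynomial ℂ) (h : PolynomiallyApproximable K g) :
    PolynomiallyApproximable K fun z => Q.eval z * g z := fun ε hε => by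
  obtain ⟨B, hB⟩ := hK.exists_bound_of_continuousOn (f := fun z => Q.eval z)
    Q.continuous.continuousOn
  obtain ⟨P, hP⟩ := h (ε / (|B| + 1)) (by positivity)
  refine ⟨Q * P, fun z hz => ?_⟩
  rw [Polynomial.eval_mul, ← mul_sub, norm_mul]
  calc ‖Q.eval z‖ * ‖g z - P.eval z‖ ≤ (|B| + 1) * (ε / (|B| + 1)) := by
        gcongr
        · linarith [hB z hz, le_abs_self B]
        · exact hP z hz
    _ = ε := by field_simp

theorem of_tendstoUniformlyOn {G : ℕ → ℂ → ℂ} (h : ∀ N, PolynomiallyApproximable K (G N))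
    (hG : TendstoUniformlyOn G g atTop K) : PolynomiallyApproximable K g := fun ε hε => by
  obtain ⟨N, hN⟩ := (Metric.tendstoUniformlyOn_iff.1 hG (ε / 2) (half_pos hε)).exists
  obtain ⟨P, hP⟩ := h N (ε / 2) (half_pos hε)
  refine ⟨P, fun z hz => ?_⟩
  have h1 := hN z hz
  rw [dist_eq_norm] at h1
  calc ‖g z - P.eval z‖ = ‖(g z - G N z) + (G N z - P.eval z)‖ := by rw [sub_add_sub_cancel]
    _ ≤ ‖g z - G N z‖ + ‖G N z - P.eval z‖ := norm_add_le _ _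
    _ ≤ ε := by linarith [hP z hz]

theorem dilation_step {Ω : Set ℂ} (hΩ : IsOpen Ω) (hK : IsCompact K)
    (hstar : StarConvex ℝ (0 : ℂ) K) {ρ M : ℝ} (hρ : 0 < ρ)
    (hρK : Metric.cthickening ρ K ⊆ Ω) (hM : ∀ z ∈ K, ‖z‖ ≤ M) {t₀ t : ℝ}
    (ht₀ : t₀ ∈ Icc (0 : ℝ) 1) (hstep : |t - t₀| * M ≤ ρ / 2)
    (h : ∀ g : ℂ → ℂ, DifferentiableOn ℂ g Ω →
      PolynomiallyApproximable K fun z => g ((t₀ : ℂ) * z)) :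
    ∀ g : ℂ → ℂ, DifferentiableOn ℂ g Ω → PolynomiallyApproximable K fun z => g ((t : ℂ) * z) := by
  intro g hg
  obtain ⟨C, hC⟩ := hK.cthickening.exists_bound_of_continuousOn
    (hg.continuousOn.mono hρK) (f := g)
  have hana : AnalyticOnNhd ℂ g Ω := hg.analyticOnNhd hΩ
  have hder : ∀ k, DifferentiableOn ℂ (iteratedDeriv k g) Ω := fun k => by
    rw [iteratedDeriv_eq_iterate]
    exact (hana.iterated_deriv k).differentiableOn
  set T : ℕ → ℂ → ℂ := fun k z => (Polynomial.C ((k.factorial : ℂ)⁻¹ * ((t : ℂ) - t₀) ^ k) *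
    Polynomial.X ^ k).eval z * iteratedDeriv k g ((t₀ : ℂ) * z) with hT
  have hclosed : ∀ z ∈ K, Metric.closedBall ((t₀ : ℂ) * z) ρ ⊆ Metric.cthickening ρ K :=
    fun z hz => Metric.closedBall_subset_cthickening
      (real_mul_mem_of_starConvex hstar hz ht₀) ρ
  have hdist : ∀ z ∈ K, ‖((t : ℂ) - t₀) * z‖ ≤ ρ / 2 := fun z hz => by
    rw [norm_mul, ← Complex.ofReal_sub, Complex.norm_real, Real.norm_eq_abs]
    exact (mul_le_mul_of_nonneg_left (hM z hz) (abs_nonneg _)).trans hstep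
  have hbound : ∀ k, ∀ z ∈ K, ‖T k z‖ ≤ C * (1 / 2) ^ k := fun k z hz => by
    have h1 := Complex.norm_iteratedDeriv_le_of_forall_mem_sphere_norm_le k hρ (f := g)
      (c := (t₀ : ℂ) * z) (C := C)
      (hg.diffContOnCl_ball ((hclosed z hz).trans hρK))
      (fun w hw => hC w (hclosed z hz (Metric.sphere_subset_closedBall hw)))
    have hC0 : 0 ≤ C := (norm_nonneg _).trans
      (hC _ (hclosed z hz (Metric.mem_closedBall_self hρ.le)))
    have hfac : (0 : ℝ) < k.factorial := by exact_mod_cast k.factorial_pos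
    have h2 : T k z = (k.factorial : ℂ)⁻¹ * (((t : ℂ) - t₀) * z) ^ k *
        iteratedDeriv k g ((t₀ : ℂ) * z) := by
      simp only [hT, Polynomial.eval_mul, Polynomial.eval_C, Polynomial.eval_pow,
        Polynomial.eval_X, mul_pow]
      ring
    rw [h2, norm_mul, norm_mul, norm_inv, norm_pow, Complex.norm_natCast]
    calc (k.factorial : ℝ)⁻¹ * ‖((t : ℂ) - t₀) * z‖ ^ k * ‖iteratedDeriv k g ((t₀ : ℂ) * z)‖
        ≤ (k.factorial : ℝ)⁻¹ * (ρ / 2) ^ k * (k.factorial * C / ρ ^ k) := by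
          gcongr
          exact hdist z hz
      _ = C * (1 / 2) ^ k := by
          rw [div_pow, div_pow, one_pow]
          field_simp
  have hsum : Summable fun k : ℕ => C * (1 / 2 : ℝ) ^ k :=
    (summable_geometric_of_lt_one (by norm_num) (by norm_num)).mul_left C
  have hlim := tendstoUniformlyOn_tsum_nat hsum hbound
  refine of_tendstoUniformlyOn (G := fun N z => ∑ k ∈ Finset.range N, T k z)
    (fun N => sum (fun k => polynomial_mul hK _ (h _ (hder k))) N) (hlim.congr_right fun z hz => ?_)
  have hb : (t : ℂ) * z ∈ Metric.ball ((t₀ : ℂ) * z) ρ := by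
    rw [mem_ball_iff_norm, ← sub_mul]
    linarith [hdist z hz]
  have h1 := Complex.hasSum_taylorSeries_on_ball (f := g) (c := (t₀ : ℂ) * z) (r := ρ)
    (hg.mono ((Metric.ball_subset_closedBall.trans (hclosed z hz)).trans hρK)) hb
  rw [← h1.tsum_eq]
  refine tsum_congr fun k => ?_
  simp only [hT, Polynomial.eval_mul, Polynomial.eval_C, Polynomial.eval_pow, Polynomial.eval_X,
    smul_eq_mul, ← sub_mul, mul_pow]
  ring

/-- Runge's theorem for star-shaped sets. -/
theorem of_differentiableOn {Ω : Set ℂ} (hΩ : IsOpen Ω) (hK : IsCompact K)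
    (hstar : StarConvex ℝ (0 : ℂ) K) (hKΩ : K ⊆ Ω) (hg : DifferentiableOn ℂ g Ω) :
    PolynomiallyApproximable K g := by
  obtain ⟨ρ, hρ, hρK⟩ := hK.exists_cthickening_subset_open hΩ hKΩ
  obtain ⟨M, hM⟩ := hK.exists_bound_of_continuousOn (f := fun z : ℂ => z) continuousOn_id
  obtain ⟨J, hJ⟩ := exists_nat_gt (M / (ρ / 2))
  have hJ1 : (0 : ℝ) < J + 1 := by positivity
  have hJ2 : (1 / ((J : ℝ) + 1)) * M ≤ ρ / 2 := by
    rw [div_lt_iff₀ (by positivity)] at hJ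
    rw [one_div_mul_eq_div, div_le_iff₀ hJ1]
    nlinarith
  have key : ∀ j : ℕ, j ≤ J + 1 → ∀ g : ℂ → ℂ, DifferentiableOn ℂ g Ω →
      PolynomiallyApproximable K fun z => g (((j / (J + 1) : ℝ) : ℂ) * z) := by
    intro j
    induction j with
    | zero =>
      intro _ g _ ε hε
      exact ⟨Polynomial.C (g 0), fun z _ => by simpa using hε.le⟩
    | succ j ih =>
      intro hj
      have hj' : (j : ℝ) + 1 ≤ J + 1 := by exact_mod_cast hj
      refine dilation_step hΩ hK hstar hρ hρK hM (t₀ := j / (J + 1))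
        ⟨by positivity, (div_le_one hJ1).2 (by linarith)⟩ ?_ (ih (by omega))
      have : ((j + 1 : ℕ) : ℝ) / (J + 1) - j / (J + 1) = 1 / ((J : ℝ) + 1) := by
        push_cast
        ring
      rw [this, abs_of_pos (by positivity)]
      exact hJ2
  have h1 := key (J + 1) le_rfl g hg
  have : (((J + 1 : ℕ) / (J + 1) : ℝ) : ℂ) = 1 := by
    push_cast
    exact div_self (by exact_mod_cast hJ1.ne')
  simpa only [this, one_mul] using h1

end PolynomiallyApproximable

end PolynomialApproximation

end RadialVekua

namespace Bicomplex

/-- The bicomplex number with prescribed values at `𝐣 = i` and `𝐣 = -i`. -/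
noncomputable def ofEvals (α β : ℂ) : Bicomplex := mk ((α + β) / 2) (-Complex.I * (α - β) / 2)

theorem eval_I_ofEvals (α β : ℂ) : eval Complex.I (ofEvals α β) = α := by
  simp only [eval, ofEvals, sc_mk, vec_mk]
  linear_combination -((α - β) / 2) * Complex.I_sq

theorem eval_neg_I_ofEvals (α β : ℂ) : eval (-Complex.I) (ofEvals α β) = β := by
  simp only [eval, ofEvals, sc_mk, vec_mk]
  linear_combination ((α - β) / 2) * Complex.I_sq

theorem norm_sc_le_eval (W : Bicomplex) :
    ‖W.sc‖ ≤ (‖eval Complex.I W‖ + ‖eval (-Complex.I) W‖) / 2 := by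
  rw [sc_eq_eval, norm_div, Complex.norm_ofNat]
  gcongr
  exact norm_add_le _ _

theorem norm_vec_le_eval (W : Bicomplex) :
    ‖W.vec‖ ≤ (‖eval Complex.I W‖ + ‖eval (-Complex.I) W‖) / 2 := by
  rw [vec_eq_eval, norm_div, norm_mul, norm_neg, Complex.norm_I, one_mul, Complex.norm_ofNat]
  gcongr
  exact norm_sub_le _ _

theorem sc_sum {N : ℕ} (F : ℕ → Bicomplex) :
    (∑ k ∈ Finset.range N, F k).sc = ∑ k ∈ Finset.range N, (F k).sc := by
  induction N with
  | zero => rfl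
  | succ N ih => rw [Finset.sum_range_succ, sc_add, ih, Finset.sum_range_succ]

theorem vec_sum {N : ℕ} (F : ℕ → Bicomplex) :
    (∑ k ∈ Finset.range N, F k).vec = ∑ k ∈ Finset.range N, (F k).vec := by
  induction N with
  | zero => rfl
  | succ N ih => rw [Finset.sum_range_succ, vec_add, ih, Finset.sum_range_succ]

theorem eval_sum (ε : ℂ) {N : ℕ} (F : ℕ → Bicomplex) :
    eval ε (∑ k ∈ Finset.range N, F k) = ∑ k ∈ Finset.range N, eval ε (F k) := by
  simp only [eval, sc_sum, vec_sum, Finset.sum_add_distrib, Finset.mul_sum]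

theorem eval_sub (ε : ℂ) (W Z : Bicomplex) : eval ε (W - Z) = eval ε W - eval ε Z := by
  simp only [eval, sc_sub, vec_sub]
  ring

end Bicomplex

namespace RadialVekua

open Bicomplex

section Transform

variable {R : ℝ} {f q : ℝ → ℂ} {Ω : Set ℂ}

theorem rayOp_sum {k : ℝ → ℝ → ℂ} (hk : Continuous fun x : ℝ × ℝ => k x.1 x.2)
    (hΩ : StarConvex ℝ (0 : ℂ) Ω) {u : ℕ → ℂ → ℂ} (hu : ∀ l, ContinuousOn (u l) Ω) {z : ℂ}
    (hz : z ∈ Ω) (N : ℕ) :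
    rayOp k (fun w => ∑ l ∈ Finset.range N, u l w) z = ∑ l ∈ Finset.range N, rayOp k (u l) z := by
  induction N with
  | zero => simp [rayOp]
  | succ N ih =>
    simp only [Finset.sum_range_succ]
    rw [rayOp_add hk hΩ (continuousOn_finsetSum _ fun l _ => hu l) (hu N) hz, ih]

theorem rayOp_sub {k : ℝ → ℝ → ℂ} (hk : Continuous fun x : ℝ × ℝ => k x.1 x.2)
    (hΩ : StarConvex ℝ (0 : ℂ) Ω) {u v : ℂ → ℂ} (hu : ContinuousOn u Ω) (hv : ContinuousOn v Ω)
    {z : ℂ} (hz : z ∈ Ω) : rayOp k (fun w => u w - v w) z = rayOp k u z - rayOp k v z := by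
  have h1 := rayOp_add hk hΩ hu (v := fun w => -1 * v w) (continuousOn_const.mul hv) hz
  rw [rayOp_const_mul] at h1
  simpa only [neg_one_mul, ← sub_eq_add_neg] using h1

theorem continuousOn_parts {W : ℂ → Bicomplex} (hW : W ∈ vekuaSolutions Ω f) :
    ContinuousOn (fun z => (W z).sc) Ω ∧ ContinuousOn (fun z => (W z).vec) Ω := by
  have hparts : ContinuousOn (fun z => partsCLM (W z)) Ω :=
    partsCLM.continuous.comp_continuousOn hW.1.continuousOn
  exact ⟨continuous_fst.comp_continuousOn hparts, continuous_snd.comp_continuousOn hparts⟩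

/-- Every solution corresponds to a holomorphic and an antiholomorphic function, whose polynomial
approximations control the approximations of the solution by formal powers. -/
theorem IsSetting.exists_holomorphic_pair (S : IsSetting R f q) (hΩ : IsOpen Ω)
    (hΩR : ∀ z ∈ Ω, ‖z‖ < R) (hstar : StarConvex ℝ (0 : ℂ) Ω) (h0 : (0 : ℂ) ∈ Ω)
    {W : ℂ → Bicomplex} (hW : W ∈ vekuaSolutions Ω f) :
    ∃ h₁ h₂ : ℂ → ℂ, DifferentiableOn ℂ h₁ Ω ∧ DifferentiableOn ℂ h₂ (starRingEnd ℂ ⁻¹' Ω) ∧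
      ∃ C : ℝ, 0 < C ∧ ∀ K : Set ℂ, IsCompact K → StarConvex ℝ (0 : ℂ) K → K ⊆ Ω →
        ∀ (N : ℕ) (A : ℕ → Bicomplex) (ε : ℝ),
          (∀ z ∈ K, ‖h₁ z - ∑ k ∈ Finset.range N, eval Complex.I (A k) * z ^ k‖ ≤ ε) →
          (∀ z ∈ K, ‖h₂ (starRingEnd ℂ z) - ∑ k ∈ Finset.range N,
            eval (-Complex.I) (A k) * (starRingEnd ℂ z) ^ k‖ ≤ ε) →
          ∀ z ∈ K, ‖W z - ∑ k ∈ Finset.range N, formalPower R f q k (A k) z‖ ≤ C * ε := by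
  obtain ⟨p, m, n, h, hp⟩ := S.exists_isInverseKernel
  have hpol := S.isPolarSolution hΩ hΩR hp hW
  have hd₁ := h.differentiableOn_of_isPolarSolution hΩ hstar h0 hpol
  have hstar' : StarConvex ℝ (0 : ℂ) (starRingEnd ℂ ⁻¹' Ω) := fun z hz a b ha hb hab => by
    have := hstar hz ha hb hab
    simpa [Complex.real_smul] using this
  have hd₂ := h.differentiableOn_of_isPolarSolution (hΩ.preimage Complex.continuous_conj) hstar'
    (by simpa using h0) (hpol.conj hΩ)
  obtain ⟨C₁, hC₁, hb₁⟩ := exists_norm_le_of_norm_rayOp_le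
    (k := fun s c => n s c + m s c) h.continuous_add S.pos.le
  obtain ⟨C₂, hC₂, hb₂⟩ := exists_norm_le_of_norm_rayOp_le
    (k := fun s c => n s c + -m s c) h.continuous_sub S.pos.le
  have hP := h.continuous_add
  have hQ := h.continuous_sub
  set P : ℝ → ℝ → ℂ := fun s c => n s c + m s c
  set Q : ℝ → ℝ → ℂ := fun s c => n s c + -m s c
  obtain ⟨huc, hvc⟩ := continuousOn_parts hW
  refine ⟨_, _, hd₁, hd₂, C₁ + C₂, by positivity, fun K hK hKs hKΩ N A ε he₁ he₂ => ?_⟩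
  have hZ : ∀ k, ContinuousOn (fun z => (formalPower R f q k (A k) z).sc) Ω ∧
      ContinuousOn (fun z => (formalPower R f q k (A k) z).vec) Ω := fun k =>
    continuousOn_parts (formalPower_mem_vekuaSolutions S hΩ hΩR k (A k))
  set X : ℂ → Bicomplex := fun z =>
    Bicomplex.mk (rayOp P (fun w => (W w).sc) z) (rayOp Q (fun w => (W w).vec) z)
      - ∑ k ∈ Finset.range N, A k * hat z ^ k with hX
  have hXI : ∀ z ∈ K, ‖eval Complex.I (X z)‖ ≤ ε := fun z hz => by
    have h1 := he₁ z hz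
    simp only [hX, eval_sub, eval_sum, eval_mul_hat_pow]
    exact h1
  have hXI' : ∀ z ∈ K, ‖eval (-Complex.I) (X z)‖ ≤ ε := fun z hz => by
    have h1 := he₂ z hz
    rw [rayOp_const_mul, rayOp_conj (u := fun w => (W w).sc),
      rayOp_conj (u := fun w => (W w).vec), Complex.conj_conj] at h1
    simp only [hX, eval_sub, eval_sum, eval_neg_mul_hat_pow]
    convert h1 using 3
    simp only [eval, sc_mk, vec_mk]
    ring
  have hsc : ∀ z ∈ K, ‖rayOp P (fun w => (W w).sc
      - ∑ k ∈ Finset.range N, (formalPower R f q k (A k) w).sc) z‖ ≤ ε := fun z hz => by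
    have h1 : rayOp P (fun w => (W w).sc
        - ∑ k ∈ Finset.range N, (formalPower R f q k (A k) w).sc) z = (X z).sc := by
      rw [rayOp_sub (k := P) hP hstar huc (continuousOn_finsetSum _ fun l _ => (hZ l).1) (hKΩ hz),
        rayOp_sum (k := P) hP hstar (fun l => (hZ l).1) (hKΩ hz), hX, sc_sub, sc_sum, sc_mk]
      congr 1
      exact Finset.sum_congr rfl fun k _ =>
        (S.rayOp_formalPower h hp k (A k) (hΩR z (hKΩ hz))).1
    rw [h1]
    linarith [norm_sc_le_eval (X z), hXI z hz, hXI' z hz]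
  have hvec : ∀ z ∈ K, ‖rayOp Q (fun w => (W w).vec
      - ∑ k ∈ Finset.range N, (formalPower R f q k (A k) w).vec) z‖ ≤ ε := fun z hz => by
    have h1 : rayOp Q (fun w => (W w).vec
        - ∑ k ∈ Finset.range N, (formalPower R f q k (A k) w).vec) z = (X z).vec := by
      rw [rayOp_sub (k := Q) hQ hstar hvc (continuousOn_finsetSum _ fun l _ => (hZ l).2) (hKΩ hz),
        rayOp_sum (k := Q) hQ hstar (fun l => (hZ l).2) (hKΩ hz), hX, vec_sub, vec_sum, vec_mk]
      congr 1
      exact Finset.sum_congr rfl fun k _ =>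
        (S.rayOp_formalPower h hp k (A k) (hΩR z (hKΩ hz))).2
    rw [h1]
    linarith [norm_vec_le_eval (X z), hXI z hz, hXI' z hz]
  have hKR : ∀ z ∈ K, ‖z‖ ≤ R := fun z hz => (hΩR z (hKΩ hz)).le
  intro z hz
  have e₁ := hb₁ K hK hKs hKR _ ((huc.sub (continuousOn_finsetSum _ fun l _ => (hZ l).1)).mono hKΩ)
    ε hsc z hz
  have e₂ := hb₂ K hK hKs hKR _ ((hvc.sub (continuousOn_finsetSum _ fun l _ => (hZ l).2)).mono hKΩ)
    ε hvec z hz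
  refine (norm_le_sc_add_vec _).trans ?_
  rw [sc_sub, vec_sub, sc_sum, vec_sum, add_mul]
  exact add_le_add e₁ e₂

end Transform

section Completeness

variable {R : ℝ} {f q : ℝ → ℂ} {Ω : Set ℂ}

theorem PolynomiallyApproximable.exists_coeff_ne_zero {K : Set ℂ} {g : ℂ → ℂ} (hK : IsCompact K)
    (h : PolynomiallyApproximable K g) {ε : ℝ} (hε : 0 < ε) (N₀ : ℕ) :
    ∃ (P : Polynomial ℂ) (N : ℕ), N₀ ≤ N ∧ P.natDegree ≤ N ∧ P.coeff N ≠ 0 ∧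
      ∀ z ∈ K, ‖g z - P.eval z‖ ≤ ε := by
  obtain ⟨P, hP⟩ := h (ε / 2) (half_pos hε)
  set N : ℕ := max N₀ (P.natDegree + 1) with hN
  obtain ⟨B, hB⟩ := hK.exists_bound_of_continuousOn (f := fun z : ℂ => z ^ N) (by fun_prop)
  set δ : ℝ := ε / 2 / (|B| + 1) with hδ
  have hδ0 : 0 < δ := by positivity
  have hdeg : P.natDegree < N := lt_of_lt_of_le (Nat.lt_succ_self _) (le_max_right _ _)
  refine ⟨P + Polynomial.C (δ : ℂ) * Polynomial.X ^ N, N, le_max_left _ _,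
    Polynomial.natDegree_add_le_of_degree_le hdeg.le (Polynomial.natDegree_C_mul_X_pow_le _ _),
    ?_, fun z hz => ?_⟩
  · rw [Polynomial.coeff_add, Polynomial.coeff_eq_zero_of_natDegree_lt hdeg,
      Polynomial.coeff_C_mul_X_pow]
    simpa using hδ0.ne'
  · simp only [Polynomial.eval_add, Polynomial.eval_mul, Polynomial.eval_C, Polynomial.eval_pow,
      Polynomial.eval_X]
    rw [← sub_sub]
    refine (norm_sub_le _ _).trans ?_
    have h1 : ‖(δ : ℂ) * z ^ N‖ ≤ ε / 2 := by
      rw [norm_mul, Complex.norm_real, Real.norm_of_nonneg hδ0.le]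
      calc δ * ‖z ^ N‖ ≤ δ * (|B| + 1) := by
            gcongr
            linarith [hB z hz, le_abs_self B]
        _ = ε / 2 := by
            rw [hδ]
            field_simp
    linarith [hP z hz]

theorem exists_starConvex_isCompact {K : Set ℂ} (hstar : StarConvex ℝ (0 : ℂ) Ω)
    (hK : IsCompact K) (hKΩ : K ⊆ Ω) :
    ∃ K' : Set ℂ, IsCompact K' ∧ StarConvex ℝ (0 : ℂ) K' ∧ K ⊆ K' ∧ K' ⊆ Ω := by
  refine ⟨(fun x : ℝ × ℂ => (x.1 : ℂ) * x.2) '' (Icc (0 : ℝ) 1 ×ˢ K),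
    (isCompact_Icc.prod hK).image (by fun_prop), ?_, fun z hz => ?_, ?_⟩
  · rintro _ ⟨⟨t, w⟩, ⟨ht, hw⟩, rfl⟩ a b ha hb hab
    refine ⟨(b * t, w), ⟨⟨mul_nonneg hb ht.1, ?_⟩, hw⟩, ?_⟩
    · exact mul_le_one₀ (by linarith) ht.1 ht.2
    · simp [Complex.real_smul, mul_assoc]
  · exact ⟨(1, z), ⟨by simp, hz⟩, by simp⟩
  · rintro _ ⟨⟨t, w⟩, ⟨ht, hw⟩, rfl⟩
    exact real_mul_mem_of_starConvex hstar (hKΩ hw) ht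

/-- The formal polynomials are dense in the space of solutions. -/
theorem IsSetting.exists_formalPolynomials_tendsto (S : IsSetting R f q) (hΩ : IsOpen Ω)
    (hΩR : ∀ z ∈ Ω, ‖z‖ < R) (hstar : StarConvex ℝ (0 : ℂ) Ω) (h0 : (0 : ℂ) ∈ Ω)
    {W : ℂ → Bicomplex} (hW : W ∈ vekuaSolutions Ω f) {K : Set ℂ} (hK : IsCompact K)
    (hKΩ : K ⊆ Ω) :
    ∃ F : ℕ → ℂ → Bicomplex, (∀ l, F l ∈ formalPolynomials R f q) ∧
      TendstoUniformlyOn F W atTop K := by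
  obtain ⟨h₁, h₂, hd₁, hd₂, C, hC, hest⟩ := S.exists_holomorphic_pair hΩ hΩR hstar h0 hW
  obtain ⟨K', hK', hKs', hKK', hKΩ'⟩ := exists_starConvex_isCompact hstar hK hKΩ
  have hconj : Continuous (starRingEnd ℂ) := Complex.continuous_conj
  have hKc : IsCompact (starRingEnd ℂ '' K') := hK'.image hconj
  have hKcs : StarConvex ℝ (0 : ℂ) (starRingEnd ℂ '' K') := by
    rintro _ ⟨z, hz, rfl⟩ a b ha hb hab
    exact ⟨_, hKs' hz ha hb hab, by simp [Complex.real_smul]⟩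
  have hKcΩ : starRingEnd ℂ '' K' ⊆ starRingEnd ℂ ⁻¹' Ω := by
    rintro _ ⟨z, hz, rfl⟩
    simpa using hKΩ' hz
  have happ₁ := PolynomiallyApproximable.of_differentiableOn hΩ hK' hKs' hKΩ' hd₁
  have happ₂ := PolynomiallyApproximable.of_differentiableOn (hΩ.preimage hconj) hKc hKcs hKcΩ hd₂
  have key : ∀ ε > 0, ∃ F ∈ formalPolynomials R f q, ∀ z ∈ K, ‖W z - F z‖ ≤ C * ε := by
    intro ε hε
    obtain ⟨P₂, hP₂⟩ := happ₂ ε hε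
    obtain ⟨P₁, N, hN, hdeg, hcoeff, hP₁⟩ := happ₁.exists_coeff_ne_zero hK' hε P₂.natDegree
    refine ⟨_, ⟨N, fun k => ofEvals (P₁.coeff k) (P₂.coeff k), fun hA => hcoeff ?_, rfl⟩,
      fun z hz => hest K' hK' hKs' hKΩ' (N + 1) _ ε (fun z hz => ?_) (fun z hz => ?_) z (hKK' hz)⟩
    · have hA' : ofEvals (P₁.coeff N) (P₂.coeff N) = 0 := hA
      rw [← eval_I_ofEvals (P₁.coeff N) (P₂.coeff N), hA']
      simp [eval]
    · simp only [eval_I_ofEvals]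
      rw [← Polynomial.eval_eq_sum_range' (Nat.lt_succ_of_le hdeg)]
      exact hP₁ z hz
    · simp only [eval_neg_I_ofEvals]
      rw [← Polynomial.eval_eq_sum_range' (Nat.lt_succ_of_le hN)]
      exact hP₂ _ ⟨z, hz, rfl⟩
  choose! F hF hFe using key
  have hpos : ∀ l : ℕ, (0 : ℝ) < 1 / ((l : ℝ) + 1) := fun l => by positivity
  refine ⟨fun l => F (1 / ((l : ℝ) + 1)), fun l => hF _ (hpos l), ?_⟩
  rw [Metric.tendstoUniformlyOn_iff]
  intro ε hε
  have hlim : Tendsto (fun l : ℕ => C * (1 / ((l : ℝ) + 1))) atTop (𝓝 (C * 0)) :=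
    tendsto_one_div_add_atTop_nhds_zero_nat.const_mul C
  rw [mul_zero] at hlim
  filter_upwards [hlim.eventually (gt_mem_nhds hε)] with l hl z hz
  rw [dist_eq_norm]
  exact (hFe _ (hpos l) z hz).trans_lt hl

/-- The bound for the formal powers in terms of the two values of the coefficient. -/
theorem IsSetting.exists_norm_formalPower_le (S : IsSetting R f q) :
    ∃ C : ℝ, 0 ≤ C ∧ ∀ (k : ℕ) (A : Bicomplex) (z : ℂ), ‖z‖ ≤ R →
      ‖formalPower R f q k A z‖ ≤
        C * ((‖eval Complex.I A‖ + ‖eval (-Complex.I) A‖) * ‖z‖ ^ k) := by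
  obtain ⟨K₁, hK₁⟩ := exists_norm_radialFactor_le S.isKernel
  obtain ⟨K₂, hK₂⟩ := exists_norm_radialFactor_le S.isKernel'
  refine ⟨|K₁| + |K₂|, by positivity, fun k A z hz => ?_⟩
  have hr : ‖z‖ ∈ Icc 0 R := ⟨norm_nonneg z, hz⟩
  have h1 : ‖scFactor R q k ‖z‖‖ ≤ |K₁| := (hK₁ k _ hr).trans (le_abs_self _)
  have h2 : ‖vecFactor R f q k ‖z‖‖ ≤ |K₂| := (hK₂ k _ hr).trans (le_abs_self _)
  have hsc := norm_sc_le_eval (A * hat z ^ k)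
  have hvec := norm_vec_le_eval (A * hat z ^ k)
  rw [eval_mul_hat_pow, eval_neg_mul_hat_pow, norm_mul, norm_mul, norm_pow, norm_pow,
    Complex.norm_conj, ← add_mul] at hsc hvec
  set E : ℝ := (‖eval Complex.I A‖ + ‖eval (-Complex.I) A‖) * ‖z‖ ^ k
  have hE : 0 ≤ E := by positivity
  rw [S.formalPower_eq k A hz]
  refine (norm_le_sc_add_vec _).trans ?_
  rw [sc_mk, vec_mk, norm_mul, norm_mul]
  calc _ ≤ |K₁| * E + |K₂| * E := by
        gcongr
        · linarith
        · linarith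
    _ = _ := by ring

/-- The expansion of the solutions in a disk. -/
theorem IsSetting.exists_expansion (S : IsSetting R f q) {W : ℂ → Bicomplex}
    (hW : W ∈ vekuaSolutions (Metric.ball 0 R) f) :
    ∃ A : ℕ → Bicomplex,
      (∀ z ∈ Metric.ball (0 : ℂ) R, Summable (fun k => ‖formalPower R f q k (A k) z‖) ∧
        HasSum (fun k => formalPower R f q k (A k) z) (W z)) ∧
      ∀ K : Set ℂ, IsCompact K → K ⊆ Metric.ball 0 R →
        TendstoUniformlyOn (fun N z => ∑ k ∈ Finset.range N, formalPower R f q k (A k) z) W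
          atTop K ∧
        TendstoUniformlyOn (fun N z => ∑ k ∈ Finset.range N, ‖formalPower R f q k (A k) z‖)
          (fun z => ∑' k, ‖formalPower R f q k (A k) z‖) atTop K := by
  have hball : ∀ z ∈ Metric.ball (0 : ℂ) R, ‖z‖ < R := fun z hz => by simpa using hz
  have h0 : (0 : ℂ) ∈ Metric.ball (0 : ℂ) R := Metric.mem_ball_self S.pos
  obtain ⟨h₁, h₂, hd₁, hd₂, C, hC, hest⟩ := S.exists_holomorphic_pair Metric.isOpen_ball hball
    ((convex_ball (0 : ℂ) R).starConvex h0) h0 hW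
  have hconj : starRingEnd ℂ ⁻¹' Metric.ball (0 : ℂ) R = Metric.ball 0 R := by
    ext z
    simp
  rw [hconj] at hd₂
  obtain ⟨B, hB, hbound⟩ := S.exists_norm_formalPower_le
  have taylor : ∀ h : ℂ → ℂ, DifferentiableOn ℂ h (Metric.ball 0 R) →
      ∃ α : ℕ → ℂ, (∀ z ∈ Metric.ball (0 : ℂ) R, HasSum (fun k => α k * z ^ k) (h z)) ∧
        ∀ r ∈ Ioo 0 R, Summable (fun k => ‖α k‖ * r ^ k) := fun h hd => by
    have hs : ∀ z ∈ Metric.ball (0 : ℂ) R,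
        HasSum (fun k : ℕ => ((k.factorial : ℂ)⁻¹ * iteratedDeriv k h 0) * z ^ k) (h z) :=
      fun z hz => by
        refine (Complex.hasSum_taylorSeries_on_ball hd hz).congr_fun fun k => ?_
        simp only [sub_zero, smul_eq_mul]
        ring
    refine ⟨_, hs, fun r hr => ?_⟩
    have h1 := (hs (r : ℂ) (by simpa [abs_of_pos hr.1] using hr.2)).summable.norm
    refine h1.congr fun k => ?_
    rw [norm_mul _ ((r : ℂ) ^ k), norm_pow, Complex.norm_real, Real.norm_of_nonneg hr.1.le]
  obtain ⟨α, hα, hαs⟩ := taylor h₁ hd₁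
  obtain ⟨β, hβ, hβs⟩ := taylor h₂ hd₂
  set A : ℕ → Bicomplex := fun k => ofEvals (α k) (β k)
  have hsmall : ∀ r ∈ Ioo 0 R, Summable (fun k => B * ((‖α k‖ + ‖β k‖) * r ^ k)) := fun r hr => by
    simp only [add_mul]
    exact ((hαs r hr).add (hβs r hr)).mul_left B
  have hterm : ∀ r ∈ Ioo 0 R, ∀ k, ∀ z ∈ Metric.closedBall (0 : ℂ) r,
      ‖formalPower R f q k (A k) z‖ ≤ B * ((‖α k‖ + ‖β k‖) * r ^ k) := fun r hr k z hz => by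
    have hz' : ‖z‖ ≤ r := by simpa using hz
    refine (hbound k (A k) z (hz'.trans hr.2.le)).trans ?_
    rw [eval_I_ofEvals, eval_neg_I_ofEvals]
    gcongr
  have hunif : ∀ r ∈ Ioo 0 R, TendstoUniformlyOn
      (fun N z => ∑ k ∈ Finset.range N, formalPower R f q k (A k) z) W atTop
      (Metric.closedBall 0 r) := fun r hr => by
    have hsub : Metric.closedBall (0 : ℂ) r ⊆ Metric.ball 0 R := Metric.closedBall_subset_ball hr.2
    have power : ∀ (h : ℂ → ℂ) (α : ℕ → ℂ),
        (∀ z ∈ Metric.ball (0 : ℂ) R, HasSum (fun k => α k * z ^ k) (h z)) →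
        Summable (fun k => ‖α k‖ * r ^ k) →
        TendstoUniformlyOn (fun N z => ∑ k ∈ Finset.range N, α k * z ^ k) h atTop
          (Metric.closedBall 0 r) := fun h α hα hαs => by
      refine (tendstoUniformlyOn_tsum_nat hαs fun k z hz => ?_).congr_right fun z hz =>
        (hα z (hsub hz)).tsum_eq
      have hz' : ‖z‖ ≤ r := by simpa using hz
      rw [norm_mul, norm_pow]
      gcongr
    have u₁ := power h₁ α hα (hαs r hr)
    have u₂ := power h₂ β hβ (hβs r hr)
    rw [Metric.tendstoUniformlyOn_iff] at u₁ u₂ ⊢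
    intro ε hε
    have hε' : 0 < ε / (2 * C) := by positivity
    filter_upwards [u₁ _ hε', u₂ _ hε'] with N hN₁ hN₂ z hz
    rw [dist_eq_norm]
    have h1 := hest (Metric.closedBall 0 r) (isCompact_closedBall 0 r)
      ((convex_closedBall (0 : ℂ) r).starConvex (Metric.mem_closedBall_self hr.1.le)) hsub N A
      (ε / (2 * C)) (fun z hz => by
        simp only [A, eval_I_ofEvals]
        have := hN₁ z hz
        rw [dist_eq_norm] at this
        exact this.le) (fun z hz => by
        simp only [A, eval_neg_I_ofEvals]
        have := hN₂ (starRingEnd ℂ z) (by simpa using hz)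
        rw [dist_eq_norm] at this
        exact this.le) z hz
    refine h1.trans_lt ?_
    have : C * (ε / (2 * C)) = ε / 2 := by field_simp
    linarith
  refine ⟨A, fun z hz => ?_, fun K hK hKb => ?_⟩
  · obtain ⟨r, hzr, hrR⟩ := exists_between (hball z hz)
    have hr : r ∈ Ioo 0 R := ⟨(norm_nonneg z).trans_lt hzr, hrR⟩
    have hzr' : z ∈ Metric.closedBall (0 : ℂ) r := by simpa using hzr.le
    have hs : Summable fun k => ‖formalPower R f q k (A k) z‖ :=
      (hsmall r hr).of_nonneg_of_le (fun k => norm_nonneg _) fun k => hterm r hr k z hzr'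
    exact ⟨hs, (hasSum_iff_tendsto_nat_of_summable_norm hs).2 ((hunif r hr).tendsto_at hzr')⟩
  · obtain ⟨r, hr, hKr⟩ := exists_pos_lt_subset_ball S.pos hK.isClosed hKb
    have hKr' : K ⊆ Metric.closedBall 0 r := hKr.trans Metric.ball_subset_closedBall
    refine ⟨(hunif r hr).mono hKr', ?_⟩
    exact tendstoUniformlyOn_tsum_nat (hsmall r hr) fun k z hz => by
      rw [norm_norm]
      exact hterm r hr k z (hKr' hz)

theorem norm_lt_outerRadius (hΩ : IsOpen Ω) (hb : Bornology.IsBounded Ω) {z : ℂ} (hz : z ∈ Ω) :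
    ‖z‖ < outerRadius Ω := by
  obtain ⟨ε, hε, hball⟩ := Metric.isOpen_iff.1 hΩ z hz
  obtain ⟨e, he, hze⟩ : ∃ e : ℂ, ‖e‖ = 1 ∧ z = ‖z‖ * e := by
    rcases eq_or_ne z 0 with rfl | hz0
    · exact ⟨1, by simp, by simp⟩
    · have hn : ‖z‖ ≠ 0 := norm_ne_zero_iff.2 hz0
      have hn' : (‖z‖ : ℂ) ≠ 0 := by exact_mod_cast hn
      exact ⟨z / ‖z‖, by simp [hn], by field_simp⟩
  set w : ℂ := ((‖z‖ + ε / 2 : ℝ) : ℂ) * e with hw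
  have hwn : ‖w‖ = ‖z‖ + ε / 2 := by
    rw [hw, norm_mul, he, mul_one, Complex.norm_real, Real.norm_of_nonneg (by positivity)]
  have hwΩ : w ∈ Ω := by
    refine hball ?_
    have : w - z = ((ε / 2 : ℝ) : ℂ) * e := by
      conv_lhs => rw [hze]
      rw [hw]
      push_cast
      ring
    rw [mem_ball_iff_norm, this, norm_mul, he, mul_one, Complex.norm_real,
      Real.norm_of_nonneg (by positivity)]
    linarith
  obtain ⟨M, hM⟩ := hb.exists_norm_le
  have hle : ‖w‖ ≤ outerRadius Ω := by
    refine le_csSup ⟨M, ?_⟩ ⟨w, hwΩ, rfl⟩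
    rintro _ ⟨x, hx, rfl⟩
    exact hM x hx
  linarith

end Completeness

end RadialVekua

theorem mainTheorem1
    (Ω : Set ℂ) (hΩ_open : IsOpen Ω) (hΩ_bdd : Bornology.IsBounded Ω)
    (hΩ_zero : (0 : ℂ) ∈ Ω) (hΩ_star : StarConvex ℝ (0 : ℂ) Ω)
    (R : ℝ) (hR : R = RadialVekua.outerRadius Ω)
    (f q : ℝ → ℂ)
    (hq : ContDiffOn ℝ 1 q (Set.Icc 0 R))
    (hf : ContDiffOn ℝ 2 f (Set.Icc 0 R))
    (hf_ne : ∀ r ∈ Set.Icc 0 R, f r ≠ 0)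
    (hf_zero : f 0 = 1)
    (hf_eq : ∀ r ∈ Set.Ioo 0 R, deriv (deriv f) r + (1 / (r : ℂ)) * deriv f r - q r * f r = 0) :
    (∀ (n : ℕ) (A : Bicomplex),
      RadialVekua.formalPower R f q n A ∈ RadialVekua.vekuaSolutions Ω f) ∧
    ∀ W ∈ RadialVekua.vekuaSolutions Ω f,
      (∀ K : Set ℂ, IsCompact K → K ⊆ Ω →
        ∃ S : ℕ → ℂ → Bicomplex, (∀ m, S m ∈ RadialVekua.formalPolynomials R f q) ∧
          TendstoUniformlyOn S W Filter.atTop K) ∧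
      (Ω = Metric.ball (0 : ℂ) R →
        ∃ A : ℕ → Bicomplex,
          (∀ z ∈ Ω, Summable (fun n => ‖RadialVekua.formalPower R f q n (A n) z‖) ∧
            HasSum (fun n => RadialVekua.formalPower R f q n (A n) z) (W z)) ∧
          ∀ K : Set ℂ, IsCompact K → K ⊆ Ω →
            TendstoUniformlyOn
              (fun N z => ∑ n ∈ Finset.range N, RadialVekua.formalPower R f q n (A n) z)
              W Filter.atTop K ∧
            TendstoUniformlyOn
              (fun N z => ∑ n ∈ Finset.range N, ‖RadialVekua.formalPower R f q n (A n) z‖)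
              (fun z => ∑' n, ‖RadialVekua.formalPower R f q n (A n) z‖)
              Filter.atTop K) := by
  have hnorm : ∀ z ∈ Ω, ‖z‖ < R := fun z hz => by
    rw [hR]
    exact RadialVekua.norm_lt_outerRadius hΩ_open hΩ_bdd hz
  have S : RadialVekua.IsSetting R f q :=
    ⟨by simpa using hnorm 0 hΩ_zero, hq, hf, hf_ne, hf_zero, hf_eq⟩
  refine ⟨RadialVekua.formalPower_mem_vekuaSolutions S hΩ_open hnorm, fun W hW =>
    ⟨fun K hK hKΩ => S.exists_formalPolynomials_tendsto hΩ_open hnorm hΩ_star hΩ_zero hW hK hKΩ,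
      fun hΩ => ?_⟩⟩
  subst hΩ
  exact S.exists_expansion hW
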